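/- Let $m\ge 2$, $\rho_1,\dots,\rho_m\in\mathbb C$, and let $z_1(t)\equiv 0, z_2(t),\dots,z_m(t)$ be pairwise distinct, continuously differentiable functions of a real or complex parameter $t$ in an open set $S$. Put $W(z)=\prod_{j=1}^m (z-z_j)$ and let $V$ be the polynomial with $2V(z)/W(z)=\sum_{j=1}^m \rho_j/(z-z_j)$, where $\rho_j=2V(z_j)/W'(z_j)\notin\mathbb Z_{\ge 0}$. For $t\in S$ let $w(\zeta)=w(\zeta;t)$ be a (complex) regular semi-classical weight on the unit circle $\mathbb T$: $w,w'\in L^1(\mathbb T)$ and $Ww'=2Vw$ on $\mathbb T\setminus\{z_1,\dots,z_m\}$, and suppose it is deformed according to $$\dot w(\zeta)=-\sum_{j=1}^m\rho_j\frac{\dot z_j}{\zeta-z_j}\,w(\zeta),\qquad \zeta\in\mathbb T\setminus\{z_1,\dots,z_m\},\qquad \dot{}=\frac{d}{dt}.$$ Let $n\ge 1$ and suppose that for every $t\in S$ there are bi-orthonormal polynomials $\phi_k,\bar\phi_k$ ($0\le k\le n$) of exact degree $k$ with the same leading coefficient $\kappa_k$, i.e. $$\int_{\mathbb T}\frac{d\zeta}{2\pi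 i\zeta}\,w(\zeta)\phi_j(\zeta)\bar\phi_k(\bar\zeta)=\delta_{j,k}$$ ($\bar\phi_k$ need not be the complex conjugate of $\phi_k$). Put $r_n=\phi_n(0)/\kappa_n$, $\bar r_n=\bar\phi_n(0)/\kappa_n$, $\phi_k^*(z)=z^k\bar\phi_k(1/z)$, $F(z)=\int_{\mathbb T}\frac{d\zeta}{2\pi i\zeta}\frac{\zeta+z}{\zeta-z}w(\zeta)$, $\epsilon_k=\psi_k+F\phi_k$, $\epsilon_k^*=\psi_k^*-F\phi_k^*$, where $\psi_0=\psi_0^*=1/\kappa_0$ and, for $k\ge 1$, $$\psi_k(z)=\int_{\mathbb T}\frac{d\zeta}{2\pi i\zeta}\frac{\zeta+z}{\zeta-z}w(\zeta)[\phi_k(\zeta)-\phi_k(z)],\qquad \psi^*_k(z)=-\int_{\mathbb T}\frac{d\zeta}{2\pi i\zeta}\frac{\zeta+z}{\zeta-z}w(\zeta)[z^k\bar\phi_k(\bar\zeta)-\phi^*_k(z)].$$ Let $t\in S$. (a) If $r_n(t)\ne0$, there is a unique polynomial $\Omega_{n-1}$ with $$2\frac{\phi_n(0)}{\kappa_{n-1}}z^{n-1}\Omega_{n-1}=W(\epsilon_n\phi_{n-1}'-\phi_n\epsilon_{n-1}')+V(\phi_{n-1}\epsilon_n+\epsilon_{n-1}\phi_n)\qquad(|z|\ne1),$$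 $r_n$ is differentiable at $t$, and $$\frac{\dot r_n}{r_n}=\frac12\sum_{j}\rho_j\frac{\dot z_j}{z_j}\,\frac{\Omega_{n-1}(z_j)-V(z_j)}{V(z_j)}.$$ (b) If $\bar r_n(t)\ne0$, there is a unique polynomial $\Omega^*_{n-1}$ with $$2\frac{\bar\phi_n(0)}{\kappa_{n-1}}z^{n}\Omega^*_{n-1}=W(-\epsilon^*_n\phi^{*\prime}_{n-1}+\phi^*_n\epsilon^{*\prime}_{n-1})-V(\phi^*_{n-1}\epsilon^*_n+\epsilon^*_{n-1}\phi^*_n)\qquad(|z|\ne1),$$ $\bar r_n$ is differentiable at $t$, and $$\frac{\dot{\bar r}_n}{\bar r_n}=\frac12\sum_{j}\rho_j\frac{\dot z_j}{z_j}\,\frac{\Omega^*_{n-1}(z_j)+V(z_j)}{V(z_j)}.$$ In both sums the fixed singular point $z_1=0$ contributes nothing, so $j$ runs over $2,\dots,m$. -/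

import Mathlib

open Polynomial

noncomputable section

namespace Biorth

/-- The normalised integral `∫_𝕋 dζ / (2πiζ) f(ζ)` over the unit circle. -/
def circMean (f : ℂ → ℂ) : ℂ :=
  (2 * (Real.pi : ℂ) * Complex.I)⁻¹ * ∮ ζ in C(0, 1), f ζ / ζ

/-- The monic polynomial `W(z) = ∏_j (z - z_j)` with zeros at the finite singular points. -/
def polyW {m : ℕ} (z : Fin m → ℂ) : ℂ[X] := ∏ j, (X - C (z j))

/-- The polynomial `V` with `2 V / W = ∑_j ρ_j / (z - z_j)`. -/
def polyV {m : ℕ} (z ρ : Fin m → ℂ) : ℂ[X] :=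
  C (1 / 2) * ∑ j, C (ρ j) * ∏ k ∈ Finset.univ.erase j, (X - C (z k))

/-- `w` is a regular semi-classical weight on the unit circle: `w` and its derivative `w'`
(along the circle) are integrable, `W w' = 2 V w` away from the zeros of `W`, and the polynomials
`W`, `V` satisfy: `deg W ≥ 2`, `deg V < deg W`, the zeros of `W` are distinct, and no residue
`2 V(x) / W'(x)` at a zero `x` of `W` is a non-negative integer. Only the values of `w` on the
unit circle matter. -/
structure IsRegularSemiclassical (W V : ℂ[X]) (w : ℂ → ℂ) : Prop where
  two_le_natDegree : 2 ≤ W.natDegree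
  degree_lt : V.degree < W.degree
  nodup_roots : W.roots.Nodup
  residue_ne : ∀ x ∈ W.roots, ∀ k : ℕ, 2 * V.eval x / W.derivative.eval x ≠ (k : ℂ)
  integrable : CircleIntegrable w 0 1
  integrable_deriv : CircleIntegrable (derivWithin w (Metric.sphere 0 1)) 0 1
  differentiable : ∀ ζ ∈ Metric.sphere (0 : ℂ) 1, W.eval ζ ≠ 0 →
    DifferentiableWithinAt ℂ w (Metric.sphere 0 1) ζ
  pearson : ∀ ζ ∈ Metric.sphere (0 : ℂ) 1, W.eval ζ ≠ 0 →
    W.eval ζ * derivWithin w (Metric.sphere 0 1) ζ = 2 * V.eval ζ * w ζ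

/-- `φ k`, `φbar k` for `k ≤ N` are the bi-orthonormal polynomials of the weight `w` up to
degree `N`: both have degree `k`, their leading coefficients agree, and
`∫ dζ/(2πiζ) w(ζ) φ_j(ζ) φbar_k(ζ̄) = δ_{jk}`. Here `φbar` need not be the complex conjugate
of `φ`. -/
structure IsBiorthonormal (w : ℂ → ℂ) (N : ℕ) (φ φbar : ℕ → ℂ[X]) : Prop where
  natDegree_eq : ∀ k ≤ N, (φ k).natDegree = k
  natDegree_bar_eq : ∀ k ≤ N, (φbar k).natDegree = k
  leadingCoeff_eq : ∀ k ≤ N, (φbar k).leadingCoeff = (φ k).leadingCoeff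
  orthonormal : ∀ j ≤ N, ∀ k ≤ N,
    circMean (fun ζ => w ζ * (φ j).eval ζ * (φbar k).eval ((starRingEnd ℂ) ζ)) =
      if j = k then 1 else 0

/-- The leading coefficient `κ_n` of `φ_n`. -/
def kappa (φ : ℕ → ℂ[X]) (n : ℕ) : ℂ := (φ n).leadingCoeff

/-- The reflection coefficient `r_n = φ_n(0) / κ_n`. -/
def reflCoeff (φ : ℕ → ℂ[X]) (n : ℕ) : ℂ := (φ n).eval 0 / kappa φ n

/-- The companion reflection coefficient `φbar_n(0) / κ_n`. -/
def reflCoeffBar (φ φbar : ℕ → ℂ[X]) (n : ℕ) : ℂ := (φbar n).eval 0 / kappa φ n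

/-- The reciprocal polynomial `φ*_n(z) = z^n φbar_n(1/z)`. -/
def recip (φbar : ℕ → ℂ[X]) (n : ℕ) : ℂ[X] :=
  ∑ j ∈ Finset.range (n + 1), C ((φbar n).coeff j) * X ^ (n - j)

/-- The Carathéodory function of the weight. -/
def carath (w : ℂ → ℂ) (z : ℂ) : ℂ := circMean (fun ζ => (ζ + z) / (ζ - z) * w ζ)

/-- The polynomials of the second kind `ψ_n`. -/
def psi (w : ℂ → ℂ) (φ : ℕ → ℂ[X]) (n : ℕ) (z : ℂ) : ℂ :=
  if n = 0 then 1 / kappa φ 0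
  else circMean (fun ζ => (ζ + z) / (ζ - z) * w ζ * ((φ n).eval ζ - (φ n).eval z))

/-- The reciprocal polynomials of the second kind `ψ*_n`. -/
def psiStar (w : ℂ → ℂ) (φ φbar : ℕ → ℂ[X]) (n : ℕ) (z : ℂ) : ℂ :=
  if n = 0 then 1 / kappa φ 0
  else -circMean (fun ζ => (ζ + z) / (ζ - z) * w ζ *
    (z ^ n * (φbar n).eval ((starRingEnd ℂ) ζ) - (recip φbar n).eval z))

/-- The associated function `ε_n = ψ_n + F φ_n`. -/
def eps (w : ℂ → ℂ) (φ : ℕ → ℂ[X]) (n : ℕ) (z : ℂ) : ℂ :=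
  psi w φ n z + carath w z * (φ n).eval z

/-- The reciprocal associated function `ε*_n = ψ*_n - F φ*_n`. -/
def epsStar (w : ℂ → ℂ) (φ φbar : ℕ → ℂ[X]) (n : ℕ) (z : ℂ) : ℂ :=
  psiStar w φ φbar n z - carath w z * (recip φbar n).eval z

/-- The polynomial `Ω` is the spectral coefficient function `Ω_n`, i.e.
`2 (φ_{n+1}(0)/κ_n) z^n Ω = W (ε_{n+1} φ_n' - φ_{n+1} ε_n') + V (φ_n ε_{n+1} + ε_n φ_{n+1})`
off the unit circle. -/
def IsOmega (W V : ℂ[X]) (w : ℂ → ℂ) (φ : ℕ → ℂ[X]) (n : ℕ) (Ω : ℂ[X]) : Prop :=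
  ∀ z : ℂ, ‖z‖ ≠ 1 →
    2 * ((φ (n + 1)).eval 0 / kappa φ n) * z ^ n * Ω.eval z =
      W.eval z * (eps w φ (n + 1) z * (φ n).derivative.eval z
          - (φ (n + 1)).eval z * deriv (eps w φ n) z)
        + V.eval z * ((φ n).eval z * eps w φ (n + 1) z + eps w φ n z * (φ (n + 1)).eval z)

/-- The polynomial `Ω` is the reciprocal spectral coefficient function `Ω*_n`, i.e.
`2 (φbar_{n+1}(0)/κ_n) z^(n+1) Ω = W (-ε*_{n+1} φ*_n' + φ*_{n+1} ε*_n')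
- V (φ*_n ε*_{n+1} + ε*_n φ*_{n+1})` off the unit circle. -/
def IsOmegaStar (W V : ℂ[X]) (w : ℂ → ℂ) (φ φbar : ℕ → ℂ[X]) (n : ℕ) (Ω : ℂ[X]) : Prop :=
  ∀ z : ℂ, ‖z‖ ≠ 1 →
    2 * ((φbar (n + 1)).eval 0 / kappa φ n) * z ^ (n + 1) * Ω.eval z =
      W.eval z * (-(epsStar w φ φbar (n + 1) z * (recip φbar n).derivative.eval z)
          + (recip φbar (n + 1)).eval z * deriv (epsStar w φ φbar n) z)
        - V.eval z * ((recip φbar n).eval z * epsStar w φ φbar (n + 1) z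
          + epsStar w φ φbar n z * (recip φbar (n + 1)).eval z)

end Biorth

end

open Biorth

noncomputable section

/-! ### Biorthogonal polynomials for an abstract shift-invariant bilinear form -/

namespace Biorth

/-! Let B(p,q) be the circle mean of w(ζ)p(ζ)q(1/ζ), and let β_x be the same form for the weight
w(ζ)/(ζ-x). Write β_j for β_x at x = z_j; it makes sense even for z_j on the circle, because the
Pearson equation and V(z_j) ≠ 0 force w/(ζ-z_j) to be integrable. The proof computes both sides of
the formula in terms of β_j.

Left side: the deformation gives Ḃ(p,q) = -∑ ρ_j ż_j β_j(p,q). The monic polynomial Φ of degree n+1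
has a variation of degree ≤ n, and B(Φ,q) = 0 for deg q ≤ n determines this variation. Since κ_n
times the reversed φ_n reproduces values at 0 (`IsToeplitzBiorth.reproducing`), ṙ_{n+1} equals
(κ_n/κ_{n+1}) ∑ ρ_j ż_j β_j(φ_{n+1}, reversed φ_n) (`hasDerivAt_reflCoeff`).

Right side: ε_k(x) = 2β_x(Xφ_k,1). Integration by parts gives these Cauchy transforms a first order
equation, in which the transcendental part of the expression defining Ω cancels; what remains is a
polynomial P, divisible by the required power of z because the Cauchy transforms vanish at 0 and
W(0) = 0. At z_j only the V term of P survives, and `IsCauchyForm.bilinear_concomitant` evaluates it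
through β_j(φ_{n+1}, reversed φ_n). Substitution yields (a). Part (b) follows the same route, with
the two arguments of B exchanged for the derivative and a companion identity for the reciprocal
polynomials.

The analytic difficulty is that z_j(t) may lie on the circle, reach it or leave it. Near such a
point |w| is comparable to |ζ-z_j|^{Re ρ_j} on either side; if Re ρ_j ≤ 0, integrability of
w/(ζ-z_j) makes w vanish on the adjacent arcs. So w tends to 0 there in every case, uniformly in t.
This removes the boundary terms in the integration by parts and makes the arcs of length O(|s-t|)
around the moving points negligible when differentiating under the integral. -/

lemma C_eq_smul_one' (c : ℂ) : (C c : ℂ[X]) = c • 1 := by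
  rw [smul_eq_C_mul, mul_one]

/-- Biorthonormal polynomials up to degree `N` for an abstract shift invariant bilinear form. -/
structure IsToeplitzBiorth (B : ℂ[X] →ₗ[ℂ] ℂ[X] →ₗ[ℂ] ℂ) (N : ℕ) (φ φbar : ℕ → ℂ[X]) : Prop where
  natDegree_eq : ∀ k ≤ N, (φ k).natDegree = k
  natDegree_bar_eq : ∀ k ≤ N, (φbar k).natDegree = k
  leadingCoeff_eq : ∀ k ≤ N, (φbar k).leadingCoeff = (φ k).leadingCoeff
  orthonormal : ∀ j ≤ N, ∀ k ≤ N, B (φ j) (φbar k) = if j = k then 1 else 0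

/-- Shift invariance of a bilinear form on polynomials, modelled on
`(p, q) ↦ ∫ p(ζ) q(1/ζ) dμ(ζ)`. -/
structure IsToeplitz (B : ℂ[X] →ₗ[ℂ] ℂ[X] →ₗ[ℂ] ℂ) : Prop where
  shift : ∀ p q, B (X * p) (X * q) = B p q
  mul_left : ∀ n p q, natDegree q ≤ n → B (p * q) (X ^ n) = B p (reflect n q)
  mul_right : ∀ n p q, natDegree q ≤ n → B (X ^ n) (p * q) = B (reflect n q) p

lemma IsToeplitz.flip {B : ℂ[X] →ₗ[ℂ] ℂ[X] →ₗ[ℂ] ℂ} (h : IsToeplitz B) : IsToeplitz B.flip :=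
  ⟨fun p q => h.shift q p, fun n p q hq => h.mul_right n p q hq,
    fun n p q hq => h.mul_left n p q hq⟩

lemma IsToeplitz.shift_pow {B : ℂ[X] →ₗ[ℂ] ℂ[X] →ₗ[ℂ] ℂ} (h : IsToeplitz B) (k : ℕ) (p q : ℂ[X]) :
    B (X ^ k * p) (X ^ k * q) = B p q := by
  induction k with
  | zero => simp
  | succ k ih => rw [pow_succ', mul_assoc, mul_assoc, h.shift, ih]

lemma IsToeplitz.apply_reflect {B : ℂ[X] →ₗ[ℂ] ℂ[X] →ₗ[ℂ] ℂ} (h : IsToeplitz B) {n : ℕ}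
    {p q : ℂ[X]} (hp : p.natDegree ≤ n) (hq : q.natDegree ≤ n) :
    B p (reflect n q) = B q (reflect n p) := by
  rw [← h.mul_left n p q hq, mul_comm, h.mul_left n q p hp]

namespace IsToeplitzBiorth

variable {B : ℂ[X] →ₗ[ℂ] ℂ[X] →ₗ[ℂ] ℂ} {N : ℕ} {φ φbar : ℕ → ℂ[X]}

lemma flip (h : IsToeplitzBiorth B N φ φbar) : IsToeplitzBiorth B.flip N φbar φ :=
  ⟨h.natDegree_bar_eq, h.natDegree_eq, fun k hk => (h.leadingCoeff_eq k hk).symm,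
    fun j hj k hk => by
      rw [LinearMap.flip_apply, h.orthonormal k hk j hj]
      simp [eq_comm]⟩

lemma ne_zero (h : IsToeplitzBiorth B N φ φbar) {k : ℕ} (hk : k ≤ N) : φ k ≠ 0 := by
  intro h0
  have := h.orthonormal k hk k hk
  simp [h0] at this

lemma kappa_ne_zero (h : IsToeplitzBiorth B N φ φbar) {k : ℕ} (hk : k ≤ N) : kappa φ k ≠ 0 :=
  leadingCoeff_ne_zero.mpr (h.ne_zero hk)

lemma kappa_bar (h : IsToeplitzBiorth B N φ φbar) {k : ℕ} (hk : k ≤ N) :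
    kappa φbar k = kappa φ k := h.leadingCoeff_eq k hk

lemma coeff_self (h : IsToeplitzBiorth B N φ φbar) {k : ℕ} (hk : k ≤ N) :
    (φ k).coeff k = kappa φ k := by
  rw [kappa, leadingCoeff, h.natDegree_eq k hk]

lemma exists_expansion (h : IsToeplitzBiorth B N φ φbar) {n : ℕ} (hn : n ≤ N) (p : ℂ[X])
    (hp : p.natDegree ≤ n) : ∃ c : ℕ → ℂ, p = ∑ k ∈ Finset.range (n + 1), c k • φ k := by
  induction n generalizing p with
  | zero =>
    refine ⟨fun _ => p.coeff 0 / kappa φ 0, ?_⟩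
    rw [eq_C_of_natDegree_le_zero hp]
    have h0 := h.coeff_self hn
    rw [Finset.sum_range_one, eq_C_of_natDegree_le_zero (h.natDegree_eq 0 hn).le, h0, smul_C]
    simp [div_mul_cancel₀ _ (h.kappa_ne_zero hn)]
  | succ n ih =>
    set q := p - (p.coeff (n + 1) / kappa φ (n + 1)) • φ (n + 1) with hq
    have hqd : q.natDegree ≤ n := by
      rw [natDegree_le_iff_coeff_eq_zero]
      intro m hm
      rcases Nat.lt_or_ge (n + 1) m with h1 | h1
      · rw [hq, coeff_sub, coeff_smul, coeff_eq_zero_of_natDegree_lt (hp.trans_lt h1),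
          coeff_eq_zero_of_natDegree_lt ((h.natDegree_eq _ hn).trans_lt h1)]
        simp
      · obtain rfl : m = n + 1 := by omega
        rw [hq, coeff_sub, coeff_smul, h.coeff_self hn, smul_eq_mul,
          div_mul_cancel₀ _ (h.kappa_ne_zero hn), sub_self]
    obtain ⟨c, hc⟩ := ih (by omega) q hqd
    refine ⟨fun k => if k = n + 1 then p.coeff (n + 1) / kappa φ (n + 1) else c k, ?_⟩
    rw [Finset.sum_range_succ]
    dsimp only
    rw [if_pos rfl]
    have : ∑ k ∈ Finset.range (n + 1),
        (if k = n + 1 then p.coeff (n + 1) / kappa φ (n + 1) else c k) • φ k = q := by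
      rw [hc]
      refine Finset.sum_congr rfl fun k hk => ?_
      rw [if_neg (by have := Finset.mem_range.mp hk; omega)]
    rw [this, hq, sub_add_cancel]

/-- The biorthogonal expansion of a polynomial. -/
lemma eq_sum (h : IsToeplitzBiorth B N φ φbar) {n : ℕ} (hn : n ≤ N) {p : ℂ[X]}
    (hp : p.natDegree ≤ n) : p = ∑ k ∈ Finset.range (n + 1), B p (φbar k) • φ k := by
  obtain ⟨c, hc⟩ := h.exists_expansion hn p hp
  conv_lhs => rw [hc]
  refine Finset.sum_congr rfl fun k hk => ?_
  have hk' := Finset.mem_range.mp hk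
  congr 1
  rw [hc, map_sum, LinearMap.sum_apply, Finset.sum_eq_single k]
  · simp [h.orthonormal k (by omega) k (by omega)]
  · intro j hj hjk
    have := Finset.mem_range.mp hj
    simp [h.orthonormal j (by omega) k (by omega), hjk]
  · intro h'; exact absurd hk h'

lemma apply_bar (h : IsToeplitzBiorth B N φ φbar) {n : ℕ} (hn : n ≤ N) {p : ℂ[X]}
    (hp : p.natDegree ≤ n) : B p (φbar n) = p.coeff n / kappa φ n := by
  rw [eq_div_iff (h.kappa_ne_zero hn)]
  have := congrArg (fun q => coeff q n) (h.eq_sum hn hp)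
  simp only [finsetSum_coeff, coeff_smul, smul_eq_mul] at this
  rw [this, Finset.sum_range_succ, Finset.sum_eq_zero, zero_add, h.coeff_self hn]
  intro k hk
  have := Finset.mem_range.mp hk
  rw [coeff_eq_zero_of_natDegree_lt (by rw [h.natDegree_eq k (by omega)]; exact this), mul_zero]

lemma apply_self (h : IsToeplitzBiorth B N φ φbar) {n : ℕ} (hn : n ≤ N) {q : ℂ[X]}
    (hq : q.natDegree ≤ n) : B (φ n) q = q.coeff n / kappa φ n := by
  rw [← LinearMap.flip_apply, h.flip.apply_bar hn hq, h.kappa_bar hn]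

lemma apply_bar_eq_zero (h : IsToeplitzBiorth B N φ φbar) {n : ℕ} (hn : n ≤ N) {p : ℂ[X]}
    (hp : p.natDegree < n) : B p (φbar n) = 0 := by
  rw [h.apply_bar hn hp.le, coeff_eq_zero_of_natDegree_lt hp, zero_div]

lemma apply_self_eq_zero (h : IsToeplitzBiorth B N φ φbar) {n : ℕ} (hn : n ≤ N) {q : ℂ[X]}
    (hq : q.natDegree < n) : B (φ n) q = 0 := by
  rw [h.apply_self hn hq.le, coeff_eq_zero_of_natDegree_lt hq, zero_div]

/-- The reversed polynomial `κ_n ζ⁻ⁿ φ_n(ζ)` reproduces values at the origin. -/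
lemma reproducing (h : IsToeplitzBiorth B N φ φbar) (hB : IsToeplitz B) {n : ℕ} (hn : n ≤ N)
    {p : ℂ[X]} (hp : p.natDegree ≤ n) :
    kappa φ n * B p (reflect n (φ n)) = p.eval 0 := by
  rw [hB.apply_reflect hp (h.natDegree_eq n hn).le, h.apply_self hn
    (natDegree_reflect_le.trans (by simp [hp])), coeff_reflect, revAt_le le_rfl, Nat.sub_self,
    mul_div_cancel₀ _ (h.kappa_ne_zero hn), coeff_zero_eq_eval_zero]

/-- The combination κ_n φbar_{n+1} - κ_{n+1} X φbar_n loses its top coefficient, so the reproducing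
property of the reversed φbar_n gives its value at 0. In that pairing only the constant term κ_n of
the reversed polynomial contributes: the rest is a multiple of X and is orthogonal to both pieces.
-/
lemma apply_one_X_mul_bar (h : IsToeplitzBiorth B N φ φbar) (hB : IsToeplitz B) {n : ℕ}
    (hn : n + 1 ≤ N) :
    B 1 (X * φbar n) = -((φbar (n + 1)).eval 0 / (kappa φ n * kappa φ (n + 1))) := by
  have hk := h.kappa_ne_zero (k := n) (by omega)
  have hk1 := h.kappa_ne_zero hn
  set q := kappa φ n • φbar (n + 1) - kappa φ (n + 1) • (X * φbar n) with hq
  have hqd : q.natDegree ≤ n := by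
    rw [natDegree_le_iff_coeff_eq_zero]
    intro m hm
    obtain ⟨m, rfl⟩ : ∃ k, m = k + 1 := ⟨m - 1, by omega⟩
    rw [hq, coeff_sub, coeff_smul, coeff_smul, coeff_X_mul]
    rcases Nat.lt_or_ge n m with h1 | h1
    · rw [coeff_eq_zero_of_natDegree_lt (by rw [h.natDegree_bar_eq _ hn]; omega),
        coeff_eq_zero_of_natDegree_lt (by rw [h.natDegree_bar_eq n (by omega)]; omega)]
      simp
    · obtain rfl : m = n := by omega
      rw [h.flip.coeff_self hn, h.flip.coeff_self (by omega), h.kappa_bar hn,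
        h.kappa_bar (by omega), smul_eq_mul, smul_eq_mul]
      ring
  have h1 := h.flip.reproducing hB.flip (n := n) (by omega) hqd
  rw [h.kappa_bar (by omega), LinearMap.flip_apply] at h1
  set p := reflect n (φbar n) with hp
  have hpd : p.natDegree ≤ n :=
    natDegree_reflect_le.trans (by simp [h.natDegree_bar_eq n (by omega)])
  have hp0 : p.coeff 0 = kappa φ n := by
    rw [hp, coeff_reflect, revAt_zero, h.flip.coeff_self (by omega), h.kappa_bar (by omega)]
  have hpX : B (X * p.divX) q = 0 := by
    rw [hq, map_sub, map_smul, map_smul, hB.shift, h.apply_bar hn, h.apply_bar (by omega),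
      coeff_divX, coeff_X_mul, coeff_divX, coeff_eq_zero_of_natDegree_lt (by omega)]
    · simp
    · rw [natDegree_divX_eq_natDegree_tsub_one]; omega
    · refine natDegree_mul_le.trans ?_
      rw [natDegree_divX_eq_natDegree_tsub_one, natDegree_X]; omega
  have h10 : B 1 (φbar (n + 1)) = 0 := h.apply_bar_eq_zero hn (by simp)
  have hp1 : p = kappa φ n • (1 : ℂ[X]) + X * p.divX := by
    conv_lhs => rw [← X_mul_divX_add p, hp0, add_comm, C_eq_smul_one']
  rw [hp1, map_add, LinearMap.add_apply, hpX, add_zero, map_smul, LinearMap.smul_apply, hq,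
    map_sub, map_smul, map_smul, h10] at h1
  simp only [smul_eq_mul, eval_sub, eval_smul, eval_mul, eval_X] at h1
  field_simp
  apply mul_left_cancel₀ hk
  linear_combination -h1

end IsToeplitzBiorth

/-- The bilinear form `β` is obtained from `B` by dividing the weight by `ζ - z`. -/
structure IsCauchyForm (B β : ℂ[X] →ₗ[ℂ] ℂ[X] →ₗ[ℂ] ℂ) (z : ℂ) : Prop where
  toeplitz : IsToeplitz β
  apply_mul : ∀ p q, β ((X - C z) * p) q = B p q

lemma natDegree_divByMonic_X_sub_C_le {p : ℂ[X]} {n : ℕ} (hp : p.natDegree ≤ n + 1) (z : ℂ) :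
    (p /ₘ (X - C z)).natDegree ≤ n := by
  rw [natDegree_divByMonic _ (monic_X_sub_C z), natDegree_X_sub_C]; omega

lemma exists_divided_difference {p : ℂ[X]} {n : ℕ} (hp : p.natDegree ≤ n + 1) {z : ℂ}
    (hz : p.eval z = 0) : ∃ Q : ℂ[X], Q.natDegree ≤ n ∧ p = (X - C z) * Q :=
  ⟨p /ₘ (X - C z), natDegree_divByMonic_X_sub_C_le hp z, (mul_divByMonic_eq_iff_isRoot.mpr hz).symm⟩

/-! ### Identities for the form with weight divided by ζ - z -/

namespace IsCauchyForm

variable {B β : ℂ[X] →ₗ[ℂ] ℂ[X] →ₗ[ℂ] ℂ} {z : ℂ} {N n : ℕ} {φ φbar : ℕ → ℂ[X]}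

lemma apply_X_mul (h : IsCauchyForm B β z) (p q : ℂ[X]) :
    β (X * p) q = z * β p q + B p q := by
  have := h.apply_mul p q
  rw [sub_mul, map_sub, LinearMap.sub_apply, ← smul_eq_C_mul, map_smul, LinearMap.smul_apply,
    smul_eq_mul] at this
  linear_combination this

/-- After shifting, X^(n+1) - z^(n+1) is a multiple of X - z, which turns β into B, and `φ (n + 1)`
is orthogonal to the result. The explicit power of z exhibits the vanishing of ε_{n+1} at the
origin; the primed variant below gives one power less than the degree shift would suggest, which is
what ε_n needs. -/
lemma apply_X_mul_self_one (h : IsCauchyForm B β z) (hφ : IsToeplitzBiorth B N φ φbar)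
    (hB : IsToeplitz B) (hn : n + 1 ≤ N) :
    β (X * φ (n + 1)) 1 = z ^ (n + 1) * β (φ (n + 1)) (X ^ n) := by
  obtain ⟨Q, hQ, hQe⟩ := exists_divided_difference (p := X ^ (n + 1) - C (z ^ (n + 1))) (n := n)
    (z := z) (natDegree_sub_C.trans_le (natDegree_X_pow_le _)) (by simp)
  have h1 : β ((X ^ (n + 1) - C (z ^ (n + 1))) * φ (n + 1)) (X ^ n) = 0 := by
    rw [hQe, mul_assoc, h.apply_mul, mul_comm, hB.mul_left n _ _ hQ, hφ.apply_self_eq_zero hn]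
    exact (natDegree_reflect_le.trans (max_le le_rfl hQ)).trans_lt (Nat.lt_succ_self n)
  have h2 := h.toeplitz.shift_pow n (X * φ (n + 1)) 1
  rw [mul_one, ← mul_assoc, ← pow_succ] at h2
  rw [sub_mul, map_sub, LinearMap.sub_apply, ← smul_eq_C_mul, map_smul, LinearMap.smul_apply,
    smul_eq_mul, h2] at h1
  linear_combination h1

lemma apply_X_mul_self_one' (h : IsCauchyForm B β z) (hφ : IsToeplitzBiorth B N φ φbar)
    (hB : IsToeplitz B) (hn : n ≤ N) :
    β (X * φ n) 1 = z ^ n * β (X * φ n) (X ^ n) := by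
  rcases n with _ | n
  · simp
  obtain ⟨Q, hQ, hQe⟩ := exists_divided_difference (p := X ^ (n + 1) - C (z ^ (n + 1))) (n := n)
    (z := z) (natDegree_sub_C.trans_le (natDegree_X_pow_le _)) (by simp)
  have hXQ : (X * Q).natDegree ≤ n + 1 := natDegree_mul_le.trans (by rw [natDegree_X]; omega)
  have h1 : β ((X ^ (n + 1) - C (z ^ (n + 1))) * (X * φ (n + 1))) (X ^ (n + 1)) = 0 := by
    rw [hQe, mul_assoc, h.apply_mul, show Q * (X * φ (n + 1)) = φ (n + 1) * (X * Q) by ring,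
      hB.mul_left (n + 1) _ _ hXQ, hφ.apply_self hn, coeff_reflect, revAt_le le_rfl, Nat.sub_self]
    · simp
    · exact natDegree_reflect_le.trans (max_le le_rfl hXQ)
  have h2 := h.toeplitz.shift_pow (n + 1) (X * φ (n + 1)) 1
  rw [mul_one] at h2
  rw [sub_mul, map_sub, LinearMap.sub_apply, ← smul_eq_C_mul, map_smul, LinearMap.smul_apply,
    smul_eq_mul, h2] at h1
  linear_combination h1

/-- For deg a ≤ n+1 the polynomial a(z)X^(n+1) - z^(n+1)a vanishes at z, so replacing a(z) by a
under β costs only a B-term. With a = φ_n this term vanishes by orthogonality; with a = φ_{n+1} it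
is the value at 0 of the quotient divided by κ_n, the source of the φ_{n+1}(0)/κ_n summand. -/
lemma bilinear_concomitant (h : IsCauchyForm B β z) (hφ : IsToeplitzBiorth B N φ φbar)
    (hB : IsToeplitz B) (hz : z ≠ 0) (hn : n + 1 ≤ N) :
    (φ n).eval z * β (X * φ (n + 1)) 1 + (φ (n + 1)).eval z * β (X * φ n) 1 =
      2 * z ^ (n + 1) * β (φ (n + 1)) (reflect n (φ n))
        + z ^ n * (φ (n + 1)).eval 0 / kappa φ n := by
  have hn' : n ≤ N := by omega
  have hfd := hφ.natDegree_eq _ hn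
  have hgd := hφ.natDegree_eq n hn'
  set f := φ (n + 1)
  set g := φ n
  have hk := hφ.kappa_ne_zero hn'
  have key : ∀ a b : ℂ[X], a.natDegree ≤ n + 1 →
      ∃ Q : ℂ[X], Q.natDegree ≤ n ∧ -z * Q.eval 0 = -z ^ (n + 1) * a.eval 0 ∧
      a.eval z * β (X * b) 1 = z ^ (n + 1) * β (a * b) (X ^ n) + B b (reflect n Q) := by
    intro a b ha
    obtain ⟨Q, hQ, hQe⟩ := exists_divided_difference
      (p := a.eval z • X ^ (n + 1) - z ^ (n + 1) • a) (n := n) (z := z)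
      ((natDegree_sub_le _ _).trans (max_le ((natDegree_smul_le _ _).trans (natDegree_X_pow_le _))
        ((natDegree_smul_le _ _).trans ha))) (by simp [mul_comm])
    refine ⟨Q, hQ, ?_, ?_⟩
    · have := congrArg (eval 0) hQe
      simp at this
      linear_combination this
    · have h1 : β ((a.eval z • X ^ (n + 1) - z ^ (n + 1) • a) * b) (X ^ n) = B b (reflect n Q) := by
        rw [hQe, mul_assoc, h.apply_mul, mul_comm, hB.mul_left n _ _ hQ]
      have h2 := h.toeplitz.shift_pow n (X * b) 1
      rw [mul_one, ← mul_assoc, ← pow_succ] at h2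
      rw [sub_mul, smul_mul_assoc, smul_mul_assoc, map_sub, LinearMap.sub_apply, map_smul, map_smul,
        LinearMap.smul_apply, LinearMap.smul_apply, smul_eq_mul, smul_eq_mul, h2] at h1
      linear_combination h1
  have hr : ∀ Q : ℂ[X], Q.natDegree ≤ n → (reflect n Q).natDegree ≤ n := fun Q hQ =>
    natDegree_reflect_le.trans (max_le le_rfl hQ)
  obtain ⟨Q₁, hQ₁, -, e₁⟩ := key g f (by omega)
  obtain ⟨Q₂, hQ₂, h0, e₂⟩ := key f g hfd.le
  rw [hφ.apply_self_eq_zero hn ((hr _ hQ₁).trans_lt (Nat.lt_succ_self n)), mul_comm g f] at e₁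
  rw [hφ.apply_self hn' (hr _ hQ₂), coeff_reflect, revAt_le le_rfl, Nat.sub_self,
    coeff_zero_eq_eval_zero] at e₂
  have h0' : Q₂.eval 0 = z ^ n * f.eval 0 := mul_left_cancel₀ (neg_ne_zero.mpr hz) (by
    rw [h0]; ring)
  rw [h0'] at e₂
  rw [e₁, e₂, ← h.toeplitz.mul_left n f g hgd.le]
  ring

lemma apply_reflect_bar_one (h : IsCauchyForm B β z) (hφ : IsToeplitzBiorth B N φ φbar)
    (hn : n ≤ N) :
    β (reflect n (φbar n)) 1 = z ^ n * β 1 (φbar n) := by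
  have h1 := h.toeplitz.mul_right n 1 (φbar n) (hφ.natDegree_bar_eq n hn).le
  rw [one_mul] at h1
  rw [← h1]
  rcases n with _ | n
  · simp
  obtain ⟨Q, hQ, hQe⟩ := exists_divided_difference (p := X ^ (n + 1) - C (z ^ (n + 1))) (n := n)
    (z := z) (natDegree_sub_C.trans_le (natDegree_X_pow_le _)) (by simp)
  have h2 : β (X ^ (n + 1) - C (z ^ (n + 1))) (φbar (n + 1)) = 0 := by
    rw [hQe, h.apply_mul, hφ.apply_bar_eq_zero hn (by omega)]
  rw [map_sub, LinearMap.sub_apply, C_eq_smul_one', map_smul, LinearMap.smul_apply,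
    smul_eq_mul] at h2
  linear_combination h2

/-- Each product of a value at z with β(1,φbar_k) is handled by a divided difference: g - g(z) for
the first, and f(z)X - zf for the second. The first quotient is orthogonal to φbar_{n+1}; the second
contributes through its constant term and `apply_one_X_mul_bar`. -/
lemma bilinear_concomitant_star (h : IsCauchyForm B β z) (hφ : IsToeplitzBiorth B N φ φbar)
    (hB : IsToeplitz B) (hz : z ≠ 0) (hn : n + 1 ≤ N) :
    z * ((reflect n (φbar n)).eval z * β (reflect (n + 1) (φbar (n + 1))) 1
      + (reflect (n + 1) (φbar (n + 1))).eval z * β (reflect n (φbar n)) 1) =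
      z ^ (n + 1) * (2 * z * β (reflect n (φbar n)) (φbar (n + 1))
        - (φbar (n + 1)).eval 0 / kappa φ n) := by
  have hn' : n ≤ N := by omega
  have hk := hφ.kappa_ne_zero hn'
  have hk1 := hφ.kappa_ne_zero hn
  have hfd := hφ.natDegree_bar_eq _ hn
  have hgd := hφ.natDegree_bar_eq n hn'
  rw [h.apply_reflect_bar_one hφ hn, h.apply_reflect_bar_one hφ hn']
  have hf0 : (reflect (n + 1) (φbar (n + 1))).eval 0 = kappa φ (n + 1) := by
    rw [← coeff_zero_eq_eval_zero, coeff_reflect, revAt_zero, hφ.flip.coeff_self hn,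
      hφ.kappa_bar hn]
  have hgf : β (reflect n (φbar n)) (φbar (n + 1)) =
      β (reflect (n + 1) (φbar (n + 1))) (X * φbar n) := by
    rw [← h.toeplitz.mul_right n _ _ hgd.le, ← h.toeplitz.mul_right (n + 1) _ _ hfd.le, pow_succ',
      mul_assoc, h.toeplitz.shift, mul_comm]
  have hfr : (reflect (n + 1) (φbar (n + 1))).natDegree ≤ n + 1 :=
    natDegree_reflect_le.trans (max_le le_rfl hfd.le)
  have hgr : (reflect n (φbar n)).natDegree ≤ n :=
    natDegree_reflect_le.trans (max_le le_rfl hgd.le)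
  set f := reflect (n + 1) (φbar (n + 1)) with hf
  set g := reflect n (φbar n) with hg
  have e₁ : g.eval z * β 1 (φbar (n + 1)) = β g (φbar (n + 1)) := by
    obtain ⟨Q, hQ, hQe⟩ := exists_divided_difference (p := g - C (g.eval z)) (n := n)
      (z := z) (natDegree_sub_C.trans_le (by omega)) (by simp)
    have h2 : β (g - C (g.eval z)) (φbar (n + 1)) = 0 := by
      rw [hQe, h.apply_mul, hφ.apply_bar_eq_zero hn (by omega)]
    rw [map_sub, LinearMap.sub_apply, C_eq_smul_one', map_smul, LinearMap.smul_apply,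
      smul_eq_mul] at h2
    linear_combination -h2
  have e₂ : f.eval z * β 1 (φbar n) =
      z * β g (φbar (n + 1)) - (φbar (n + 1)).eval 0 / kappa φ n := by
    obtain ⟨Q, hQ, hQe⟩ := exists_divided_difference (p := f.eval z • X - z • f) (n := n) (z := z)
      ((natDegree_sub_le _ _).trans (max_le ((natDegree_smul_le _ _).trans
        (natDegree_X_le.trans (by omega))) ((natDegree_smul_le _ _).trans hfr)))
      (by simp [mul_comm])
    have hQ0 : Q.coeff 0 = kappa φ (n + 1) := by
      have := congrArg (eval 0) hQe
      simp [hf0] at this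
      rw [coeff_zero_eq_eval_zero]
      rcases this with h | h
      · exact h.symm
      · exact absurd h hz
    have h3 : B Q (X * φbar n) = -((φbar (n + 1)).eval 0 / kappa φ n) := by
      -- For n = 0 the quotient is constant and no degree lies strictly below 0, so orthogonality of
      -- `Q.divX` to `φbar n` is available only for positive n.
      rcases n with _ | n
      · rw [eq_C_of_natDegree_le_zero hQ, hQ0, C_eq_smul_one', map_smul, LinearMap.smul_apply,
          hφ.apply_one_X_mul_bar hB hn, smul_eq_mul]
        field_simp
      rw [← X_mul_divX_add Q, hQ0, map_add, LinearMap.add_apply, hB.shift, hφ.apply_bar_eq_zero hn',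
        C_eq_smul_one', map_smul, LinearMap.smul_apply, hφ.apply_one_X_mul_bar hB hn, smul_eq_mul]
      · field_simp; simp
      · rw [natDegree_divX_eq_natDegree_tsub_one]; omega
    rw [← h.apply_mul, ← hQe, map_sub, LinearMap.sub_apply, map_smul, map_smul,
      LinearMap.smul_apply, LinearMap.smul_apply, ← hgf, smul_eq_mul, smul_eq_mul] at h3
    have h4 := h.toeplitz.shift 1 (φbar n)
    rw [mul_one] at h4
    rw [h4] at h3
    linear_combination h3
  linear_combination z ^ (n + 2) * e₁ + z ^ (n + 1) * e₂

end IsCauchyForm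

end Biorth

/-! ### Differentiating reflection coefficients through the bilinear form -/

namespace Biorth
open Filter Topology Asymptotics

/-- The difference quotient is c times that of g. No differentiability of c is needed, so mere
continuity of the expansion coefficients suffices below. -/
lemma hasDerivAt_mul_of_eq_zero {𝕜 : Type*} [RCLike 𝕜] [NormedAlgebra 𝕜 ℂ] {c g : 𝕜 → ℂ} {t : 𝕜}
    {g' : ℂ} (hc : Tendsto c (𝓝 t) (𝓝 0)) (hg : HasDerivAt g g' t) (hg0 : g t = 0) :
    HasDerivAt (fun s => c s * g s) 0 t := by
  rw [hasDerivAt_iff_tendsto_slope] at hg ⊢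
  have := (hc.mono_left nhdsWithin_le_nhds).mul hg
  rw [zero_mul] at this
  refine this.congr fun s => ?_
  rw [slope_def_module, slope_def_module, hg0, mul_zero, sub_zero, sub_zero, mul_smul_comm]

/-- Continuity of the biorthogonal expansion coefficients of the monic polynomial. -/
lemma tendsto_expansion_coeff {𝕜 : Type*} [RCLike 𝕜] {n : ℕ} {t : 𝕜} {c : ℕ → 𝕜 → ℂ}
    {b : ℕ → 𝕜 → ℂ} {e : ℕ → ℕ → 𝕜 → ℂ}
    (hb : ∀ k, Tendsto (b k) (𝓝 t) (𝓝 0)) (he : ∀ j k, Tendsto (e j k) (𝓝 t) (𝓝 0))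
    (h : ∀ᶠ s in 𝓝 t, ∀ k ∈ Finset.range n,
      c k s = b k s + ∑ j ∈ Finset.range n, c j s * e j k s) {k : ℕ} (hk : k ∈ Finset.range n) :
    Tendsto (c k) (𝓝 t) (𝓝 0) := by
  set β : 𝕜 → ℝ := fun s => ∑ k ∈ Finset.range n, ‖b k s‖ with hβ
  set ε : 𝕜 → ℝ := fun s => ∑ k ∈ Finset.range n, ∑ j ∈ Finset.range n, ‖e j k s‖ with hε
  have hβ0 : Tendsto β (𝓝 t) (𝓝 0) := by
    have := tendsto_finsetSum (Finset.range n) fun k _ => (hb k).norm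
    simpa using this
  have hε0 : Tendsto ε (𝓝 t) (𝓝 0) := by
    have := tendsto_finsetSum (Finset.range n) fun k _ =>
      tendsto_finsetSum (Finset.range n) fun j _ => (he j k).norm
    simpa using this
  have hsmall : ∀ᶠ s in 𝓝 t, ε s ≤ 1 / 2 :=
    (hε0.eventually (gt_mem_nhds (by norm_num : (0 : ℝ) < 1 / 2))).mono fun _ h => h.le
  rw [tendsto_zero_iff_norm_tendsto_zero]
  refine squeeze_zero' (Eventually.of_forall fun _ => norm_nonneg _)
    (?_ : ∀ᶠ s in 𝓝 t, ‖c k s‖ ≤ 2 * β s) (by simpa using hβ0.const_mul 2)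
  filter_upwards [h, hsmall] with s hs hs'
  set A := ∑ k ∈ Finset.range n, ‖c k s‖ with hA
  have hA0 : 0 ≤ A := Finset.sum_nonneg fun _ _ => norm_nonneg _
  -- Summing the linear system bounds A by itself times a small factor; once `ε s ≤ 1 / 2` the last
  -- term is absorbed on the left.
  have h1 : A ≤ β s + A * ε s := by
    rw [hA, hβ, hε]
    simp only
    rw [Finset.mul_sum, ← Finset.sum_add_distrib]
    refine Finset.sum_le_sum fun k hk => ?_
    conv_lhs => rw [hs k hk]
    refine (norm_add_le _ _).trans (add_le_add le_rfl ((norm_sum_le _ _).trans ?_))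
    rw [Finset.mul_sum]
    refine Finset.sum_le_sum fun j hj => ?_
    rw [norm_mul]
    exact mul_le_mul_of_nonneg_right
      (Finset.single_le_sum (f := fun k => ‖c k s‖) (fun _ _ => norm_nonneg _) hj) (norm_nonneg _)
  have h2 : A * ε s ≤ A * (1 / 2) := mul_le_mul_of_nonneg_left hs' hA0
  have h3 : ‖c k s‖ ≤ A :=
    Finset.single_le_sum (f := fun k => ‖c k s‖) (fun _ _ => norm_nonneg _) hk
  linarith

/-- The derivative of the reflection coefficient in terms of that of the bilinear form. -/
theorem hasDerivAt_reflCoeff {𝕜 : Type*} [RCLike 𝕜] [NormedAlgebra 𝕜 ℂ] {t : 𝕜} {n : ℕ}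
    {B : 𝕜 → ℂ[X] →ₗ[ℂ] ℂ[X] →ₗ[ℂ] ℂ} {D : ℂ[X] → ℂ[X] → ℂ} {φ φbar : 𝕜 → ℕ → ℂ[X]}
    (hD : ∀ p q, HasDerivAt (fun s => B s p q) (D p q) t)
    (hφ : ∀ᶠ s in 𝓝 t, IsToeplitzBiorth (B s) (n + 1) (φ s) (φbar s)) (hB : IsToeplitz (B t)) :
    HasDerivAt (fun s => reflCoeff (φ s) (n + 1))
      (-(kappa (φ t) n / kappa (φ t) (n + 1)) * D (φ t (n + 1)) (reflect n (φ t n))) t := by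
  have ht := hφ.self_of_nhds
  -- The sign of each orthonormal pair may jump with s, so `φ s` need not be continuous; the monic
  -- polynomial is free of this choice, and its value at 0 is the reflection coefficient.
  set Φ : 𝕜 → ℂ[X] := fun s => (kappa (φ s) (n + 1))⁻¹ • φ s (n + 1) with hΦ
  set K := reflect n (φ t n) with hK
  have hKd : K.natDegree ≤ n :=
    natDegree_reflect_le.trans (max_le le_rfl (ht.natDegree_eq n (by omega)).le)
  set c : ℕ → 𝕜 → ℂ := fun k s => B t (Φ s - Φ t) (φbar t k) with hc
  have hdeg : ∀ᶠ s in 𝓝 t, (Φ s - Φ t).natDegree ≤ n := by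
    filter_upwards [hφ] with s hs
    rw [natDegree_le_iff_coeff_eq_zero]
    intro m hm
    simp only [hΦ, coeff_sub, coeff_smul, smul_eq_mul]
    rcases Nat.lt_or_ge (n + 1) m with h1 | h1
    · rw [coeff_eq_zero_of_natDegree_lt (by rw [hs.natDegree_eq _ le_rfl]; omega),
        coeff_eq_zero_of_natDegree_lt (by rw [ht.natDegree_eq _ le_rfl]; omega)]
      simp
    · obtain rfl : m = n + 1 := by omega
      rw [hs.coeff_self le_rfl, ht.coeff_self le_rfl, inv_mul_cancel₀ (hs.kappa_ne_zero le_rfl),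
        inv_mul_cancel₀ (ht.kappa_ne_zero le_rfl), sub_self]
  have horth : ∀ᶠ s in 𝓝 t, ∀ q : ℂ[X], q.natDegree ≤ n → B s (Φ s) q = 0 := by
    filter_upwards [hφ] with s hs q hq
    rw [hΦ]
    simp only [map_smul, LinearMap.smul_apply]
    rw [hs.apply_self_eq_zero le_rfl (by omega), smul_zero]
  have hexp : ∀ᶠ s in 𝓝 t, Φ s - Φ t = ∑ k ∈ Finset.range (n + 1), c k s • φ t k := by
    filter_upwards [hdeg] with s hs using ht.eq_sum (Nat.le_succ n) hs
  -- Both B_s(Φ_s,q) and B_t(Φ_t,q) vanish, so B_t(Φ_s-Φ_t,q) is minus the increment B_s-B_t applied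
  -- to Φ_s, split as Φ_t plus the expansion of Φ_s-Φ_t. The second part is of second order.
  have hdiff : ∀ᶠ s in 𝓝 t, ∀ q : ℂ[X], q.natDegree ≤ n → B t (Φ s - Φ t) q =
      -(B s (Φ t) q - B t (Φ t) q) +
        ∑ k ∈ Finset.range (n + 1), c k s * -(B s (φ t k) q - B t (φ t k) q) := by
    filter_upwards [horth, hexp] with s h1 h2 q hq
    have h3 : ∑ k ∈ Finset.range (n + 1), c k s * -(B s (φ t k) q - B t (φ t k) q) =
        B t (Φ s - Φ t) q - B s (Φ s - Φ t) q := by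
      simp only [h2, map_sum, LinearMap.sum_apply, map_smul, LinearMap.smul_apply, smul_eq_mul]
      rw [← Finset.sum_sub_distrib]
      exact Finset.sum_congr rfl fun k _ => by ring
    rw [h3]
    simp only [map_sub, LinearMap.sub_apply, h1 q hq, horth.self_of_nhds q hq]
    ring
  have hzero : ∀ p q, Tendsto (fun s => -(B s p q - B t p q)) (𝓝 t) (𝓝 0) := fun p q => by
    simpa using ((hD p q).continuousAt.tendsto.sub_const (B t p q)).neg
  have hc0 : ∀ k ∈ Finset.range (n + 1), Tendsto (c k) (𝓝 t) (𝓝 0) := by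
    intro k hk
    refine tendsto_expansion_coeff (b := fun k s => -(B s (Φ t) (φbar t k) - B t (Φ t) (φbar t k)))
      (e := fun j k s => -(B s (φ t j) (φbar t k) - B t (φ t j) (φbar t k)))
      (fun k => hzero _ _) (fun j k => hzero _ _) ?_ hk
    filter_upwards [hdiff] with s hs k hk
    have := Finset.mem_range.mp hk
    exact hs _ (by rw [ht.natDegree_bar_eq k (by omega)]; omega)
  have hr : ∀ᶠ s in 𝓝 t, reflCoeff (φ s) (n + 1) = reflCoeff (φ t) (n + 1) + kappa (φ t) n *
      (-(B s (Φ t) K - B t (Φ t) K) +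
        ∑ k ∈ Finset.range (n + 1), c k s * -(B s (φ t k) K - B t (φ t k) K)) := by
    filter_upwards [hdiff, hdeg] with s h1 h2
    rw [← h1 K hKd, ht.reproducing hB (Nat.le_succ n) h2]
    simp only [hΦ, reflCoeff, eval_sub, eval_smul, smul_eq_mul]
    ring
  refine HasDerivAt.congr_of_eventuallyEq ?_ hr
  have hsum : HasDerivAt (fun s => ∑ k ∈ Finset.range (n + 1),
      c k s * -(B s (φ t k) K - B t (φ t k) K)) (∑ k ∈ Finset.range (n + 1), 0) t :=
    HasDerivAt.fun_sum fun k hk => hasDerivAt_mul_of_eq_zero (hc0 k hk)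
      (((hD _ _).sub_const _).neg) (by simp)
  have hΦt : HasDerivAt (fun s => B s (Φ t) K)
      ((kappa (φ t) (n + 1))⁻¹ * D (φ t (n + 1)) K) t := by
    simp only [hΦ, map_smul, LinearMap.smul_apply, smul_eq_mul]
    exact (hD _ _).const_mul _
  have := (((hΦt.sub_const (B t (Φ t) K)).neg.add hsum).const_mul (kappa (φ t) n)).const_add
    (reflCoeff (φ t) (n + 1))
  refine this.congr_deriv ?_
  rw [Finset.sum_const_zero]
  ring

end Biorth

/-! ### Circle means, the moment form and Cauchy transforms -/

namespace Biorth
open Filter Topology Asymptotics MeasureTheory Set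

lemma circMean_eq_integral (f : ℂ → ℂ) :
    circMean f = (2 * Real.pi : ℂ)⁻¹ * ∫ θ in (0 : ℝ)..2 * Real.pi, f (circleMap 0 1 θ) := by
  have h : ∀ θ : ℝ, deriv (circleMap 0 1) θ • (f (circleMap 0 1 θ) / circleMap 0 1 θ) =
      Complex.I * f (circleMap 0 1 θ) := by
    intro θ
    have : circleMap 0 1 θ ≠ 0 := circleMap_ne_center one_ne_zero
    rw [deriv_circleMap, smul_eq_mul]
    field_simp
  rw [circMean, circleIntegral]
  simp only [h]
  rw [intervalIntegral.integral_const_mul]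
  have hpi : (Real.pi : ℂ) ≠ 0 := by exact_mod_cast Real.pi_ne_zero
  field_simp

lemma circleMap_mem_sphere_one (θ : ℝ) : circleMap 0 1 θ ∈ Metric.sphere (0 : ℂ) 1 :=
  circleMap_mem_sphere 0 zero_le_one θ

lemma ae_circleMap_notMem {T : Set ℂ} (hT : T.Countable) : ∀ᵐ θ : ℝ, circleMap 0 1 θ ∉ T :=
  (hT.preimage_circleMap 0 one_ne_zero).ae_notMem volume

/-- The mean over the circle does not see countable sets. -/
lemma circMean_congr_off {f g : ℂ → ℂ} {T : Set ℂ} (hT : T.Countable)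
    (h : ∀ ζ ∈ Metric.sphere (0 : ℂ) 1, ζ ∉ T → f ζ = g ζ) : circMean f = circMean g := by
  rw [circMean_eq_integral, circMean_eq_integral]
  congr 1
  refine intervalIntegral.integral_congr_ae ?_
  filter_upwards [ae_circleMap_notMem hT] with θ hθ _
  exact h _ (circleMap_mem_sphere_one θ) hθ

lemma circMean_congr {f g : ℂ → ℂ} (h : ∀ ζ ∈ Metric.sphere (0 : ℂ) 1, f ζ = g ζ) :
    circMean f = circMean g :=
  circMean_congr_off countable_empty fun ζ hζ _ => h ζ hζ

lemma circleIntegrable_congr_off {f g : ℂ → ℂ} {T : Set ℂ} (hT : T.Countable)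
    (h : ∀ ζ ∈ Metric.sphere (0 : ℂ) 1, ζ ∉ T → f ζ = g ζ) (hf : CircleIntegrable f 0 1) :
    CircleIntegrable g 0 1 := by
  refine IntervalIntegrable.congr_ae hf ?_
  refine ae_restrict_of_ae ?_
  filter_upwards [ae_circleMap_notMem hT] with θ hθ
  exact h _ (circleMap_mem_sphere_one θ) hθ

lemma circleIntegrable_mul {f g : ℂ → ℂ} (hf : CircleIntegrable f 0 1)
    (hg : ContinuousOn g (Metric.sphere 0 1)) : CircleIntegrable (fun ζ => f ζ * g ζ) 0 1 :=
  hf.mul_continuousOn (by simpa using hg)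

lemma circMean_add {f g : ℂ → ℂ} (hf : CircleIntegrable f 0 1) (hg : CircleIntegrable g 0 1) :
    circMean (fun ζ => f ζ + g ζ) = circMean f + circMean g := by
  simp only [circMean_eq_integral]
  rw [intervalIntegral.integral_add hf hg, mul_add]

lemma circMean_const_mul (c : ℂ) (f : ℂ → ℂ) :
    circMean (fun ζ => c * f ζ) = c * circMean f := by
  simp only [circMean_eq_integral]
  rw [intervalIntegral.integral_const_mul]
  ring

lemma circMean_sub {f g : ℂ → ℂ} (hf : CircleIntegrable f 0 1) (hg : CircleIntegrable g 0 1) :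
    circMean (fun ζ => f ζ - g ζ) = circMean f - circMean g := by
  simp only [circMean_eq_integral]
  rw [intervalIntegral.integral_sub hf hg, mul_sub]

lemma circMean_sum {ι : Type*} (s : Finset ι) {f : ι → ℂ → ℂ}
    (hf : ∀ i ∈ s, CircleIntegrable (f i) 0 1) :
    circMean (fun ζ => ∑ i ∈ s, f i ζ) = ∑ i ∈ s, circMean (f i) := by
  simp only [circMean_eq_integral]
  rw [intervalIntegral.integral_finsetSum hf, Finset.mul_sum]

lemma continuousOn_eval_inv (q : ℂ[X]) :
    ContinuousOn (fun ζ : ℂ => q.eval ζ⁻¹) (Metric.sphere 0 1) := by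
  refine q.continuous.comp_continuousOn (continuousOn_inv₀.mono fun ζ hζ => ?_)
  exact ne_zero_of_mem_unit_sphere ⟨ζ, hζ⟩

lemma circleIntegrable_mul_polynomial {w : ℂ → ℂ} (hw : CircleIntegrable w 0 1) (p q : ℂ[X]) :
    CircleIntegrable (fun ζ => w ζ * p.eval ζ * q.eval ζ⁻¹) 0 1 :=
  circleIntegrable_mul (circleIntegrable_mul hw p.continuous.continuousOn) (continuousOn_eval_inv q)

open Classical in
/-- The bilinear form `(p, q) ↦ ∫ dζ/(2πiζ) w(ζ) p(ζ) q(1/ζ)`, zero if `w` is not integrable. -/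
def pairing (w : ℂ → ℂ) : ℂ[X] →ₗ[ℂ] ℂ[X] →ₗ[ℂ] ℂ :=
  if hw : CircleIntegrable w 0 1 then
    LinearMap.mk₂ ℂ (fun p q => circMean (fun ζ => w ζ * p.eval ζ * q.eval ζ⁻¹))
      (fun p₁ p₂ q => by
        rw [← circMean_add (circleIntegrable_mul_polynomial hw _ _)
          (circleIntegrable_mul_polynomial hw _ _)]
        simp only [eval_add, mul_add, add_mul])
      (fun c p q => by
        rw [smul_eq_mul, ← circMean_const_mul]
        congr 1; funext ζ
        rw [eval_smul, smul_eq_mul]; ring)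
      (fun p q₁ q₂ => by
        rw [← circMean_add (circleIntegrable_mul_polynomial hw _ _)
          (circleIntegrable_mul_polynomial hw _ _)]
        simp only [eval_add, mul_add])
      (fun c p q => by
        rw [smul_eq_mul, ← circMean_const_mul]
        congr 1; funext ζ
        rw [eval_smul, smul_eq_mul]; ring)
  else 0

lemma pairing_apply {w : ℂ → ℂ} (hw : CircleIntegrable w 0 1) (p q : ℂ[X]) :
    pairing w p q = circMean (fun ζ => w ζ * p.eval ζ * q.eval ζ⁻¹) := by
  rw [pairing, dif_pos hw, LinearMap.mk₂_apply]

lemma eval_reflect_inv_mul_pow {q : ℂ[X]} {n : ℕ} (hq : q.natDegree ≤ n) {ζ : ℂ} (hζ : ζ ≠ 0) :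
    (reflect n q).eval ζ⁻¹ * ζ ^ n = q.eval ζ := by
  let := invertibleOfNonzero hζ
  have := eval₂_reflect_mul_pow (RingHom.id ℂ) ζ n q hq
  rwa [invOf_eq_inv] at this

lemma eval_reflect {q : ℂ[X]} {n : ℕ} (hq : q.natDegree ≤ n) {ζ : ℂ} (hζ : ζ ≠ 0) :
    (reflect n q).eval ζ = ζ ^ n * q.eval ζ⁻¹ := by
  have := eval_reflect_inv_mul_pow hq (inv_ne_zero hζ)
  rw [inv_inv] at this
  rw [← this, inv_pow]
  field_simp

lemma isToeplitz_pairing {w : ℂ → ℂ} (hw : CircleIntegrable w 0 1) : IsToeplitz (pairing w) where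
  shift p q := by
    rw [pairing_apply hw, pairing_apply hw]
    refine circMean_congr fun ζ hζ => ?_
    have h0 : ζ ≠ 0 := ne_zero_of_mem_unit_sphere ⟨ζ, hζ⟩
    simp only [eval_mul, eval_X]
    field_simp
  mul_left n p q hq := by
    rw [pairing_apply hw, pairing_apply hw]
    refine circMean_congr fun ζ hζ => ?_
    have h0 : ζ ≠ 0 := ne_zero_of_mem_unit_sphere ⟨ζ, hζ⟩
    rw [eval_reflect hq (inv_ne_zero h0)]
    simp only [eval_mul, eval_pow, eval_X, inv_inv]
    ring
  mul_right n p q hq := by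
    rw [pairing_apply hw, pairing_apply hw]
    refine circMean_congr fun ζ hζ => ?_
    have h0 : ζ ≠ 0 := ne_zero_of_mem_unit_sphere ⟨ζ, hζ⟩
    rw [eval_reflect hq h0]
    simp only [eval_mul, eval_pow, eval_X]
    ring

/-- Only integrability of the quotient is asked for, so z may be a singular point on the circle; the
single point ζ = z is invisible to the mean. -/
lemma isCauchyForm_pairing {w : ℂ → ℂ} (hw : CircleIntegrable w 0 1) {z : ℂ}
    (hu : CircleIntegrable (fun ζ => w ζ / (ζ - z)) 0 1) :
    IsCauchyForm (pairing w) (pairing fun ζ => w ζ / (ζ - z)) z where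
  toeplitz := isToeplitz_pairing hu
  apply_mul p q := by
    rw [pairing_apply hw, pairing_apply hu]
    refine circMean_congr_off (countable_singleton z) fun ζ hζ hz => ?_
    have : ζ - z ≠ 0 := sub_ne_zero.mpr hz
    simp only [eval_mul, eval_sub, eval_X, eval_C]
    field_simp

lemma ne_of_norm_ne_one {z ζ : ℂ} (hz : ‖z‖ ≠ 1) (hζ : ζ ∈ Metric.sphere (0 : ℂ) 1) : ζ ≠ z := by
  rintro rfl
  exact hz (by simpa using hζ)

lemma circleIntegrable_div_sub {w : ℂ → ℂ} (hw : CircleIntegrable w 0 1) {z : ℂ} (hz : ‖z‖ ≠ 1) :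
    CircleIntegrable (fun ζ => w ζ / (ζ - z)) 0 1 := by
  simp only [div_eq_mul_inv]
  refine circleIntegrable_mul hw (ContinuousOn.inv₀ (by fun_prop) fun ζ hζ => ?_)
  exact sub_ne_zero.mpr (ne_of_norm_ne_one hz hζ)

/-- The Cauchy transform of an integrable function on the circle is holomorphic off the circle. -/
lemma hasDerivAt_cauchyTransform {h : ℂ → ℂ} (hh : CircleIntegrable h 0 1) {z : ℂ}
    (hz : ‖z‖ ≠ 1) :
    HasDerivAt (fun z => circMean fun ζ => h ζ / (ζ - z))
      (circMean fun ζ => h ζ / (ζ - z) ^ 2) z := by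
  simp only [circMean_eq_integral]
  refine HasDerivAt.const_mul _ ?_
  -- The distance from z to the circle; on the ball of radius d/2 the denominators stay at least
  -- d/2, which supplies the dominating function.
  set d := |‖z‖ - 1| with hd
  have hd0 : 0 < d := abs_pos.mpr (sub_ne_zero.mpr hz)
  have hdist : ∀ x ∈ Metric.ball z (d / 2), ∀ θ : ℝ, d / 2 ≤ ‖circleMap 0 1 θ - x‖ := by
    intro x hx θ
    rw [Metric.mem_ball, dist_eq_norm] at hx
    have h1 : d ≤ ‖z - circleMap 0 1 θ‖ := by
      have := abs_norm_sub_norm_le z (circleMap 0 1 θ)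
      simpa [hd] using this
    have h2 : ‖z - circleMap 0 1 θ‖ ≤ ‖x - z‖ + ‖circleMap 0 1 θ - x‖ := by
      rw [← norm_neg]
      refine le_trans (le_of_eq ?_) (norm_add_le _ _)
      congr 1; ring
    linarith
  have hne : ∀ x ∈ Metric.ball z (d / 2), ∀ θ : ℝ, circleMap 0 1 θ - x ≠ 0 := fun x hx θ =>
    norm_pos_iff.mp (lt_of_lt_of_le (by positivity) (hdist x hx θ))
  have hball : Metric.ball z (d / 2) ∈ 𝓝 z := Metric.ball_mem_nhds z (by positivity)
  have hmeas : ∀ x, AEStronglyMeasurable (fun θ : ℝ => (circleMap 0 1 θ - x)⁻¹)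
      (volume.restrict (uIoc 0 (2 * Real.pi))) := fun x =>
    (((measurable_circleMap 0 1).sub_const x).inv).aestronglyMeasurable
  refine (intervalIntegral.hasDerivAt_integral_of_dominated_loc_of_deriv_le (μ := volume)
    (F := fun x θ => h (circleMap 0 1 θ) / (circleMap 0 1 θ - x))
    (F' := fun x θ => h (circleMap 0 1 θ) / (circleMap 0 1 θ - x) ^ 2)
    (bound := fun θ => ‖h (circleMap 0 1 θ)‖ * ((d / 2) ^ 2)⁻¹) hball ?_ ?_ ?_ ?_ ?_ ?_).2
  · filter_upwards with x
    simp only [div_eq_mul_inv]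
    exact hh.def'.aestronglyMeasurable.mul (hmeas x)
  · exact circleIntegrable_div_sub hh hz
  · simp only [div_eq_mul_inv, ← inv_pow]
    exact hh.def'.aestronglyMeasurable.mul ((hmeas z).pow 2)
  · filter_upwards with θ _ x hx
    rw [norm_div, norm_pow, div_eq_mul_inv]
    have := hdist x hx θ
    gcongr
  · exact hh.norm.mul_const _
  · filter_upwards with θ _ x hx
    have h1 := hne x hx θ
    have := ((hasDerivAt_const x (circleMap 0 1 θ)).sub (hasDerivAt_id x)).inv h1
    have := this.const_mul (h (circleMap 0 1 θ))
    refine (this.congr_deriv ?_)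
    simp [div_eq_mul_inv]

end Biorth

/-! ### Semi-classical weights: integrability, integration by parts, concomitant polynomials -/

namespace Biorth
open Filter Topology Asymptotics MeasureTheory Set

section Weight

variable {m : ℕ} {z ρ : Fin m → ℂ} {w : ℂ → ℂ}

lemma eval_polyW (z : Fin m → ℂ) (x : ℂ) : (polyW z).eval x = ∏ j, (x - z j) := by
  simp [polyW, eval_prod]

lemma two_mul_eval_polyV (z ρ : Fin m → ℂ) (x : ℂ) :
    2 * (polyV z ρ).eval x = ∑ j, ρ j * ∏ k ∈ Finset.univ.erase j, (x - z k) := by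
  simp [polyV, eval_finsetSum, eval_prod]

lemma eval_polyW_eq_mul (z : Fin m → ℂ) (x : ℂ) (j : Fin m) :
    (polyW z).eval x = (x - z j) * ∏ k ∈ Finset.univ.erase j, (x - z k) := by
  rw [eval_polyW, Finset.mul_prod_erase _ (fun k => x - z k) (Finset.mem_univ j)]

lemma eval_polyW_ne_zero_iff {x : ℂ} : (polyW z).eval x ≠ 0 ↔ x ∉ range z := by
  rw [eval_polyW, Finset.prod_ne_zero_iff]
  simp [sub_ne_zero, eq_comm]

lemma two_mul_eval_polyV_eq {x : ℂ} (hx : x ∉ range z) :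
    2 * (polyV z ρ).eval x = (polyW z).eval x * ∑ j, ρ j / (x - z j) := by
  rw [two_mul_eval_polyV, Finset.mul_sum]
  refine Finset.sum_congr rfl fun j _ => ?_
  have : x - z j ≠ 0 := sub_ne_zero.mpr fun h => hx ⟨j, h.symm⟩
  rw [eval_polyW_eq_mul z x j]
  field_simp

lemma two_mul_eval_polyV_self (z ρ : Fin m → ℂ) (j : Fin m) :
    2 * (polyV z ρ).eval (z j) = ρ j * ∏ k ∈ Finset.univ.erase j, (z j - z k) := by
  rw [two_mul_eval_polyV, Finset.sum_eq_single j]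
  · intro k _ hkj
    rw [Finset.prod_eq_zero (Finset.mem_erase.mpr ⟨hkj.symm, Finset.mem_univ j⟩) (sub_self _),
      mul_zero]
  · simp

lemma roots_polyW (z : Fin m → ℂ) : (polyW z).roots = Finset.univ.val.map z := by
  rw [polyW, Finset.prod, ← roots_multiset_prod_X_sub_C (Finset.univ.val.map z), Multiset.map_map]
  rfl

namespace IsRegularSemiclassical

lemma injective (h : IsRegularSemiclassical (polyW z) (polyV z ρ) w) : Function.Injective z := by
  have := h.nodup_roots
  rw [roots_polyW] at this
  intro i j hij
  exact Multiset.inj_on_of_nodup_map this i (Finset.mem_univ i) j (Finset.mem_univ j) hij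

lemma eval_polyV_ne_zero (h : IsRegularSemiclassical (polyW z) (polyV z ρ) w) (j : Fin m) :
    (polyV z ρ).eval (z j) ≠ 0 := by
  intro h0
  refine h.residue_ne (z j) ?_ 0 ?_
  · rw [roots_polyW]
    exact Multiset.mem_map_of_mem z (Finset.mem_univ j)
  · simp [h0]

lemma derivWithin_eq (h : IsRegularSemiclassical (polyW z) (polyV z ρ) w) {ζ : ℂ}
    (hζ : ζ ∈ Metric.sphere (0 : ℂ) 1) (hz : ζ ∉ range z) :
    derivWithin w (Metric.sphere 0 1) ζ = ∑ j, ρ j * (w ζ / (ζ - z j)) := by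
  have hW := eval_polyW_ne_zero_iff.mpr hz
  apply mul_left_cancel₀ hW
  rw [h.pearson ζ hζ hW, two_mul_eval_polyV_eq hz, mul_assoc, Finset.sum_mul]
  congr 1
  exact Finset.sum_congr rfl fun j _ => by ring

/-- Write V = V(z_j) + (X-z_j)V₁ and W = (X-z_j)W_j. Dividing the Pearson equation by ζ-z_j gives
V(z_j) w/(ζ-z_j) = ½W_j w' - V₁w, whose right side is integrable; V(z_j) ≠ 0 because the residue at
z_j is not 0. -/
lemma integrable_div (h : IsRegularSemiclassical (polyW z) (polyV z ρ) w) (j : Fin m) :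
    CircleIntegrable (fun ζ => w ζ / (ζ - z j)) 0 1 := by
  obtain ⟨V₁, -, hV₁⟩ := exists_divided_difference
    (p := polyV z ρ - C ((polyV z ρ).eval (z j))) (n := (polyV z ρ).natDegree) (z := z j)
    (natDegree_sub_C.trans_le (Nat.le_succ _)) (by simp)
  set Wj : ℂ[X] := ∏ k ∈ Finset.univ.erase j, (X - C (z k)) with hWj
  have hint := ((circleIntegrable_mul h.integrable_deriv Wj.continuous.continuousOn).const_smul
    (a := (1 / 2 : ℂ))).sub (circleIntegrable_mul h.integrable V₁.continuous.continuousOn)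
  refine circleIntegrable_congr_off (finite_range z).countable (fun ζ hζ hz => ?_)
    (hint.const_smul (a := ((polyV z ρ).eval (z j))⁻¹))
  have hV := h.eval_polyV_ne_zero j
  have hW := eval_polyW_ne_zero_iff.mpr hz
  have h1 := h.pearson ζ hζ hW
  have h2 : ζ - z j ≠ 0 := sub_ne_zero.mpr fun h => hz ⟨j, h.symm⟩
  have h3 : (polyW z).eval ζ = (ζ - z j) * Wj.eval ζ := by
    rw [eval_polyW_eq_mul z ζ j, hWj, eval_prod]
    simp
  have h4 := congrArg (eval ζ) hV₁
  simp only [eval_sub, eval_C, eval_mul, eval_X] at h4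
  rw [h3] at h1
  simp only [Pi.smul_apply, Pi.sub_apply, smul_eq_mul]
  rw [inv_mul_eq_iff_eq_mul₀ hV, mul_div_assoc', eq_div_iff h2]
  linear_combination (1 / 2) * h1 + w ζ * h4

/-- The weight has limit zero at each of its singular points on the circle. -/
def VanishesAtSingular (z : Fin m → ℂ) (w : ℂ → ℂ) : Prop :=
  ∀ j, z j ∈ Metric.sphere (0 : ℂ) 1 →
    Tendsto w (𝓝[Metric.sphere 0 1 \ {z j}] (z j)) (𝓝 0)

/-- The values of w at singular points are unconstrained; replacing them by the limit 0 produces the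
continuous representative to which the fundamental theorem of calculus applies. -/
lemma continuousOn_indicator (h : IsRegularSemiclassical (polyW z) (polyV z ρ) w)
    (hlim : VanishesAtSingular z w) :
    ContinuousOn ((range z)ᶜ.indicator w) (Metric.sphere 0 1) := by
  intro ζ hζ
  by_cases hz : ζ ∈ range z
  · obtain ⟨j, rfl⟩ := hz
    have h0 : (range z)ᶜ.indicator w (z j) = 0 := indicator_of_notMem (by simp) _
    rw [← continuousWithinAt_sdiff_self, ContinuousWithinAt, h0]
    refine squeeze_zero_norm (fun ζ => norm_indicator_le_norm_self _ _) ?_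
    simpa using (hlim j hζ).norm
  · have h1 := (h.differentiable ζ hζ (eval_polyW_ne_zero_iff.mpr hz)).continuousWithinAt
    refine h1.congr_of_eventuallyEq ?_ (indicator_of_mem hz _)
    filter_upwards [nhdsWithin_le_nhds ((finite_range z).isClosed.isOpen_compl.mem_nhds hz)]
      with x hx using indicator_of_mem hx _

/-- Integration by parts against a semi-classical weight. -/
lemma circMean_by_parts (h : IsRegularSemiclassical (polyW z) (polyV z ρ) w)
    (hlim : VanishesAtSingular z w) {P P' : ℂ → ℂ}
    (hP : ∀ ζ ∈ Metric.sphere (0 : ℂ) 1, HasDerivAt P (P' ζ) ζ)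
    (hP' : ContinuousOn P' (Metric.sphere 0 1)) :
    circMean (fun ζ => ζ * (w ζ * P' ζ + (∑ j, ρ j * (w ζ / (ζ - z j))) * P ζ)) = 0 := by
  have hPc : ContinuousOn P (Metric.sphere 0 1) := fun ζ hζ =>
    (hP ζ hζ).continuousAt.continuousWithinAt
  have hcirc : ContinuousOn (circleMap 0 1) (uIcc 0 (2 * Real.pi)) :=
    (continuous_circleMap 0 1).continuousOn
  have hmaps : MapsTo (circleMap 0 1) (uIcc 0 (2 * Real.pi)) (Metric.sphere 0 1) :=
    fun θ _ => circleMap_mem_sphere_one θ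
  set F : ℝ → ℂ := fun θ => (range z)ᶜ.indicator w (circleMap 0 1 θ) * P (circleMap 0 1 θ) with hF
  set G : ℂ → ℂ := fun ζ => ζ * (w ζ * P' ζ + (∑ j, ρ j * (w ζ / (ζ - z j))) * P ζ) with hG
  have hGi : CircleIntegrable G 0 1 := by
    have h1 := circleIntegrable_mul h.integrable hP'
    have h2 : CircleIntegrable (fun ζ => ∑ j, ρ j * (w ζ / (ζ - z j))) 0 1 :=
      CircleIntegrable.fun_sum _ fun j _ => (h.integrable_div j).const_smul (a := ρ j)
    have h3 := circleIntegrable_mul (h1.add (circleIntegrable_mul h2 hPc)) continuousOn_id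
    refine circleIntegrable_congr_off countable_empty (fun ζ _ _ => ?_) h3
    simp [hG, mul_comm]
  have hint : IntervalIntegrable (fun θ => Complex.I * G (circleMap 0 1 θ)) volume 0
      (2 * Real.pi) := IntervalIntegrable.const_mul hGi _
  -- Only the singular angles, a countable set, are exceptional. The boundary values at 0 and 2π
  -- agree by periodicity, so the integral of the derivative is zero.
  have key := integral_eq_of_hasDerivAt_off_countable F
    (fun θ => Complex.I * G (circleMap 0 1 θ)) (a := 0) (b := 2 * Real.pi)
    ((finite_range z).countable.preimage_circleMap 0 one_ne_zero)
    (((h.continuousOn_indicator hlim).comp hcirc hmaps).mul (hPc.comp hcirc hmaps)) ?_ hint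
  · have hper : F (2 * Real.pi) = F 0 := by
      simp only [hF]
      rw [show circleMap 0 1 (2 * Real.pi) = circleMap 0 1 0 by simp [circleMap]]
    rw [hper, sub_self, intervalIntegral.integral_const_mul] at key
    rw [circMean_eq_integral, (mul_eq_zero.mp key).resolve_left Complex.I_ne_zero, mul_zero]
  · rintro θ ⟨-, hθ⟩
    have hz : circleMap 0 1 θ ∉ range z := hθ
    have hmem := circleMap_mem_sphere_one θ
    have hd := (h.differentiable _ hmem (eval_polyW_ne_zero_iff.mpr hz)).hasDerivWithinAt
    rw [h.derivWithin_eq hmem hz] at hd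
    have hc := hasDerivAt_circleMap 0 1 θ
    have h1 := hd.comp_hasDerivAt θ hc (Eventually.of_forall circleMap_mem_sphere_one)
    have h2 := (hP _ hmem).comp θ hc
    have h3 := (h1.mul h2).congr_of_eventuallyEq (f₁ := F) (by
      have : ∀ᶠ x in 𝓝 θ, circleMap 0 1 x ∈ (range z)ᶜ :=
        (continuous_circleMap 0 1).continuousAt.eventually
          ((finite_range z).isClosed.isOpen_compl.mem_nhds hz)
      filter_upwards [this] with x hx
      simp [hF, indicator_of_mem hx])
    refine h3.congr_deriv ?_
    simp only [hG, Function.comp]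
    ring

end IsRegularSemiclassical

/-- The bilinear form of the weight `w(ζ) / (ζ - x)`. -/
def cauchyPairing (w : ℂ → ℂ) (x : ℂ) : ℂ[X] →ₗ[ℂ] ℂ[X] →ₗ[ℂ] ℂ :=
  pairing fun ζ => w ζ / (ζ - x)

lemma cauchyPairing_apply_eq (hw : CircleIntegrable w 0 1) {x : ℂ} (hx : ‖x‖ ≠ 1) (p q : ℂ[X]) :
    cauchyPairing w x p q = circMean fun ζ => (w ζ * p.eval ζ * q.eval ζ⁻¹) / (ζ - x) := by
  rw [cauchyPairing, pairing_apply (circleIntegrable_div_sub hw hx)]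
  congr 1; funext ζ; ring

lemma isOpen_norm_ne_one : IsOpen {x : ℂ | ‖x‖ ≠ 1} :=
  isOpen_ne_fun continuous_norm continuous_const

lemma hasDerivAt_cauchyPairing (hw : CircleIntegrable w 0 1) {x : ℂ} (hx : ‖x‖ ≠ 1)
    (p q : ℂ[X]) :
    HasDerivAt (fun x => cauchyPairing w x p q)
      (circMean fun ζ => (w ζ * p.eval ζ * q.eval ζ⁻¹) / (ζ - x) ^ 2) x := by
  refine (hasDerivAt_cauchyTransform (circleIntegrable_mul_polynomial hw p q) hx
    ).congr_of_eventuallyEq ?_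
  filter_upwards [isOpen_norm_ne_one.mem_nhds hx] with y hy using cauchyPairing_apply_eq hw hy p q

/-- The value is the mean of ζw(ζ)(f(ζ)-f(x))/(ζ-x), polynomial in x. The same polynomial serves off
the circle and at singular points on it, so no boundary limit of a Cauchy transform is ever taken.
-/
lemma exists_second_kind_polynomial (hw : CircleIntegrable w 0 1) (f : ℂ[X]) :
    ∃ Ψ : ℂ[X], ∀ x, CircleIntegrable (fun ζ => w ζ / (ζ - x)) 0 1 →
      Ψ.eval x = cauchyPairing w x (X * f) 1 - f.eval x * cauchyPairing w x X 1 := by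
  induction f using Polynomial.induction_on' with
  | add p q hp hq =>
    obtain ⟨P, hP⟩ := hp
    obtain ⟨Q, hQ⟩ := hq
    refine ⟨P + Q, fun x hx => ?_⟩
    rw [eval_add, hP x hx, hQ x hx, mul_add, map_add, LinearMap.add_apply, eval_add]
    ring
  | monomial k a =>
    induction k with
    | zero =>
      refine ⟨0, fun x _ => ?_⟩
      rw [monomial_zero_left, C_eq_smul_one', mul_smul_comm, map_smul, LinearMap.smul_apply]
      simp
    | succ k ih =>
      obtain ⟨P, hP⟩ := ih
      refine ⟨X * P + C (pairing w (X * monomial k a) 1), fun x hx => ?_⟩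
      rw [← X_mul_monomial, cauchyPairing, (isCauchyForm_pairing hw hx).apply_X_mul, eval_add,
        eval_mul, eval_X, eval_C, hP x hx, eval_mul, eval_X, cauchyPairing]
      ring

namespace IsRegularSemiclassical

lemma isCauchyForm (h : IsRegularSemiclassical (polyW z) (polyV z ρ) w) (j : Fin m) :
    IsCauchyForm (pairing w) (cauchyPairing w (z j)) (z j) :=
  isCauchyForm_pairing h.integrable (h.integrable_div j)

lemma isCauchyForm_off (h : IsRegularSemiclassical (polyW z) (polyV z ρ) w) {x : ℂ}
    (hx : ‖x‖ ≠ 1) : IsCauchyForm (pairing w) (cauchyPairing w x) x :=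
  isCauchyForm_pairing h.integrable (circleIntegrable_div_sub h.integrable hx)

/-- The first order equation satisfied by the Cauchy transform of a semi-classical weight. -/
lemma polyW_mul_deriv_cauchyPairing (h : IsRegularSemiclassical (polyW z) (polyV z ρ) w)
    (hlim : VanishesAtSingular z w) {x : ℂ} (hx : ‖x‖ ≠ 1) (f : ℂ[X]) :
    (polyW z).eval x * deriv (fun x => cauchyPairing w x (X * f) 1) x =
      (polyW z).eval x * cauchyPairing w x (X * derivative f) 1
        + 2 * (polyV z ρ).eval x * cauchyPairing w x (X * f) 1
        - ∑ j, ρ j * (∏ k ∈ Finset.univ.erase j, (x - z k)) * cauchyPairing w (z j) (X * f) 1 := by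
  have hne : ∀ ζ ∈ Metric.sphere (0 : ℂ) 1, ζ - x ≠ 0 := fun ζ hζ =>
    sub_ne_zero.mpr (ne_of_norm_ne_one hx hζ)
  rw [(hasDerivAt_cauchyPairing h.integrable hx _ _).deriv]
  have hc1 : ContinuousOn (fun ζ : ℂ => (ζ - x)⁻¹) (Metric.sphere 0 1) :=
    ContinuousOn.inv₀ (by fun_prop) hne
  -- Testing the weight against f(ζ)/(ζ-x) trades the double pole in the derivative of the Cauchy
  -- transform for the derivatives of f and w.
  have hparts := h.circMean_by_parts hlim (P := fun ζ => f.eval ζ * (ζ - x)⁻¹)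
    (P' := fun ζ => (derivative f).eval ζ * (ζ - x)⁻¹ - f.eval ζ * (ζ - x)⁻¹ ^ 2)
    (fun ζ hζ => by
      refine ((f.hasDerivAt ζ).mul (((hasDerivAt_id ζ).sub_const x).inv (hne ζ hζ))).congr_deriv ?_
      simp [div_eq_mul_inv]
      ring)
    (((derivative f).continuous.continuousOn.mul hc1).sub
      (f.continuous.continuousOn.mul (hc1.pow 2)))
  have hi : ∀ p : ℂ[X], CircleIntegrable (fun ζ => w ζ * p.eval ζ * (1 : ℂ[X]).eval ζ⁻¹) 0 1 :=
    fun p => circleIntegrable_mul_polynomial h.integrable p 1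
  have hi1 : ∀ p : ℂ[X],
      CircleIntegrable (fun ζ => (w ζ * p.eval ζ * (1 : ℂ[X]).eval ζ⁻¹) / (ζ - x)) 0 1 :=
    fun p => circleIntegrable_div_sub (hi p) hx
  have hi2 : CircleIntegrable
      (fun ζ => (w ζ * (X * f).eval ζ * (1 : ℂ[X]).eval ζ⁻¹) / (ζ - x) ^ 2) 0 1 := by
    refine circleIntegrable_congr_off countable_empty (fun ζ _ _ => ?_)
      (circleIntegrable_mul (hi1 (X * f)) hc1)
    rw [div_eq_mul_inv, div_eq_mul_inv, ← inv_pow]; ring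
  have hi3 : ∀ j, CircleIntegrable (fun ζ => w ζ / (ζ - z j) * (ζ * f.eval ζ * (ζ - x)⁻¹)) 0 1 :=
    fun j => circleIntegrable_mul (h.integrable_div j)
      ((continuousOn_id.mul f.continuous.continuousOn).mul hc1)
  have hsum : CircleIntegrable
      (fun ζ => ∑ j, ρ j * (w ζ / (ζ - z j) * (ζ * f.eval ζ * (ζ - x)⁻¹))) 0 1 :=
    CircleIntegrable.fun_sum _ fun j _ => (hi3 j).const_smul (a := ρ j)
  have hi4 : CircleIntegrable (fun ζ => (w ζ * (X * derivative f).eval ζ * (1 : ℂ[X]).eval ζ⁻¹) /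
      (ζ - x) + ∑ j, ρ j * (w ζ / (ζ - z j) * (ζ * f.eval ζ * (ζ - x)⁻¹))) 0 1 :=
    (hi1 (X * derivative f)).add hsum
  have hsplit : circMean (fun ζ => (w ζ * (X * f).eval ζ * (1 : ℂ[X]).eval ζ⁻¹) / (ζ - x) ^ 2) =
      cauchyPairing w x (X * derivative f) 1 +
        ∑ j, ρ j * circMean (fun ζ => w ζ / (ζ - z j) * (ζ * f.eval ζ * (ζ - x)⁻¹)) := by
    rw [cauchyPairing_apply_eq h.integrable hx]
    simp only [← circMean_const_mul]
    rw [← circMean_sum Finset.univ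
        (f := fun j ζ => ρ j * (w ζ / (ζ - z j) * (ζ * f.eval ζ * (ζ - x)⁻¹)))
        fun j _ => (hi3 j).const_smul (a := ρ j),
      ← circMean_add (hi1 _) hsum, ← sub_eq_zero, ← circMean_sub hi2 hi4,
      ← neg_eq_zero, ← neg_one_mul, ← circMean_const_mul, ← hparts]
    congr 1; funext ζ
    rw [Finset.sum_mul, mul_add, Finset.mul_sum]
    have : ∀ j, ζ * (ρ j * (w ζ / (ζ - z j)) * (f.eval ζ * (ζ - x)⁻¹)) =
        ρ j * (w ζ / (ζ - z j) * (ζ * f.eval ζ * (ζ - x)⁻¹)) := fun j => by ring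
    simp only [this]
    simp only [eval_mul, eval_X, eval_one, div_eq_mul_inv, ← inv_pow]
    ring
  -- Partial fractions for 1/((ζ-z_j)(ζ-x)); the factor x-z_j produced by them comes from W(x).
  have hterm : ∀ j, (polyW z).eval x *
        circMean (fun ζ => w ζ / (ζ - z j) * (ζ * f.eval ζ * (ζ - x)⁻¹)) =
      (∏ k ∈ Finset.univ.erase j, (x - z k)) *
        (cauchyPairing w x (X * f) 1 - cauchyPairing w (z j) (X * f) 1) := by
    intro j
    rw [eval_polyW_eq_mul z x j, mul_comm (x - z j), mul_assoc, ← circMean_const_mul,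
      cauchyPairing_apply_eq h.integrable hx, cauchyPairing, pairing_apply (h.integrable_div j),
      ← circMean_sub (hi1 _) (circleIntegrable_mul_polynomial (h.integrable_div j) _ _)]
    congr 1
    refine circMean_congr_off (countable_singleton (z j)) fun ζ hζ hz => ?_
    have h1 := hne ζ hζ
    have h2 : ζ - z j ≠ 0 := sub_ne_zero.mpr hz
    simp only [eval_mul, eval_X, eval_one]
    field_simp
    ring
  rw [hsplit, mul_add, Finset.mul_sum]
  simp only [mul_left_comm _ (ρ _), hterm, two_mul_eval_polyV, Finset.sum_mul]
  rw [add_sub_assoc, ← Finset.sum_sub_distrib]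
  congr 1
  exact Finset.sum_congr rfl fun j _ => by ring

/-- The bilinear concomitant of two shifted Cauchy transforms is a polynomial, whose values at the
singular points are explicit. -/
lemma exists_concomitant_polynomial (h : IsRegularSemiclassical (polyW z) (polyV z ρ) w)
    (hlim : VanishesAtSingular z w) (f g : ℂ[X]) (a b : ℂ) :
    ∃ P : ℂ[X], (∀ x, ‖x‖ ≠ 1 → P.eval x =
      (polyW z).eval x * ((cauchyPairing w x (X * f) 1 + a) * (derivative g).eval x
        - f.eval x * deriv (fun x => cauchyPairing w x (X * g) 1 + b) x)
      + (polyV z ρ).eval x * (g.eval x * (cauchyPairing w x (X * f) 1 + a)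
        + f.eval x * (cauchyPairing w x (X * g) 1 + b))) ∧
    ∀ j, P.eval (z j) = (polyV z ρ).eval (z j) *
      (g.eval (z j) * (cauchyPairing w (z j) (X * f) 1 + a)
        + f.eval (z j) * (cauchyPairing w (z j) (X * g) 1 + b)) := by
  obtain ⟨Ψf, hf⟩ := exists_second_kind_polynomial h.integrable f
  obtain ⟨Ψg, hg⟩ := exists_second_kind_polynomial h.integrable g
  obtain ⟨Ψg', hg'⟩ := exists_second_kind_polynomial h.integrable (derivative g)
  set R : ℂ[X] := ∑ j, C (ρ j * cauchyPairing w (z j) (X * g) 1) *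
    ∏ k ∈ Finset.univ.erase j, (X - C (z k)) with hR
  have hRe : ∀ x, R.eval x = ∑ j, ρ j * (∏ k ∈ Finset.univ.erase j, (x - z k)) *
      cauchyPairing w (z j) (X * g) 1 := by
    intro x
    rw [hR, eval_finsetSum]
    refine Finset.sum_congr rfl fun j _ => ?_
    simp [eval_prod]
    ring
  -- Let K be the transform of X. Substituting F = Ψf + fK, G = Ψg + gK and the equation for WG'
  -- cancels every occurrence of K, leaving this polynomial. At z_j the term fR restores 2VfG, which
  -- turns V(gF-fG) into V(gF+fG).
  refine ⟨polyW z * (Ψf * derivative g - f * Ψg') + polyV z ρ * (g * Ψf - f * Ψg) + f * R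
    + C a * polyW z * derivative g + polyV z ρ * (C a * g + C b * f), fun x hx => ?_, fun j => ?_⟩
  · have hu := circleIntegrable_div_sub h.integrable hx
    have hd := h.polyW_mul_deriv_cauchyPairing hlim hx g
    rw [← hRe] at hd
    rw [deriv_add_const]
    simp only [eval_add, eval_mul, eval_sub, eval_C, hf x hu, hg x hu, hg' x hu]
    linear_combination f.eval x * hd
  · have hu := h.integrable_div j
    have hW : (polyW z).eval (z j) = 0 := by rw [eval_polyW_eq_mul z _ j, sub_self, zero_mul]
    have hS : R.eval (z j) = 2 * (polyV z ρ).eval (z j) * cauchyPairing w (z j) (X * g) 1 := by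
      rw [hRe, two_mul_eval_polyV_self, Finset.sum_eq_single j]
      · intro k _ hkj
        rw [Finset.prod_eq_zero (Finset.mem_erase.mpr ⟨hkj.symm, Finset.mem_univ j⟩) (sub_self _)]
        ring
      · simp
    simp only [eval_add, eval_mul, eval_sub, eval_C, hf _ hu, hg _ hu, hS, hW]
    ring

end IsRegularSemiclassical

end Weight

lemma X_pow_dvd_of_eventually_eq {P : ℂ[X]} {a : ℕ} {H : ℂ → ℂ} (hH : ContinuousAt H 0)
    (h : ∀ᶠ x in 𝓝[≠] (0 : ℂ), P.eval x = x ^ a * H x) : X ^ a ∣ P := by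
  induction a generalizing P with
  | zero => simp
  | succ a ih =>
    have h0 : P.eval 0 = 0 := by
      have h1 : Tendsto (fun x => x ^ (a + 1) * H x) (𝓝[≠] (0 : ℂ)) (𝓝 (0 ^ (a + 1) * H 0)) :=
        ((continuousAt_id.pow _).mul hH).tendsto.mono_left nhdsWithin_le_nhds
      have h2 : Tendsto (fun x => P.eval x) (𝓝[≠] (0 : ℂ)) (𝓝 (P.eval 0)) :=
        P.continuous.continuousAt.tendsto.mono_left nhdsWithin_le_nhds
      have := tendsto_nhds_unique (h2.congr' h) h1
      simpa using this
    obtain ⟨Q, rfl⟩ := X_dvd_iff.mpr ((coeff_zero_eq_eval_zero P).trans h0)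
    rw [pow_succ']
    refine mul_dvd_mul_left X (ih ?_)
    filter_upwards [h, self_mem_nhdsWithin] with x hx hx0
    refine mul_left_cancel₀ hx0 ?_
    rw [eval_mul, eval_X] at hx
    rw [hx]; ring

/-- Differentiating G lowers its order of vanishing at 0 by one, but the zero of W at the origin
compensates. -/
lemma X_pow_dvd_concomitant {m : ℕ} {z : Fin m → ℂ} {j₀ : Fin m} (hz₀ : z j₀ = 0) {a : ℕ}
    {P V f g : ℂ[X]} {F G E₁ E₂ : ℂ → ℂ}
    (hP : ∀ x, ‖x‖ ≠ 1 → P.eval x = (polyW z).eval x * (F x * (derivative g).eval x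
      - f.eval x * deriv G x) + V.eval x * (g.eval x * F x + f.eval x * G x))
    (hF : ∀ x, ‖x‖ ≠ 1 → F x = x ^ (a + 1) * E₁ x) (hG : ∀ x, ‖x‖ ≠ 1 → G x = x ^ a * E₂ x)
    (hE₁ : ∀ x, ‖x‖ ≠ 1 → DifferentiableAt ℂ E₁ x)
    (hE₂ : ∀ x, ‖x‖ ≠ 1 → DifferentiableAt ℂ E₂ x) : X ^ a ∣ P := by
  have hnhds : {x : ℂ | ‖x‖ ≠ 1} ∈ 𝓝 (0 : ℂ) := isOpen_norm_ne_one.mem_nhds (by simp)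
  have hdE : ContinuousAt (deriv E₂) 0 := by
    have : DifferentiableOn ℂ E₂ {x | ‖x‖ ≠ 1} := fun x hx => (hE₂ x hx).differentiableWithinAt
    exact ((this.analyticAt hnhds).deriv).continuousAt
  have h₁ := (hE₁ 0 (by simp)).continuousAt
  have h₂ := (hE₂ 0 (by simp)).continuousAt
  set W₁ : ℂ → ℂ := fun x => ∏ k ∈ Finset.univ.erase j₀, (x - z k) with hW₁
  have hW₁c : Continuous W₁ := by fun_prop
  refine X_pow_dvd_of_eventually_eq (H := fun x => (polyW z).eval x * (x * E₁ x *
      (derivative g).eval x - f.eval x * deriv E₂ x) - W₁ x * f.eval x * (a * E₂ x)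
      + V.eval x * (g.eval x * (x * E₁ x) + f.eval x * E₂ x)) ?_ ?_
  · have c1 := fun p : ℂ[X] => p.continuous.continuousAt (x := (0 : ℂ))
    have hid : ContinuousAt (fun x : ℂ => x) 0 := continuousAt_id
    exact (((c1 _).mul (((hid.mul h₁).mul (c1 _)).sub ((c1 _).mul hdE))).sub
      ((hW₁c.continuousAt.mul (c1 _)).mul (continuousAt_const.mul h₂))).add
      ((c1 _).mul (((c1 _).mul (hid.mul h₁)).add ((c1 _).mul h₂)))
  · filter_upwards [nhdsWithin_le_nhds hnhds] with x hx
    have hdG : deriv G x = a * x ^ (a - 1) * E₂ x + x ^ a * deriv E₂ x := by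
      have h1 : G =ᶠ[𝓝 x] fun x => x ^ a * E₂ x := by
        filter_upwards [isOpen_norm_ne_one.mem_nhds hx] with y hy using hG y hy
      rw [h1.deriv_eq]
      exact ((hasDerivAt_pow a x).mul (hE₂ x hx).hasDerivAt).deriv
    have hW : (polyW z).eval x = x * W₁ x := by rw [eval_polyW_eq_mul z x j₀, hz₀, sub_zero]
    have ha : x * (a * x ^ (a - 1)) = a * x ^ a := by
      rcases a with _ | a
      · simp
      · simp only [Nat.add_sub_cancel]; ring
    rw [hP x hx, hF x hx, hG x hx, hdG, hW]
    linear_combination (-(W₁ x * f.eval x * E₂ x)) * ha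

end Biorth

/-! ### Associated functions and the spectral coefficients Ω, Ω* -/

namespace Biorth
open Filter Topology Asymptotics MeasureTheory Set

section SpectralCoefficients

variable {m n N : ℕ} {z ρ : Fin m → ℂ} {w : ℂ → ℂ} {φ φbar : ℕ → ℂ[X]} {x : ℂ}

lemma recip_eq_reflect {k : ℕ} (hk : (φbar k).natDegree ≤ k) :
    recip φbar k = reflect k (φbar k) := by
  ext i
  rw [coeff_reflect, recip, finsetSum_coeff]
  simp only [coeff_C_mul, coeff_X_pow]
  rcases Nat.lt_or_ge k i with hi | hi
  · rw [revAt_eq_self_of_lt hi, coeff_eq_zero_of_natDegree_lt (hk.trans_lt hi)]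
    exact Finset.sum_eq_zero fun j _ => by rw [if_neg (by omega), mul_zero]
  · rw [revAt_le hi, Finset.sum_eq_single (k - i)]
    · rw [if_pos (by omega), mul_one]
    · intro j hj hji
      have := Finset.mem_range.mp hj
      rw [if_neg (by omega), mul_zero]
    · intro h
      exact absurd (Finset.mem_range.mpr (by omega)) h

lemma IsBiorthonormal.isToeplitzBiorth (h : IsBiorthonormal w N φ φbar)
    (hw : CircleIntegrable w 0 1) : IsToeplitzBiorth (pairing w) N φ φbar where
  natDegree_eq := h.natDegree_eq
  natDegree_bar_eq := h.natDegree_bar_eq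
  leadingCoeff_eq := h.leadingCoeff_eq
  orthonormal j hj k hk := by
    rw [← h.orthonormal j hj k hk, pairing_apply hw]
    refine circMean_congr fun ζ hζ => ?_
    rw [← Complex.inv_eq_conj (by simpa using hζ)]

lemma carath_eq (hw : CircleIntegrable w 0 1) (hx : ‖x‖ ≠ 1) :
    carath w x = cauchyPairing w x (X + C x) 1 := by
  rw [cauchyPairing, pairing_apply (circleIntegrable_div_sub hw hx), carath]
  congr 1; funext ζ
  simp only [eval_add, eval_X, eval_C, eval_one]
  ring

lemma apply_X_add_C (hw : CircleIntegrable w 0 1) (hx : ‖x‖ ≠ 1) (p q : ℂ[X]) :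
    cauchyPairing w x ((X + C x) * p) q = 2 * x * cauchyPairing w x p q + pairing w p q := by
  have := (isCauchyForm_pairing hw (circleIntegrable_div_sub hw hx)).apply_X_mul p q
  rw [add_mul, map_add, LinearMap.add_apply, ← smul_eq_C_mul, map_smul, LinearMap.smul_apply,
    smul_eq_mul, cauchyPairing, this]
  ring

/-- Since (ζ+x)/(ζ-x) = 2ζ/(ζ-x) - 1, the correction is B(φ_k,1). It is 0 for k ≥ 1 and 1/κ_0 for k
= 0, matching the convention for ψ_0. -/
lemma eps_eq (h : IsToeplitzBiorth (pairing w) N φ φbar) (hw : CircleIntegrable w 0 1)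
    (hx : ‖x‖ ≠ 1) {k : ℕ} (hk : k ≤ N) :
    eps w φ k x = 2 * cauchyPairing w x (X * φ k) 1 := by
  have hu := circleIntegrable_div_sub hw hx
  have hX := (isCauchyForm_pairing hw hu).apply_X_mul (φ k) 1
  have hAdd := apply_X_add_C hw hx (φ k) 1
  rw [cauchyPairing] at hAdd ⊢
  rw [eps, carath_eq hw hx, hX, psi, cauchyPairing]
  split_ifs with h0
  · subst h0
    have hC : φ 0 = kappa φ 0 • 1 := by
      rw [← C_eq_smul_one', ← h.coeff_self hk]
      exact eq_C_of_natDegree_le_zero (h.natDegree_eq 0 hk).le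
    have h1 := h.apply_self hk (q := 1) (by simp)
    rw [coeff_one_zero] at h1
    rw [← h1]
    have h2 : pairing (fun ζ => w ζ / (ζ - x)) (X + C x) 1 * (φ 0).eval x =
        pairing (fun ζ => w ζ / (ζ - x)) ((X + C x) * φ 0) 1 := by
      rw [hC, mul_smul_comm, mul_one, map_smul, LinearMap.smul_apply, eval_smul, eval_one]
      simp [mul_comm]
    rw [h2, hAdd]
    ring
  · have h1 : pairing w (φ k) 1 = 0 := h.apply_self_eq_zero hk (by simp; omega)
    have h2 : circMean (fun ζ => (ζ + x) / (ζ - x) * w ζ * ((φ k).eval ζ - (φ k).eval x)) =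
        pairing (fun ζ => w ζ / (ζ - x)) ((X + C x) * (φ k - C ((φ k).eval x))) 1 := by
      rw [pairing_apply hu]
      congr 1; funext ζ
      simp only [eval_mul, eval_add, eval_sub, eval_X, eval_C, eval_one]
      ring
    rw [h2, mul_sub, map_sub, LinearMap.sub_apply, hAdd, mul_comm _ (C _), ← smul_eq_C_mul,
      map_smul, LinearMap.smul_apply, smul_eq_mul, h1]
    ring

lemma epsStar_eq (h : IsToeplitzBiorth (pairing w) N φ φbar) (hw : CircleIntegrable w 0 1)
    (hx : ‖x‖ ≠ 1) {k : ℕ} (hk : k ≤ N) :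
    epsStar w φ φbar k x = -(2 * x ^ (k + 1) * cauchyPairing w x 1 (φbar k)) := by
  have hu := circleIntegrable_div_sub hw hx
  rw [epsStar, carath_eq hw hx, psiStar]
  have hAdd := fun q => apply_X_add_C hw hx 1 q
  simp only [mul_one] at hAdd
  split_ifs with h0
  · subst h0
    have hC : φbar 0 = kappa φ 0 • 1 := by
      rw [← C_eq_smul_one', ← h.kappa_bar hk, ← h.flip.coeff_self hk]
      exact eq_C_of_natDegree_le_zero (h.natDegree_bar_eq 0 hk).le
    have h1 := h.apply_bar hk (p := 1) (by simp)
    rw [coeff_one_zero, hC, map_smul, smul_eq_mul] at h1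
    rw [recip_eq_reflect (h.natDegree_bar_eq 0 hk).le, hC, hAdd, ← h1, map_smul, smul_eq_mul,
      ← C_eq_smul_one', reflect_C]
    simp
    ring
  · have h1 : pairing w 1 (φbar k) = 0 := h.apply_bar_eq_zero hk (by simp; omega)
    have h2 : circMean (fun ζ => (ζ + x) / (ζ - x) * w ζ *
        (x ^ k * (φbar k).eval ((starRingEnd ℂ) ζ) - (recip φbar k).eval x)) =
        cauchyPairing w x (X + C x) (x ^ k • φbar k - (recip φbar k).eval x • 1) := by
      rw [cauchyPairing, pairing_apply hu]
      refine circMean_congr fun ζ hζ => ?_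
      rw [← Complex.inv_eq_conj (by simpa using hζ)]
      simp only [eval_add, eval_sub, eval_X, eval_C, eval_one, eval_smul, smul_eq_mul]
      ring
    rw [h2, map_sub, map_smul, map_smul, hAdd, hAdd, h1, smul_eq_mul, smul_eq_mul]
    ring

/-- A Cauchy transform of φ*_k plus a constant: the shape required by
`exists_concomitant_polynomial`, whose free constants a and b exist for this use. -/
lemma epsStar_eq_recip (h : IsToeplitzBiorth (pairing w) N φ φbar) (hw : CircleIntegrable w 0 1)
    (hx : ‖x‖ ≠ 1) {k : ℕ} (hk : k ≤ N) :
    epsStar w φ φbar k x = -(2 * (cauchyPairing w x (X * recip φbar k) 1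
      + -pairing w (recip φbar k) 1)) := by
  have hu := isCauchyForm_pairing hw (circleIntegrable_div_sub hw hx)
  rw [epsStar_eq h hw hx hk, cauchyPairing, hu.apply_X_mul,
    recip_eq_reflect (h.natDegree_bar_eq k hk).le, hu.apply_reflect_bar_one h hk]
  ring

lemma poly_eq_of_eq_off_circle {P Q : ℂ[X]} (h : ∀ x : ℂ, ‖x‖ ≠ 1 → P.eval x = Q.eval x) :
    P = Q := by
  refine Polynomial.eq_of_infinite_eval_eq P Q (Set.Infinite.mono (s := Metric.ball 0 1) ?_ ?_)
  · intro x hx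
    exact h x (by rw [Metric.mem_ball, dist_zero_right] at hx; exact hx.ne)
  · exact infinite_of_mem_nhds 0 (Metric.ball_mem_nhds 0 one_pos)

/-- Existence and uniqueness of the spectral coefficient function and its values at the singular
points. -/
lemma isOmega_existsUnique (hw : IsRegularSemiclassical (polyW z) (polyV z ρ) w)
    (hlim : IsRegularSemiclassical.VanishesAtSingular z w)
    (h : IsBiorthonormal w (n + 1) φ φbar) {j₀ : Fin m} (hz₀ : z j₀ = 0)
    (hr : (φ (n + 1)).eval 0 ≠ 0) :
    (∃! Ω : ℂ[X], IsOmega (polyW z) (polyV z ρ) w φ n Ω) ∧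
    ∀ Ω : ℂ[X], IsOmega (polyW z) (polyV z ρ) w φ n Ω → ∀ j, z j ≠ 0 →
      (Ω.eval (z j) - (polyV z ρ).eval (z j)) / (polyV z ρ).eval (z j) =
        2 * z j * (kappa φ n / (φ (n + 1)).eval 0) *
          cauchyPairing w (z j) (φ (n + 1)) (reflect n (φ n)) := by
  have hi := hw.integrable
  have hT := h.isToeplitzBiorth hi
  have hB := isToeplitz_pairing hi
  have hk := hT.kappa_ne_zero (k := n) (by omega)
  set c := (φ (n + 1)).eval 0 / kappa φ n with hc
  have hc0 : c ≠ 0 := div_ne_zero hr hk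
  obtain ⟨P, hP, hPz⟩ := hw.exists_concomitant_polynomial hlim (φ (n + 1)) (φ n) 0 0
  simp only [add_zero] at hP hPz
  have hdvd : X ^ n ∣ P := X_pow_dvd_concomitant hz₀ hP
    (fun x hx => (hw.isCauchyForm_off hx).apply_X_mul_self_one hT hB le_rfl)
    (fun x hx => (hw.isCauchyForm_off hx).apply_X_mul_self_one' hT hB (by omega))
    (fun x hx => (hasDerivAt_cauchyPairing hi hx _ _).differentiableAt)
    (fun x hx => (hasDerivAt_cauchyPairing hi hx _ _).differentiableAt)
  -- The defining identity off the circle is equivalent to one polynomial identity, valid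
  -- everywhere. Existence, uniqueness and evaluation at z_j on the circle all follow from it.
  have hiff : ∀ Ω : ℂ[X], IsOmega (polyW z) (polyV z ρ) w φ n Ω ↔ C c * X ^ n * Ω = P := by
    intro Ω
    have hcalc : ∀ x, ‖x‖ ≠ 1 → (polyW z).eval x * (eps w φ (n + 1) x * (φ n).derivative.eval x
          - (φ (n + 1)).eval x * deriv (eps w φ n) x)
        + (polyV z ρ).eval x * ((φ n).eval x * eps w φ (n + 1) x
          + eps w φ n x * (φ (n + 1)).eval x) = 2 * P.eval x := by
      intro x hx
      have hd : deriv (eps w φ n) x = 2 * deriv (fun x => cauchyPairing w x (X * φ n) 1) x := by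
        have h1 : eps w φ n =ᶠ[𝓝 x] fun x => 2 * cauchyPairing w x (X * φ n) 1 := by
          filter_upwards [isOpen_norm_ne_one.mem_nhds hx] with y hy
          exact eps_eq hT hi hy (by omega)
        rw [h1.deriv_eq]
        exact ((hasDerivAt_cauchyPairing hi hx _ _).differentiableAt.hasDerivAt.const_mul 2).deriv
      rw [hd, hP x hx, eps_eq hT hi hx le_rfl, eps_eq hT hi hx (by omega)]
      ring
    constructor
    · intro hΩ
      refine poly_eq_of_eq_off_circle fun x hx => ?_
      have h1 := hΩ x hx
      rw [hcalc x hx] at h1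
      simp only [eval_mul, eval_C, eval_pow, eval_X]
      linear_combination (1 / 2) * h1
    · intro hΩ x hx
      rw [hcalc x hx, ← hΩ]
      simp only [eval_mul, eval_C, eval_pow, eval_X]
      ring
  have hne : C c * X ^ n ≠ 0 := mul_ne_zero (C_ne_zero.mpr hc0) (pow_ne_zero n X_ne_zero)
  refine ⟨?_, fun Ω hΩ j hj => ?_⟩
  · obtain ⟨Q, rfl⟩ := hdvd
    refine ⟨C c⁻¹ * Q, (hiff _).mpr ?_, fun Ω hΩ => ?_⟩
    · have : C c * C c⁻¹ = 1 := by rw [← C_mul, mul_inv_cancel₀ hc0, C_1]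
      linear_combination X ^ n * Q * this
    · have h1 := (hiff Ω).mp hΩ
      refine mul_left_cancel₀ hne (h1.trans ?_)
      have : C c * C c⁻¹ = 1 := by rw [← C_mul, mul_inv_cancel₀ hc0, C_1]
      linear_combination -(X ^ n * Q * this)
  · have h1 := congrArg (eval (z j)) ((hiff Ω).mp hΩ)
    rw [hPz j, (hw.isCauchyForm j).bilinear_concomitant hT hB hj le_rfl] at h1
    simp only [eval_mul, eval_C, eval_pow, eval_X] at h1
    have hV := hw.eval_polyV_ne_zero j
    have hzn : z j ^ n ≠ 0 := pow_ne_zero n hj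
    have h2 : c * Ω.eval (z j) = (polyV z ρ).eval (z j) *
        (2 * z j * cauchyPairing w (z j) (φ (n + 1)) (reflect n (φ n)) + c) := by
      refine mul_left_cancel₀ hzn ?_
      rw [hc] at h1 ⊢
      linear_combination h1
    have h3 : kappa φ n / (φ (n + 1)).eval 0 = c⁻¹ := by rw [hc, inv_div]
    rw [h3, div_eq_iff hV]
    refine mul_left_cancel₀ hc0 ?_
    field_simp
    linear_combination h2

/-- Existence and uniqueness of the reciprocal spectral coefficient function and its values at the
singular points. -/
lemma isOmegaStar_existsUnique (hw : IsRegularSemiclassical (polyW z) (polyV z ρ) w)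
    (hlim : IsRegularSemiclassical.VanishesAtSingular z w)
    (h : IsBiorthonormal w (n + 1) φ φbar) {j₀ : Fin m} (hz₀ : z j₀ = 0)
    (hr : (φbar (n + 1)).eval 0 ≠ 0) :
    (∃! Ω : ℂ[X], IsOmegaStar (polyW z) (polyV z ρ) w φ φbar n Ω) ∧
    ∀ Ω : ℂ[X], IsOmegaStar (polyW z) (polyV z ρ) w φ φbar n Ω → ∀ j, z j ≠ 0 →
      (Ω.eval (z j) + (polyV z ρ).eval (z j)) / (polyV z ρ).eval (z j) =
        2 * z j * (kappa φ n / (φbar (n + 1)).eval 0) *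
          cauchyPairing w (z j) (reflect n (φbar n)) (φbar (n + 1)) := by
  have hi := hw.integrable
  have hT := h.isToeplitzBiorth hi
  have hB := isToeplitz_pairing hi
  have hk := hT.kappa_ne_zero (k := n) (by omega)
  have hf := recip_eq_reflect (hT.natDegree_bar_eq (n + 1) le_rfl).le
  have hg := recip_eq_reflect (hT.natDegree_bar_eq n (by omega)).le
  set c := (φbar (n + 1)).eval 0 / kappa φ n with hc
  have hc0 : c ≠ 0 := div_ne_zero hr hk
  have hform : ∀ k ≤ n + 1, ∀ x, IsCauchyForm (pairing w) (cauchyPairing w x) x →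
      cauchyPairing w x (X * recip φbar k) 1 + -pairing w (recip φbar k) 1 =
        x ^ (k + 1) * cauchyPairing w x 1 (φbar k) := by
    intro k hk x hx
    rw [hx.apply_X_mul, recip_eq_reflect (hT.natDegree_bar_eq k hk).le,
      hx.apply_reflect_bar_one hT hk]
    ring
  obtain ⟨P, hP, hPz⟩ := hw.exists_concomitant_polynomial hlim (recip φbar (n + 1))
    (recip φbar n) (-pairing w (recip φbar (n + 1)) 1) (-pairing w (recip φbar n) 1)
  have hdvd : X ^ (n + 1) ∣ P := X_pow_dvd_concomitant hz₀ hP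
    (fun x hx => hform _ le_rfl x (hw.isCauchyForm_off hx))
    (fun x hx => hform _ (by omega) x (hw.isCauchyForm_off hx))
    (fun x hx => (hasDerivAt_cauchyPairing hi hx _ _).differentiableAt)
    (fun x hx => (hasDerivAt_cauchyPairing hi hx _ _).differentiableAt)
  have hiff : ∀ Ω : ℂ[X], IsOmegaStar (polyW z) (polyV z ρ) w φ φbar n Ω ↔
      C c * X ^ (n + 1) * Ω = P := by
    intro Ω
    have hcalc : ∀ x, ‖x‖ ≠ 1 → (polyW z).eval x *
          (-(epsStar w φ φbar (n + 1) x * (recip φbar n).derivative.eval x)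
          + (recip φbar (n + 1)).eval x * deriv (epsStar w φ φbar n) x)
        - (polyV z ρ).eval x * ((recip φbar n).eval x * epsStar w φ φbar (n + 1) x
          + epsStar w φ φbar n x * (recip φbar (n + 1)).eval x) = 2 * P.eval x := by
      intro x hx
      have hd : deriv (epsStar w φ φbar n) x = -(2 * deriv (fun x =>
          cauchyPairing w x (X * recip φbar n) 1 + -pairing w (recip φbar n) 1) x) := by
        have h1 : epsStar w φ φbar n =ᶠ[𝓝 x] fun x =>
            -(2 * (cauchyPairing w x (X * recip φbar n) 1 + -pairing w (recip φbar n) 1)) := by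
          filter_upwards [isOpen_norm_ne_one.mem_nhds hx] with y hy
          exact epsStar_eq_recip hT hi hy (by omega)
        rw [h1.deriv_eq]
        exact ((((hasDerivAt_cauchyPairing hi hx _ _).add_const
          _).differentiableAt.hasDerivAt.const_mul 2).neg).deriv
      rw [hd, hP x hx, epsStar_eq_recip hT hi hx le_rfl, epsStar_eq_recip hT hi hx (by omega)]
      ring
    constructor
    · intro hΩ
      refine poly_eq_of_eq_off_circle fun x hx => ?_
      have h1 := hΩ x hx
      rw [hcalc x hx] at h1
      simp only [eval_mul, eval_C, eval_pow, eval_X]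
      linear_combination (1 / 2) * h1
    · intro hΩ x hx
      rw [hcalc x hx, ← hΩ]
      simp only [eval_mul, eval_C, eval_pow, eval_X]
      ring
  have hne : C c * X ^ (n + 1) ≠ 0 :=
    mul_ne_zero (C_ne_zero.mpr hc0) (pow_ne_zero _ X_ne_zero)
  have hcc : C c * C c⁻¹ = 1 := by rw [← C_mul, mul_inv_cancel₀ hc0, C_1]
  refine ⟨?_, fun Ω hΩ j hj => ?_⟩
  · obtain ⟨Q, rfl⟩ := hdvd
    refine ⟨C c⁻¹ * Q, (hiff _).mpr ?_, fun Ω hΩ => ?_⟩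
    · linear_combination X ^ (n + 1) * Q * hcc
    · have h1 := (hiff Ω).mp hΩ
      refine mul_left_cancel₀ hne (h1.trans ?_)
      linear_combination -(X ^ (n + 1) * Q * hcc)
  · have h1 := congrArg (eval (z j)) ((hiff Ω).mp hΩ)
    have hcf := hw.isCauchyForm j
    have h5 := hcf.bilinear_concomitant_star hT hB hj le_rfl
    rw [hPz j, hf, hg, hcf.apply_X_mul, hcf.apply_X_mul] at h1
    simp only [eval_mul, eval_C, eval_pow, eval_X] at h1
    have hV := hw.eval_polyV_ne_zero j
    have hzn : z j ^ (n + 1) ≠ 0 := pow_ne_zero _ hj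
    have h2 : c * Ω.eval (z j) = (polyV z ρ).eval (z j) *
        (2 * z j * cauchyPairing w (z j) (reflect n (φbar n)) (φbar (n + 1)) - c) := by
      refine mul_left_cancel₀ hzn ?_
      rw [hc] at h1 ⊢
      -- By `apply_X_mul`, each transform minus its constant is z_j β_j(φ*_k,1); the common factor
      -- z_j matches the one kept in the star identity `h5`.
      linear_combination h1 + (polyV z ρ).eval (z j) * h5
    have h3 : kappa φ n / (φbar (n + 1)).eval 0 = c⁻¹ := by rw [hc, inv_div]
    rw [h3, div_eq_iff hV]
    refine mul_left_cancel₀ hc0 ?_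
    field_simp
    linear_combination h2

end SpectralCoefficients

end Biorth

/-! ### Comparison estimates for linear equations, uniform in the pole -/

namespace Biorth
open Filter Topology Asymptotics MeasureTheory Set

/-- A function whose derivative is dominated by itself on a small convex compact set is comparable
to any of its values there. -/
lemma norm_le_two_mul_of_norm_deriv_le {𝕜 E : Type*} [RCLike 𝕜] [NormedAddCommGroup E]
    [NormedSpace 𝕜 E] {f f' : 𝕜 → E} {K : Set 𝕜} {M : ℝ} (hK : IsCompact K) (hc : Convex ℝ K)
    (hM : 0 ≤ M) (hd : ∀ x ∈ K, HasDerivWithinAt f (f' x) K x)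
    (hb : ∀ x ∈ K, ‖f' x‖ ≤ M * ‖f x‖) (hdiam : ∀ x ∈ K, ∀ y ∈ K, M * ‖x - y‖ ≤ 1 / 2)
    {x y : 𝕜} (hx : x ∈ K) (hy : y ∈ K) : ‖f x‖ ≤ 2 * ‖f y‖ := by
  have hcont : ContinuousOn f K := fun x hx => (hd x hx).continuousWithinAt
  -- The mean value inequality is applied at a maximiser of the norm, where the derivative bound
  -- becomes half the maximum and can be absorbed.
  obtain ⟨p, hp, hmax⟩ := hK.exists_isMaxOn ⟨x, hx⟩ hcont.norm
  have hmax' : ∀ y ∈ K, ‖f y‖ ≤ ‖f p‖ := fun y hy => hmax hy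
  have h1 : ‖f p - f y‖ ≤ (M * ‖f p‖) * ‖p - y‖ :=
    hc.norm_image_sub_le_of_norm_hasDerivWithin_le hd
      (fun x hx => (hb x hx).trans (mul_le_mul_of_nonneg_left (hmax' x hx) hM)) hy hp
  have h2 : (M * ‖f p‖) * ‖p - y‖ ≤ 1 / 2 * ‖f p‖ := by
    rw [mul_right_comm]
    exact mul_le_mul_of_nonneg_right (hdiam p hp y hy) (norm_nonneg _)
  have h3 : ‖f p‖ ≤ ‖f y‖ + ‖f p - f y‖ := by
    simpa using norm_add_le (f y) (f p - f y)
  linarith [hmax' x hx]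

/-- A short arc of the unit circle, seen from a point off the arc, can be rotated into the slit
plane. -/
lemma exists_rotation_mem_slitPlane {α β : ℝ} (hαβ : β - α ≤ 1) {a : ℂ}
    (hne : ∀ θ ∈ Icc α β, circleMap 0 1 θ ≠ a) :
    ∃ c : ℂ, ‖c‖ = 1 ∧ ∀ θ ∈ Icc α β, c * (circleMap 0 1 θ - a) ∈ Complex.slitPlane := by
  -- With this rotation the real part along the arc is sin(θ-α) up to a constant, injective for arc
  -- length at most 1. The arc therefore meets the imaginary axis at most once, and a further factor
  -- ∓I sends that crossing to the positive real axis.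
  set c₀ : ℂ := -Complex.I * Complex.exp (-(α * Complex.I)) with hc₀
  have hc₀n : ‖c₀‖ = 1 := by
    rw [hc₀, norm_mul, ← neg_mul, ← Complex.ofReal_neg, Complex.norm_exp_ofReal_mul_I]
    simp
  set p : ℝ → ℂ := fun θ => c₀ * (circleMap 0 1 θ - a) with hp
  have hp0 : ∀ θ ∈ Icc α β, p θ ≠ 0 := fun θ hθ =>
    mul_ne_zero (norm_ne_zero_iff.mp (by rw [hc₀n]; exact one_ne_zero))
      (sub_ne_zero.mpr (hne θ hθ))
  have hre : ∀ θ, (p θ).re = Real.sin (θ - α) - (c₀ * a).re := by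
    intro θ
    have : c₀ * circleMap 0 1 θ = -Complex.I * Complex.exp ((θ - α : ℝ) * Complex.I) := by
      rw [hc₀, circleMap_zero, Complex.ofReal_one, one_mul, mul_assoc, ← Complex.exp_add]
      push_cast
      ring_nf
    rw [hp]
    simp only [mul_sub, Complex.sub_re]
    rw [this, neg_mul, Complex.neg_re, Complex.I_mul_re, Complex.exp_ofReal_mul_I_im, neg_neg]
  have hinj : ∀ θ ∈ Icc α β, ∀ θ' ∈ Icc α β, (p θ).re = (p θ').re → θ = θ' := by
    intro θ hθ θ' hθ' h
    rw [hre, hre] at h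
    have hpi := Real.pi_gt_three
    have h1 := Real.injOn_sin (x₁ := θ - α) (x₂ := θ' - α)
      ⟨by linarith [hθ.1], by linarith [hθ.2]⟩ ⟨by linarith [hθ'.1], by linarith [hθ'.2]⟩
      (by linarith)
    linarith
  have hI : ∀ θ, (Complex.I * p θ).re = -(p θ).im ∧ (Complex.I * p θ).im = (p θ).re := fun θ => by
    simp
  by_cases h : ∃ θ ∈ Icc α β, (p θ).re = 0 ∧ 0 < (p θ).im
  · obtain ⟨θ₀, hθ₀, h1, h2⟩ := h
    refine ⟨-Complex.I * c₀, by simp [hc₀n], fun θ hθ => ?_⟩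
    rw [mul_assoc, Complex.mem_slitPlane_iff, neg_mul, Complex.neg_re, Complex.neg_im]
    change 0 < -(Complex.I * p θ).re ∨ -(Complex.I * p θ).im ≠ 0
    rw [(hI θ).1, (hI θ).2, neg_neg]
    by_cases h3 : (p θ).re = 0
    · left; rwa [hinj θ hθ θ₀ hθ₀ (h3.trans h1.symm)]
    · right; exact neg_ne_zero.mpr h3
  · push Not at h
    refine ⟨Complex.I * c₀, by simp [hc₀n], fun θ hθ => ?_⟩
    rw [mul_assoc, Complex.mem_slitPlane_iff]
    change 0 < (Complex.I * p θ).re ∨ (Complex.I * p θ).im ≠ 0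
    rw [(hI θ).1, (hI θ).2]
    by_cases h3 : (p θ).re = 0
    · left
      have := h θ hθ h3
      rcases this.lt_or_eq with h4 | h4
      · linarith
      · exact absurd (Complex.ext h3 h4) (hp0 θ hθ)
    · right; exact h3

/-- Two-sided comparison of solutions of a first order equation on a short arc of the circle with a
simple pole of residue `r` in the coefficient, uniformly in the position of the pole. -/
lemma norm_le_of_fuchsian {x y : ℝ} (hxy : |y - x| ≤ 1) {a r : ℂ} {u h : ℝ → ℂ} {H : ℝ}
    (hne : ∀ θ ∈ uIcc x y, circleMap 0 1 θ ≠ a)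
    (hu : ∀ θ ∈ uIcc x y, HasDerivAt u
      ((r * (circleMap 0 1 θ * Complex.I) / (circleMap 0 1 θ - a) + h θ) * u θ) θ)
    (hH : ∀ θ ∈ uIcc x y, ‖h θ‖ ≤ H) (hHd : H * |y - x| ≤ 1 / 2) :
    ‖u x‖ ≤ 2 * Real.exp (2 * Real.pi * |r.im|) *
      (‖circleMap 0 1 x - a‖ / ‖circleMap 0 1 y - a‖) ^ r.re * ‖u y‖ := by
  obtain ⟨c, hc, hslit⟩ := exists_rotation_mem_slitPlane (α := min x y) (β := max x y)
    (by rwa [max_sub_min_eq_abs]) hne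
  have hc0 : c ≠ 0 := norm_ne_zero_iff.mp (by rw [hc]; exact one_ne_zero)
  set q : ℝ → ℂ := fun θ => c * (circleMap 0 1 θ - a) with hq
  have hq0 : ∀ θ ∈ uIcc x y, q θ ≠ 0 := fun θ hθ => mul_ne_zero hc0 (sub_ne_zero.mpr (hne θ hθ))
  have hqd : ∀ θ, HasDerivAt q (c * (circleMap 0 1 θ * Complex.I)) θ := fun θ =>
    ((hasDerivAt_circleMap 0 1 θ).sub_const a).const_mul c
  -- Dividing by a branch of (ζ-a)^r removes the pole from the equation, leaving v' = hv.
  set v : ℝ → ℂ := fun θ => u θ * q θ ^ (-r) with hv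
  have hvd : ∀ θ ∈ uIcc x y, HasDerivAt v (h θ * v θ) θ := by
    intro θ hθ
    have h1 : HasDerivAt (fun θ => q θ ^ (-r))
        (-r * q θ ^ (-r - 1) * (c * (circleMap 0 1 θ * Complex.I))) θ := by
      have := (hasDerivAt_id (q θ)).cpow_const (c := -r) (hslit θ hθ)
      rw [mul_one] at this
      exact this.comp θ (hqd θ)
    refine ((hu θ hθ).mul h1).congr_deriv ?_
    rw [Complex.cpow_sub _ _ (hq0 θ hθ), Complex.cpow_one]
    have h2 := sub_ne_zero.mpr (hne θ hθ)
    simp only [hv, hq]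
    field_simp
    ring
  have hH0 : 0 ≤ H := (norm_nonneg _).trans (hH x left_mem_uIcc)
  have hvxy : ‖v x‖ ≤ 2 * ‖v y‖ := by
    refine norm_le_two_mul_of_norm_deriv_le (𝕜 := ℝ) (f := v) (f' := fun θ => h θ * v θ)
      (K := uIcc x y) isCompact_uIcc (convex_uIcc x y) hH0
      (fun θ hθ => (hvd θ hθ).hasDerivWithinAt) (fun θ hθ => ?_) (fun s hs s' hs' => ?_)
      left_mem_uIcc right_mem_uIcc
    · rw [norm_mul]; exact mul_le_mul_of_nonneg_right (hH θ hθ) (norm_nonneg _)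
    · refine (mul_le_mul_of_nonneg_left ?_ hH0).trans hHd
      rw [Real.norm_eq_abs, abs_sub_comm y x]
      exact abs_sub_le_of_uIcc_subset_uIcc (uIcc_subset_uIcc hs' hs) |>.trans
        (by rw [abs_sub_comm])
  have hqn : ∀ θ, ‖q θ‖ = ‖circleMap 0 1 θ - a‖ := fun θ => by rw [hq]; simp [hc]
  have hcp : ∀ θ ∈ uIcc x y, ‖q θ ^ r‖ = ‖q θ‖ ^ r.re / Real.exp (Complex.arg (q θ) * r.im) :=
    fun θ hθ => Complex.norm_cpow_of_ne_zero (hq0 θ hθ) r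
  have huv : ∀ θ ∈ uIcc x y, u θ = v θ * q θ ^ r := by
    intro θ hθ
    rw [hv]
    simp only
    rw [mul_assoc, ← Complex.cpow_add _ _ (hq0 θ hθ), neg_add_cancel, Complex.cpow_zero, mul_one]
  have harg : ∀ θ, |Complex.arg (q θ) * r.im| ≤ Real.pi * |r.im| := fun θ => by
    rw [abs_mul]
    exact mul_le_mul_of_nonneg_right (Complex.abs_arg_le_pi _) (abs_nonneg _)
  have hx := left_mem_uIcc (a := x) (b := y)
  have hy := right_mem_uIcc (a := x) (b := y)
  have hqx : 0 < ‖q x‖ := norm_pos_iff.mpr (hq0 x hx)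
  have hqy : 0 < ‖q y‖ := norm_pos_iff.mpr (hq0 y hy)
  rw [← hqn, ← hqn, Real.div_rpow hqx.le hqy.le]
  have h1 : ‖v y‖ = ‖u y‖ * Real.exp (Complex.arg (q y) * r.im) / ‖q y‖ ^ r.re := by
    have e : ‖u y‖ = ‖v y‖ * (‖q y‖ ^ r.re / Real.exp (Complex.arg (q y) * r.im)) :=
      (congrArg norm (huv y hy)).trans (by rw [norm_mul, hcp y hy])
    rw [e]
    have := (Real.rpow_pos_of_pos hqy r.re).ne'
    field_simp
  -- Each argument lies in [-π,π], so the non-modulus part of the complex power costs a constant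
  -- independent of the pole.
  have h2 : Real.exp (Complex.arg (q y) * r.im) / Real.exp (Complex.arg (q x) * r.im) ≤
      Real.exp (2 * Real.pi * |r.im|) := by
    rw [← Real.exp_sub, Real.exp_le_exp]
    have := abs_le.mp (harg x)
    have := abs_le.mp (harg y)
    linarith
  calc ‖u x‖ = ‖v x‖ * (‖q x‖ ^ r.re / Real.exp (Complex.arg (q x) * r.im)) := by
        rw [huv x hx, norm_mul, hcp x hx]
    _ ≤ (2 * ‖v y‖) * (‖q x‖ ^ r.re / Real.exp (Complex.arg (q x) * r.im)) := by gcongr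
    _ = 2 * (Real.exp (Complex.arg (q y) * r.im) / Real.exp (Complex.arg (q x) * r.im)) *
        (‖q x‖ ^ r.re / ‖q y‖ ^ r.re) * ‖u y‖ := by rw [h1]; ring
    _ ≤ _ := by gcongr

end Biorth

/-! ### Behaviour of the weight on arcs next to a singular point -/

namespace Biorth
open Filter Topology Asymptotics MeasureTheory Set

lemma circleMap_eq_iff_of_abs_sub_lt {θ θ' : ℝ} (h : |θ - θ'| < 2 * Real.pi)
    (he : circleMap 0 1 θ = circleMap 0 1 θ') : θ = θ' := by
  rw [circleMap_zero, circleMap_zero, mul_right_inj' (by simp), Complex.exp_eq_exp_iff_exists_int] at he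
  obtain ⟨n, hn⟩ := he
  have h1 : θ = θ' + n * (2 * Real.pi) := by
    have h2 : (θ : ℂ) = ((θ' + n * (2 * Real.pi) : ℝ) : ℂ) := by
      apply mul_right_cancel₀ Complex.I_ne_zero
      rw [hn]; push_cast; ring
    exact_mod_cast h2
  have hpi := Real.pi_pos
  have h3 : |(n : ℝ)| < 1 := by
    rw [h1, add_sub_cancel_left, abs_mul, abs_of_pos (by positivity : 0 < 2 * Real.pi)] at h
    by_contra! h4
    nlinarith
  have h4 : n = 0 := by
    rw [← Int.cast_abs] at h3
    exact Int.abs_lt_one_iff.mp (by exact_mod_cast h3)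
  simpa [h4] using h1

lemma eventually_exists_circleMap_eq (α : ℝ) {δ : ℝ} (hδ : 0 < δ) :
    ∀ᶠ ζ in 𝓝 (circleMap 0 1 α), ζ ∈ Metric.sphere (0 : ℂ) 1 →
      ∃ θ, |θ - α| < δ ∧ ζ = circleMap 0 1 θ := by
  have hα : circleMap 0 1 α ≠ 0 := circleMap_ne_center one_ne_zero
  have h1 : ContinuousAt (fun ζ : ℂ => Complex.arg (ζ / circleMap 0 1 α)) (circleMap 0 1 α) := by
    refine ContinuousAt.comp (f := fun ζ : ℂ => ζ / circleMap 0 1 α) (g := Complex.arg) ?_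
      (by fun_prop)
    rw [div_self hα]
    exact Complex.continuousAt_arg (by simp)
  have h2 : ∀ᶠ ζ in 𝓝 (circleMap 0 1 α), |Complex.arg (ζ / circleMap 0 1 α)| < δ := by
    have := h1.abs.tendsto
    simp only [div_self hα, Complex.arg_one, abs_zero] at this
    exact this.eventually (gt_mem_nhds hδ)
  filter_upwards [h2] with ζ hζ hmem
  refine ⟨α + Complex.arg (ζ / circleMap 0 1 α), by simpa using hζ, ?_⟩
  have hn : ‖ζ / circleMap 0 1 α‖ = 1 := by
    rw [norm_div, mem_sphere_zero_iff_norm.mp hmem]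
    simp
  have h3 := Complex.norm_mul_exp_arg_mul_I (ζ / circleMap 0 1 α)
  rw [hn, Complex.ofReal_one, one_mul] at h3
  have h4 : circleMap 0 1 (α + Complex.arg (ζ / circleMap 0 1 α)) =
      circleMap 0 1 α * (ζ / circleMap 0 1 α) := by
    conv_rhs => rw [← h3]
    rw [circleMap_zero, Complex.ofReal_add, add_mul, Complex.exp_add, circleMap_zero]
    ring
  rw [h4, mul_div_cancel₀ _ hα]

namespace IsRegularSemiclassical

variable {m : ℕ} {z ρ : Fin m → ℂ} {w : ℂ → ℂ}

lemma hasDerivAt_comp_circleMap (h : IsRegularSemiclassical (polyW z) (polyV z ρ) w) {θ : ℝ}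
    (hθ : circleMap 0 1 θ ∉ range z) (k : Fin m) :
    HasDerivAt (fun θ => w (circleMap 0 1 θ))
      ((ρ k * (circleMap 0 1 θ * Complex.I) / (circleMap 0 1 θ - z k)
        + circleMap 0 1 θ * Complex.I *
          ∑ l ∈ Finset.univ.erase k, ρ l / (circleMap 0 1 θ - z l)) * w (circleMap 0 1 θ)) θ := by
  have hmem := circleMap_mem_sphere_one θ
  have hd := (h.differentiable _ hmem (eval_polyW_ne_zero_iff.mpr hθ)).hasDerivWithinAt
  rw [h.derivWithin_eq hmem hθ] at hd
  refine (hd.comp_hasDerivAt θ (hasDerivAt_circleMap 0 1 θ)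
    (Eventually.of_forall circleMap_mem_sphere_one)).congr_deriv ?_
  rw [← Finset.add_sum_erase _ _ (Finset.mem_univ k)]
  have : ∑ l ∈ Finset.univ.erase k, ρ l * (w (circleMap 0 1 θ) / (circleMap 0 1 θ - z l)) =
      (∑ l ∈ Finset.univ.erase k, ρ l / (circleMap 0 1 θ - z l)) * w (circleMap 0 1 θ) := by
    rw [Finset.sum_mul]
    exact Finset.sum_congr rfl fun l _ => by ring
  rw [this]
  ring

lemma norm_comp_circleMap_le (h : IsRegularSemiclassical (polyW z) (polyV z ρ) w) {x y H : ℝ}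
    (hxy : |y - x| ≤ 1) (k : Fin m) (hk : ∀ θ ∈ uIcc x y, circleMap 0 1 θ ≠ z k)
    (hl : ∀ θ ∈ uIcc x y, ∀ l ≠ k, circleMap 0 1 θ ≠ z l)
    (hH : ∀ θ ∈ uIcc x y, ∑ l ∈ Finset.univ.erase k, ‖ρ l‖ / ‖circleMap 0 1 θ - z l‖ ≤ H)
    (hHd : H * |y - x| ≤ 1 / 2) :
    ‖w (circleMap 0 1 x)‖ ≤ 2 * Real.exp (2 * Real.pi * |(ρ k).im|) *
      (‖circleMap 0 1 x - z k‖ / ‖circleMap 0 1 y - z k‖) ^ (ρ k).re * ‖w (circleMap 0 1 y)‖ := by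
  refine norm_le_of_fuchsian (u := fun θ => w (circleMap 0 1 θ)) hxy hk (fun θ hθ =>
    h.hasDerivAt_comp_circleMap ?_ k) (fun θ hθ => ?_) hHd
  · rintro ⟨l, hl'⟩
    by_cases hlk : l = k
    · exact hk θ hθ (hlk ▸ hl'.symm)
    · exact hl θ hθ l hlk hl'.symm
  · refine le_trans ?_ (hH θ hθ)
    rw [norm_mul, norm_mul, norm_circleMap_zero, abs_one, Complex.norm_I, one_mul, one_mul]
    refine (norm_sum_le _ _).trans (le_of_eq ?_)
    exact Finset.sum_congr rfl fun l _ => norm_div _ _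

/-- If the exponent at a singular point on the circle has nonpositive real part, then the weight
vanishes next to this point. -/
lemma eq_zero_of_re_nonpos (h : IsRegularSemiclassical (polyW z) (polyV z ρ) w) {α y H : ℝ}
    (hαy : α ≠ y) (hxy : |y - α| ≤ 1) (k : Fin m) (hk : z k = circleMap 0 1 α)
    (hl : ∀ θ ∈ uIcc α y, ∀ l ≠ k, circleMap 0 1 θ ≠ z l)
    (hH : ∀ θ ∈ uIcc α y, ∑ l ∈ Finset.univ.erase k, ‖ρ l‖ / ‖circleMap 0 1 θ - z l‖ ≤ H)
    (hHd : H * |y - α| ≤ 1 / 2) (hρ : (ρ k).re ≤ 0) : w (circleMap 0 1 y) = 0 := by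
  by_contra hy0
  have hpi := Real.pi_gt_three
  have hkne : ∀ θ ∈ uIcc α y, θ ≠ α → circleMap 0 1 θ ≠ z k := by
    intro θ hθ hne he
    rw [hk] at he
    refine hne (circleMap_eq_iff_of_abs_sub_lt ?_ he)
    have := abs_sub_left_of_mem_uIcc hθ
    linarith
  have hq : 0 < ‖circleMap 0 1 y - z k‖ :=
    norm_pos_iff.mpr (sub_ne_zero.mpr (hkne y right_mem_uIcc hαy.symm))
  set C := 2 * Real.exp (2 * Real.pi * |(ρ k).im|) with hC
  have hC0 : 0 < C := by positivity
  -- A chord of the unit circle has length at most 2, so r₀ is a lower bound for the ratio of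
  -- distances occurring in the comparison.
  set r₀ := ‖circleMap 0 1 y - z k‖ / 2 with hr₀
  have hr0 : 0 < r₀ := by positivity
  have hH0 : 0 ≤ H := (Finset.sum_nonneg fun l _ => by positivity).trans (hH α left_mem_uIcc)
  have hlow : ∀ θ ∈ uIcc α y, θ ≠ α →
      ‖w (circleMap 0 1 y)‖ ≤ C * r₀ ^ (ρ k).re * ‖w (circleMap 0 1 θ)‖ := by
    intro θ hθ hne
    have hsub : uIcc y θ ⊆ uIcc α y := uIcc_subset_uIcc right_mem_uIcc hθ
    have habs : |θ - y| ≤ |y - α| := by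
      rw [abs_sub_comm θ y]; exact abs_sub_right_of_mem_uIcc hθ
    have hα : ∀ θ' ∈ uIcc y θ, θ' ≠ α := by
      rintro θ' hθ' rfl
      rcases le_total θ' y with h1 | h1
      · rw [uIcc_of_le h1] at hθ
        have h2 : θ' < θ := lt_of_le_of_ne hθ.1 hne.symm
        have h3 : θ' < y := lt_of_le_of_ne h1 hαy
        rw [mem_uIcc] at hθ'
        rcases hθ' with h4 | h4 <;> linarith [h4.1, h4.2]
      · rw [uIcc_of_ge h1] at hθ
        have h2 : θ < θ' := lt_of_le_of_ne hθ.2 hne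
        have h3 : y < θ' := lt_of_le_of_ne h1 hαy.symm
        rw [mem_uIcc] at hθ'
        rcases hθ' with h4 | h4 <;> linarith [h4.1, h4.2]
    refine (h.norm_comp_circleMap_le (habs.trans hxy) k
      (fun θ' hθ' => hkne θ' (hsub hθ') (hα θ' hθ')) (fun θ' hθ' => hl θ' (hsub hθ'))
      (fun θ' hθ' => hH θ' (hsub hθ')) ((mul_le_mul_of_nonneg_left habs hH0).trans hHd)).trans ?_
    refine mul_le_mul_of_nonneg_right (mul_le_mul_of_nonneg_left
      (Real.rpow_le_rpow_of_nonpos hr0 ?_ hρ) hC0.le) (norm_nonneg _)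
    have hθk : 0 < ‖circleMap 0 1 θ - z k‖ :=
      norm_pos_iff.mpr (sub_ne_zero.mpr (hkne θ hθ hne))
    rw [hr₀]
    refine div_le_div_of_nonneg_left hq.le hθk ?_
    refine (norm_sub_le _ _).trans ?_
    rw [hk]; simp; norm_num
  set c₁ := ‖w (circleMap 0 1 y)‖ / (C * r₀ ^ (ρ k).re) with hc₁
  have hden : 0 < C * r₀ ^ (ρ k).re := mul_pos hC0 (Real.rpow_pos_of_pos hr0 _)
  have hc₁0 : 0 < c₁ := div_pos (norm_pos_iff.mpr hy0) hden
  have hlow' : ∀ θ ∈ uIcc α y, θ ≠ α →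
      c₁ * ‖(θ - α)⁻¹‖ ≤ ‖w (circleMap 0 1 θ) / (circleMap 0 1 θ - z k)‖ := by
    intro θ hθ hne
    have h1 : c₁ ≤ ‖w (circleMap 0 1 θ)‖ := by
      rw [hc₁, div_le_iff₀ hden, mul_comm]; exact hlow θ hθ hne
    have h2 : ‖circleMap 0 1 θ - z k‖ ≤ |θ - α| := by
      have := (lipschitzWith_circleMap 0 1).dist_le_mul θ α
      rw [hk, ← dist_eq_norm, ← Real.dist_eq]
      simpa using this
    have h3 : 0 < ‖circleMap 0 1 θ - z k‖ :=
      norm_pos_iff.mpr (sub_ne_zero.mpr (hkne θ hθ hne))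
    rw [norm_div, norm_inv, Real.norm_eq_abs, ← div_eq_mul_inv]
    gcongr
  have hint : IntervalIntegrable
      (fun θ => w (circleMap 0 1 θ) / (circleMap 0 1 θ - z k)) volume α y := by
    refine Function.Periodic.intervalIntegrable (T := 2 * Real.pi) (t := 0) ?_
      (by positivity) ?_ α y
    · intro θ
      simp only [periodic_circleMap 0 1 θ]
    · rw [zero_add]
      exact h.integrable_div k
  -- A nonzero value at y keeps |w| bounded below up to α; then integrability of w/(ζ-z_k) would
  -- make 1/(θ-α) integrable at α.
  have hbad : IntervalIntegrable (fun θ : ℝ => (θ - α)⁻¹) volume α y := by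
    refine (hint.norm.const_mul c₁⁻¹).mono_fun' ?_ ?_
    · exact ((measurable_id.sub_const α).inv).aestronglyMeasurable
    · rw [EventuallyLE, ae_restrict_iff' measurableSet_uIoc]
      filter_upwards [(countable_singleton α).ae_notMem volume] with θ hθ hmem
      rw [← div_eq_inv_mul, le_div_iff₀ hc₁0, mul_comm]
      exact hlow' θ (uIoc_subset_uIcc hmem) hθ
  rw [intervalIntegrable_sub_inv_iff] at hbad
  rcases hbad with h1 | h1
  · exact hαy h1
  · exact h1 left_mem_uIcc

end IsRegularSemiclassical

end Biorth

/-! ### Deformed weights: estimates far from and near the moving singular points -/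

namespace Biorth
open Filter Topology Asymptotics MeasureTheory Set

/-- A family of regular semi-classical weights deformed along moving singular points. -/
structure IsDeformation {𝕜 : Type*} [RCLike 𝕜] [NormedAlgebra 𝕜 ℂ] {m : ℕ} (S : Set 𝕜)
    (ρ : Fin m → ℂ) (z : 𝕜 → Fin m → ℂ) (w : 𝕜 → ℂ → ℂ) : Prop where
  isOpen : IsOpen S
  contDiffOn : ∀ j, ContDiffOn 𝕜 1 (fun t => z t j) S
  semiclassical : ∀ t ∈ S, IsRegularSemiclassical (polyW (z t)) (polyV (z t) ρ) (w t)
  hasDerivAt : ∀ t ∈ S, ∀ ζ ∈ Metric.sphere (0 : ℂ) 1, (∀ j, ζ ≠ z t j) →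
    HasDerivAt (fun s => w s ζ)
      (-(∑ j, ρ j * (deriv (fun s => z s j) t / (ζ - z t j))) * w t ζ) t

namespace IsDeformation

variable {𝕜 : Type*} [RCLike 𝕜] [NormedAlgebra 𝕜 ℂ] {m : ℕ} {S : Set 𝕜} {ρ : Fin m → ℂ}
  {z : 𝕜 → Fin m → ℂ} {w : 𝕜 → ℂ → ℂ} {t : 𝕜}

lemma hasDerivAt_singular (h : IsDeformation S ρ z w) {s : 𝕜} (hs : s ∈ S) (k : Fin m) :
    HasDerivAt (fun s => z s k) (deriv (fun s => z s k) s) s :=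
  (((h.contDiffOn k).differentiableOn one_ne_zero).differentiableAt
    (h.isOpen.mem_nhds hs)).hasDerivAt

lemma continuousAt_singular (h : IsDeformation S ρ z w) (ht : t ∈ S) (k : Fin m) :
    ContinuousAt (fun s => z s k) t := (h.hasDerivAt_singular ht k).continuousAt

lemma exists_lipschitz (h : IsDeformation S ρ z w) (ht : t ∈ S) :
    ∃ M > 0, ∃ η > 0, Metric.ball t η ⊆ S ∧ ∀ s ∈ Metric.ball t η, ∀ k,
      ‖deriv (fun s => z s k) s‖ ≤ M ∧ ‖z s k - z t k‖ ≤ M * ‖s - t‖ := by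
  set M := 1 + ∑ k, ‖deriv (fun s => z s k) t‖ with hM
  have hev : ∀ᶠ s in 𝓝 t, s ∈ S ∧ ∀ k, ‖deriv (fun s => z s k) s‖ ≤ M := by
    refine Eventually.and (h.isOpen.mem_nhds ht) (eventually_all.mpr fun k => ?_)
    have hc : ContinuousAt (deriv fun s => z s k) t :=
      ((h.contDiffOn k).continuousOn_deriv_of_isOpen h.isOpen le_rfl).continuousAt
        (h.isOpen.mem_nhds ht)
    refine (hc.norm.eventually (gt_mem_nhds (?_ : ‖deriv (fun s => z s k) t‖ < M))).mono
      fun s hs => hs.le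
    have := Finset.single_le_sum (f := fun k => ‖deriv (fun s => z s k) t‖)
      (fun _ _ => norm_nonneg _) (Finset.mem_univ k)
    linarith
  obtain ⟨η, hη, hball⟩ := Metric.eventually_nhds_iff_ball.mp hev
  have hM0 : 0 < M := by
    have : 0 ≤ ∑ k, ‖deriv (fun s => z s k) t‖ := Finset.sum_nonneg fun _ _ => norm_nonneg _
    linarith
  refine ⟨M, hM0, η, hη, fun s hs => (hball s hs).1, fun s hs k => ⟨(hball s hs).2 k, ?_⟩⟩
  exact (convex_ball t η).norm_image_sub_le_of_norm_hasDerivWithin_le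
    (fun x hx => (h.hasDerivAt_singular (hball x hx).1 k).hasDerivWithinAt)
    (fun x hx => (hball x hx).2 k) (Metric.mem_ball_self hη) hs

/-- Control of the deformed weight at distance `≳ ‖s - t‖` from the singular points. -/
lemma exists_far_bound (h : IsDeformation S ρ z w) (ht : t ∈ S) :
    ∃ M > 0, ∃ R > 0, ∃ η > 0, Metric.ball t η ⊆ S ∧ ∀ s ∈ Metric.ball t η,
      ∀ ζ ∈ Metric.sphere (0 : ℂ) 1, (∀ k, ζ ≠ z t k) → (∀ k, R * ‖s - t‖ ≤ ‖ζ - z t k‖) →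
      ‖w s ζ‖ ≤ 2 * ‖w t ζ‖ ∧
      ‖w s ζ - w t ζ‖ ≤ M * (∑ k, ‖ρ k‖ * ‖w t ζ / (ζ - z t k)‖) * ‖s - t‖ := by
  obtain ⟨M, hM, η, hη, hS, hz⟩ := h.exists_lipschitz ht
  set A := ∑ k, ‖ρ k‖ with hA
  have hA0 : 0 ≤ A := Finset.sum_nonneg fun _ _ => norm_nonneg _
  -- The term 2M keeps every z_k(x) within half the distance from ζ to z_k(t); the term 8MA makes
  -- the coefficient bound times the diameter 2‖s-t‖ at most 1/2.
  set R := 2 * M + 8 * M * A with hR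
  have hR0 : 0 < R := by positivity
  refine ⟨4 * M, by positivity, R, hR0, η, hη, hS, fun s hs ζ hζ hne hfar => ?_⟩
  set K := Metric.closedBall t ‖s - t‖ with hK
  have hKη : K ⊆ Metric.ball t η := Metric.closedBall_subset_ball (by
    rwa [Metric.mem_ball, dist_eq_norm] at hs)
  have hsK : s ∈ K := by rw [hK, Metric.mem_closedBall, dist_eq_norm]
  have htK : t ∈ K := Metric.mem_closedBall_self (norm_nonneg _)
  have hpos : ∀ k, 0 < ‖ζ - z t k‖ := fun k => norm_pos_iff.mpr (sub_ne_zero.mpr (hne k))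
  have hdist : ∀ x ∈ K, ∀ k, ‖ζ - z t k‖ / 2 ≤ ‖ζ - z x k‖ := by
    intro x hx k
    have h1 := (hz x (hKη hx) k).2
    have h2 : ‖x - t‖ ≤ ‖s - t‖ := by rwa [← dist_eq_norm]
    have h3 : M * ‖x - t‖ ≤ M * ‖s - t‖ := mul_le_mul_of_nonneg_left h2 hM.le
    have h4 : 2 * M * ‖s - t‖ ≤ R * ‖s - t‖ :=
      mul_le_mul_of_nonneg_right (by rw [hR]; have := mul_nonneg hM.le hA0; linarith)
        (norm_nonneg _)
    have h5 := hfar k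
    have h6 : ‖ζ - z t k‖ ≤ ‖ζ - z x k‖ + ‖z x k - z t k‖ := by
      simpa using norm_add_le (ζ - z x k) (z x k - z t k)
    linarith
  have hne' : ∀ x ∈ K, ∀ k, ζ ≠ z x k := fun x hx k => sub_ne_zero.mp (norm_pos_iff.mp
    (lt_of_lt_of_le (by have := hpos k; positivity) (hdist x hx k)))
  set G := ∑ k, ‖ρ k‖ * (2 * M / ‖ζ - z t k‖) with hG
  have hG0 : 0 ≤ G := Finset.sum_nonneg fun k _ => by positivity
  set f' : 𝕜 → ℂ := fun x => -(∑ j, ρ j * (deriv (fun s => z s j) x / (ζ - z x j))) * w x ζ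
  have hd : ∀ x ∈ K, HasDerivWithinAt (fun s => w s ζ) (f' x) K x := fun x hx =>
    (h.hasDerivAt x (hS (hKη hx)) ζ hζ (hne' x hx)).hasDerivWithinAt
  have hb : ∀ x ∈ K, ‖f' x‖ ≤ G * ‖w x ζ‖ := by
    intro x hx
    rw [norm_mul, norm_neg]
    refine mul_le_mul_of_nonneg_right ((norm_sum_le _ _).trans (Finset.sum_le_sum fun k _ => ?_))
      (norm_nonneg _)
    rw [norm_mul, norm_div]
    refine mul_le_mul_of_nonneg_left ?_ (norm_nonneg _)
    have h1 := (hz x (hKη hx) k).1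
    have h2 := hdist x hx k
    have h3 := hpos k
    calc ‖deriv (fun s => z s k) x‖ / ‖ζ - z x k‖ ≤ M / (‖ζ - z t k‖ / 2) := by gcongr
      _ = 2 * M / ‖ζ - z t k‖ := by field_simp
  have hGs : G * (2 * ‖s - t‖) ≤ 1 / 2 := by
    rw [hG, Finset.sum_mul]
    have : ∀ k, ‖ρ k‖ * (2 * M / ‖ζ - z t k‖) * (2 * ‖s - t‖) ≤ ‖ρ k‖ * (4 * M / R) := by
      intro k
      rw [mul_assoc]
      refine mul_le_mul_of_nonneg_left ?_ (norm_nonneg _)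
      have h3 := hpos k
      rw [div_mul_eq_mul_div, div_le_div_iff₀ h3 hR0]
      have := mul_le_mul_of_nonneg_left (hfar k) (by positivity : 0 ≤ 4 * M)
      linarith
    refine (Finset.sum_le_sum fun k _ => this k).trans ?_
    rw [← Finset.sum_mul, ← hA, ← mul_div_assoc, div_le_iff₀ hR0, hR]
    linarith
  have hcomp : ∀ x ∈ K, ‖w x ζ‖ ≤ 2 * ‖w t ζ‖ := by
    have : ProperSpace 𝕜 := FiniteDimensional.proper_rclike 𝕜 𝕜
    intro x hx
    refine norm_le_two_mul_of_norm_deriv_le (f := fun s => w s ζ) (isCompact_closedBall t _)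
      (convex_closedBall t _) hG0 hd hb (fun x hx y hy => ?_) hx htK
    refine (mul_le_mul_of_nonneg_left ?_ hG0).trans hGs
    rw [← dist_eq_norm, two_mul]
    exact (dist_triangle_right x y t).trans (add_le_add hx hy)
  refine ⟨hcomp s hsK, ?_⟩
  have := (convex_closedBall t ‖s - t‖).norm_image_sub_le_of_norm_hasDerivWithin_le hd
    (fun x hx => (hb x hx).trans (mul_le_mul_of_nonneg_left (hcomp x hx) hG0)) htK hsK
  refine this.trans (mul_le_mul_of_nonneg_right (le_of_eq ?_) (norm_nonneg _))
  rw [hG, Finset.sum_mul, Finset.mul_sum]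
  refine Finset.sum_congr rfl fun k _ => ?_
  rw [norm_div]
  ring

/-- For fixed ζ the deformation equation is linear in w, so a zero persists while the poles stay
away; the far bound ‖w_s‖ ≤ 2‖w_t‖ expresses this. -/
lemma eventually_eq_zero (h : IsDeformation S ρ z w) (ht : t ∈ S) {ζ : ℂ}
    (hζ : ζ ∈ Metric.sphere (0 : ℂ) 1) (hne : ∀ k, ζ ≠ z t k) (h0 : w t ζ = 0) :
    ∀ᶠ s in 𝓝 t, w s ζ = 0 := by
  obtain ⟨M, -, R, -, η, hη, -, hfar⟩ := h.exists_far_bound ht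
  have h1 : ∀ᶠ s in 𝓝 t, ∀ k, R * ‖s - t‖ ≤ ‖ζ - z t k‖ := by
    refine eventually_all.mpr fun k => ?_
    have hc : ContinuousAt (fun s : 𝕜 => R * ‖s - t‖) t := by fun_prop
    refine (hc.eventually (gt_mem_nhds ?_)).mono fun s hs => hs.le
    simpa [sub_eq_zero] using hne k
  filter_upwards [h1, Metric.ball_mem_nhds t hη] with s hs hsη
  have := (hfar s hsη ζ hζ hne hs).1
  rw [h0, norm_zero, mul_zero] at this
  exact norm_le_zero_iff.mp this

/-- The deformed weights vanish uniformly at a singular point on the circle. -/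
lemma eventually_norm_le_near (h : IsDeformation S ρ z w) (ht : t ∈ S) {k : Fin m}
    (hk : z t k ∈ Metric.sphere (0 : ℂ) 1) {ε : ℝ} (hε : 0 < ε) :
    ∀ᶠ p in 𝓝 t ×ˢ 𝓝 (z t k), p.2 ∈ Metric.sphere (0 : ℂ) 1 → p.2 ≠ z p.1 k →
      ‖w p.1 p.2‖ ≤ ε := by
  obtain ⟨α, hα⟩ : ∃ α, circleMap 0 1 α = z t k := by
    rw [← abs_one, ← range_circleMap] at hk
    exact hk
  have hinj := (h.semiclassical t ht).injective
  have hpi := Real.pi_gt_three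
  have hne : ∀ l ≠ k, circleMap 0 1 α - z t l ≠ 0 := fun l hl => by
    rw [hα]; exact sub_ne_zero.mpr (hinj.ne hl.symm)
  have hcont : ∀ l, ContinuousAt (fun p : 𝕜 × ℝ => circleMap 0 1 p.2 - z p.1 l) (t, α) := fun l =>
    ((continuous_circleMap 0 1).continuousAt.comp continuousAt_snd).sub
      ((h.continuousAt_singular ht l).comp (f := Prod.fst) (x := (t, α)) continuousAt_fst)
  set g : 𝕜 × ℝ → ℝ := fun p =>
    ∑ l ∈ Finset.univ.erase k, ‖ρ l‖ / ‖circleMap 0 1 p.2 - z p.1 l‖ with hg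
  have hgc : ContinuousAt g (t, α) := by
    refine tendsto_finsetSum _ fun l hl => ?_
    exact (tendsto_const_nhds).div (hcont l).norm.tendsto
      (norm_ne_zero_iff.mpr (hne l (Finset.ne_of_mem_erase hl)))
  set H := g (t, α) + 1 with hH
  have hH1 : 1 ≤ H := by
    have : 0 ≤ g (t, α) := Finset.sum_nonneg fun l _ => by positivity
    linarith
  have hev : ∀ᶠ p in 𝓝 (t, α), (g p ≤ H ∧ ∀ l, l ≠ k → circleMap 0 1 p.2 ≠ z p.1 l) := by
    refine ((hgc.eventually (gt_mem_nhds (lt_add_one _))).mono fun p hp => hp.le).and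
      (eventually_all.mpr fun l => ?_)
    by_cases hl : l = k
    · exact Eventually.of_forall fun p hp => absurd hl hp
    · filter_upwards [(hcont l).eventually_ne (hne l hl)] with p hp _
      exact sub_ne_zero.mp hp
  rw [nhds_prod_eq] at hev
  obtain ⟨U, hU, V, hV, hUV⟩ := eventually_prod_iff.mp hev
  obtain ⟨δ₀, hδ₀, hball⟩ := Metric.eventually_nhds_iff_ball.mp hV
  -- Arcs between points within δ of α have length at most 2δ; this choice, with H ≥ 1, meets both
  -- the length bound 1 and the bound 1/2 on H times length.
  set δ := min (δ₀ / 2) (1 / (8 * H)) with hδdef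
  have hδ : 0 < δ := by positivity
  have hδ1 : δ < δ₀ := (min_le_left _ _).trans_lt (by linarith)
  have hHδ : H * (2 * δ) ≤ 1 / 4 := by
    have : δ ≤ 1 / (8 * H) := min_le_right _ _
    rw [le_div_iff₀ (by positivity)] at this
    linarith
  have hδ2 : 2 * δ ≤ 1 / 4 := by nlinarith
  have hgood : ∀ s, U s → ∀ θ, |θ - α| ≤ δ → g (s, θ) ≤ H ∧
      ∀ l, l ≠ k → circleMap 0 1 θ ≠ z s l := fun s hs θ hθ =>
    hUV hs (hball θ (by rw [Metric.mem_ball, Real.dist_eq]; linarith))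
  have harc : ∀ x y, |x - α| ≤ δ → |y - α| ≤ δ → ∀ θ ∈ uIcc x y, |θ - α| ≤ δ := by
    intro x y hx hy θ hθ
    rw [abs_le] at hx hy ⊢
    rw [mem_uIcc] at hθ
    constructor <;> rcases hθ with h | h <;> linarith [h.1, h.2]
  set C := 2 * Real.exp (2 * Real.pi * |(ρ k).im|) with hC
  set T : ℝ → 𝕜 × ℂ → ℝ := fun y p =>
    C * (‖p.2 - z p.1 k‖ / ‖circleMap 0 1 y - z p.1 k‖) ^ (ρ k).re * ‖w p.1 (circleMap 0 1 y)‖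
    with hT
  have hT0 : ∀ y p, 0 ≤ T y p := fun y p => by positivity
  have hbound : ∀ s, U s → s ∈ S → ∀ θ, |θ - α| ≤ δ → ∀ y, |y - α| ≤ δ →
      (∀ θ' ∈ uIcc θ y, circleMap 0 1 θ' ≠ z s k) →
      ‖w s (circleMap 0 1 θ)‖ ≤ T y (s, circleMap 0 1 θ) := by
    intro s hs hsS θ hθ y hy hzk
    have hyθ : |y - θ| ≤ 2 * δ := by
      rw [abs_le] at hθ hy ⊢
      constructor <;> linarith [hθ.1, hθ.2, hy.1, hy.2]
    refine (h.semiclassical s hsS).norm_comp_circleMap_le (by linarith) k hzk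
      (fun θ' hθ' => (hgood s hs θ' (harc _ _ hθ hy θ' hθ')).2)
      (fun θ' hθ' => (hgood s hs θ' (harc _ _ hθ hy θ' hθ')).1) ?_
    have := mul_le_mul_of_nonneg_left hyθ (by linarith : 0 ≤ H)
    linarith
  have htU : U t := hU.self_of_nhds
  have hTlim : ∀ y, y ≠ α → |y - α| ≤ δ → Tendsto (T y) (𝓝 t ×ˢ 𝓝 (z t k)) (𝓝 0) := by
    intro y hyα hy
    have hyk : circleMap 0 1 y ≠ z t k := by
      rw [← hα]
      exact fun he => hyα (circleMap_eq_iff_of_abs_sub_lt (by linarith) he)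
    have hyne : ∀ l, circleMap 0 1 y ≠ z t l := fun l => by
      by_cases hl : l = k
      · rw [hl]; exact hyk
      · exact (hgood t htU y hy).2 l hl
    have hmem := circleMap_mem_sphere_one y
    -- For a nonpositive exponent the weight is zero at the reference point y, hence also for nearby
    -- parameters, and T vanishes; for a positive exponent the distance factor tends to 0.
    rcases le_or_gt (ρ k).re 0 with hre | hre
    · have hα0 : |α - α| ≤ δ := by simpa using hδ.le
      have h0 : w t (circleMap 0 1 y) = 0 := by
        refine (h.semiclassical t ht).eq_zero_of_re_nonpos hyα.symm (by linarith) k hα.symm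
          (fun θ hθ => (hgood t htU θ (harc _ _ hα0 hy θ hθ)).2)
          (fun θ hθ => (hgood t htU θ (harc _ _ hα0 hy θ hθ)).1) ?_ hre
        have := mul_le_mul_of_nonneg_left hy (by linarith : 0 ≤ H)
        linarith
      refine tendsto_const_nhds.congr' ?_
      filter_upwards [(h.eventually_eq_zero ht hmem hyne h0).prod_inl _] with p hp
      simp [hT, hp]
    · have hz1 : Tendsto (fun p : 𝕜 × ℂ => z p.1 k) (𝓝 t ×ˢ 𝓝 (z t k)) (𝓝 (z t k)) :=
        (h.continuousAt_singular ht k).tendsto.comp tendsto_fst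
      have hw1 : Tendsto (fun p : 𝕜 × ℂ => w p.1 (circleMap 0 1 y)) (𝓝 t ×ˢ 𝓝 (z t k))
          (𝓝 (w t (circleMap 0 1 y))) :=
        (h.hasDerivAt t ht _ hmem hyne).continuousAt.tendsto.comp tendsto_fst
      have h1 := ((tendsto_snd.sub hz1).norm.div (tendsto_const_nhds.sub hz1).norm
        (norm_ne_zero_iff.mpr (sub_ne_zero.mpr hyk))).rpow_const
          (p := (ρ k).re) (Or.inr hre.le)
      have h2 := (h1.const_mul C).mul hw1.norm
      rw [sub_self, norm_zero, zero_div, Real.zero_rpow hre.ne', mul_zero, zero_mul] at h2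
      exact h2
  have hδα1 : |α + δ - α| ≤ δ := by rw [add_sub_cancel_left, abs_of_pos hδ]
  have hδα2 : |α - δ - α| ≤ δ := by rw [sub_sub_cancel_left, abs_neg, abs_of_pos hδ]
  have hlim := (hTlim (α + δ) (by linarith) hδα1).add (hTlim (α - δ) (by linarith) hδα2)
  rw [add_zero] at hlim
  have hcirc := eventually_exists_circleMap_eq α hδ
  rw [hα] at hcirc
  filter_upwards [hlim.eventually (gt_mem_nhds hε), hcirc.prod_inr _,
    (hU.and (h.isOpen.mem_nhds ht)).prod_inl _] with p hp hθ hUS hmem hne'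
  obtain ⟨θ, hθα, hθe⟩ := hθ hmem
  obtain ⟨s, ζ⟩ := p
  simp only at hθe hne' hUS hp ⊢
  subst hθe
  have hθ1 := abs_lt.mp hθα
  -- The comparison arc must avoid the moving pole. A pole on the circle can obstruct only one of
  -- the two arcs from θ to α ± δ, so one reference point always works.
  by_cases hcase : ∀ θ' ∈ uIcc θ (α + δ), circleMap 0 1 θ' ≠ z s k
  · have := hbound s hUS.1 hUS.2 θ hθα.le _ hδα1 hcase
    linarith [hT0 (α - δ) (s, circleMap 0 1 θ)]
  · push Not at hcase
    obtain ⟨θ₁, hθ₁, he₁⟩ := hcase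
    have hcase2 : ∀ θ' ∈ uIcc θ (α - δ), circleMap 0 1 θ' ≠ z s k := by
      intro θ₂ hθ₂ he₂
      rw [uIcc_of_le (by linarith)] at hθ₁
      rw [uIcc_of_ge (by linarith)] at hθ₂
      have h12 : θ₁ = θ₂ := by
        refine circleMap_eq_iff_of_abs_sub_lt ?_ (he₁.trans he₂.symm)
        rw [abs_lt]
        constructor <;> linarith [hθ₁.1, hθ₁.2, hθ₂.1, hθ₂.2]
      have : θ = θ₁ := le_antisymm hθ₁.1 (h12 ▸ hθ₂.2)
      exact hne' (this ▸ he₁)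
    have := hbound s hUS.1 hUS.2 θ hθα.le _ hδα2 hcase2
    linarith [hT0 (α + δ) (s, circleMap 0 1 θ)]

lemma vanishesAtSingular (h : IsDeformation S ρ z w) (ht : t ∈ S) :
    IsRegularSemiclassical.VanishesAtSingular (z t) (w t) := by
  intro k hk
  rw [tendsto_zero_iff_norm_tendsto_zero, Metric.tendsto_nhds]
  intro ε hε
  have h1 := h.eventually_norm_le_near ht hk (half_pos hε)
  have h2 : Tendsto (fun ζ : ℂ => (t, ζ)) (𝓝 (z t k)) (𝓝 t ×ˢ 𝓝 (z t k)) :=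
    tendsto_const_nhds.prodMk tendsto_id
  filter_upwards [nhdsWithin_le_nhds (h2.eventually h1), self_mem_nhdsWithin] with ζ hζ hmem
  have := hζ hmem.1 hmem.2
  simp only [dist_zero_right, norm_norm] at this ⊢
  linarith

end IsDeformation

end Biorth

/-! ### Differentiation under the integral with moving singularities -/

namespace Biorth
open Filter Topology Asymptotics MeasureTheory Set

/-- The part of the circle inside a small disc has small length. -/
lemma volume_circleMap_preimage_ball_le (a : ℂ) {r : ℝ} (hr : 0 ≤ r) :
    volume.restrict (Ioc 0 (2 * Real.pi)) {θ | ‖circleMap 0 1 θ - a‖ < r} ≤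
      ENNReal.ofReal (6 * Real.pi * r) := by
  have hmeas : MeasurableSet {θ : ℝ | ‖circleMap 0 1 θ - a‖ < r} :=
    measurableSet_lt (by fun_prop) measurable_const
  rw [Measure.restrict_apply hmeas]
  rcases ({θ : ℝ | ‖circleMap 0 1 θ - a‖ < r} ∩ Ioc 0 (2 * Real.pi)).eq_empty_or_nonempty
    with he | ⟨θ₀, h₀, hmem₀⟩
  · rw [he]; simp
  have hpi := Real.pi_pos
  -- Any two such points are less than 2r apart. Jordan's inequality turns this into an angle below
  -- πr modulo 2π; the shifts by ±2π handle wrap-around, and three intervals of length 2πr give the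
  -- constant 6π.
  have hsub : {θ : ℝ | ‖circleMap 0 1 θ - a‖ < r} ∩ Ioc 0 (2 * Real.pi) ⊆
      Metric.ball θ₀ (Real.pi * r) ∪ Metric.ball (θ₀ + 2 * Real.pi) (Real.pi * r) ∪
        Metric.ball (θ₀ - 2 * Real.pi) (Real.pi * r) := by
    rintro θ ⟨hθ, hmem⟩
    have h1 : ‖circleMap 0 1 θ - circleMap 0 1 θ₀‖ < 2 * r := by
      have h2 := norm_sub_le (circleMap 0 1 θ - a) (circleMap 0 1 θ₀ - a)
      rw [sub_sub_sub_cancel_right] at h2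
      have : ‖circleMap 0 1 θ - a‖ < r := hθ
      have : ‖circleMap 0 1 θ₀ - a‖ < r := h₀
      linarith
    have h2 : circleMap 0 1 θ - circleMap 0 1 θ₀ =
        circleMap 0 1 θ₀ * (Complex.exp (Complex.I * ((θ - θ₀ : ℝ) : ℂ)) - 1) := by
      rw [circleMap_zero, circleMap_zero, mul_sub, mul_one, mul_assoc, ← Complex.exp_add]
      push_cast
      ring_nf
    rw [h2, norm_mul, norm_circleMap_zero, abs_one, one_mul,
      Complex.norm_exp_I_mul_ofReal_sub_one, norm_mul, Real.norm_eq_abs, abs_two,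
      Real.norm_eq_abs] at h1
    set x := (θ - θ₀) / 2 with hx
    have h3 : |Real.sin x| < r := by linarith
    have key : ∀ y : ℝ, |y| ≤ Real.pi / 2 → |Real.sin y| < r → 2 * |y| < Real.pi * r := by
      intro y hy hs
      have h4 := (Real.mul_abs_le_abs_sin hy).trans_lt hs
      rw [div_mul_eq_mul_div, div_lt_iff₀ hpi] at h4
      linarith
    have habs : ∀ y : ℝ, 2 * |y| = |2 * y| := fun y => by rw [abs_mul, abs_two]
    simp only [mem_union, Metric.mem_ball, Real.dist_eq]
    rcases lt_or_ge (Real.pi / 2) x with hc | hc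
    · left; right
      have := key (x - Real.pi) (by rw [abs_le]; constructor <;> linarith [hmem.2, hmem₀.1])
        (by rw [Real.sin_sub_pi, abs_neg]; exact h3)
      rw [habs] at this
      convert this using 2
      rw [hx]; ring
    · rcases lt_or_ge x (-(Real.pi / 2)) with hc' | hc'
      · right
        have := key (x + Real.pi) (by rw [abs_le]; constructor <;> linarith [hmem.1, hmem₀.2])
          (by rw [Real.sin_add_pi, abs_neg]; exact h3)
        rw [habs] at this
        convert this using 2
        rw [hx]; ring
      · left; left
        have := key x (abs_le.mpr ⟨hc', hc⟩) h3
        rw [habs] at this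
        convert this using 2
        rw [hx]; ring
  refine (measure_mono hsub).trans ((measure_union_le _ _).trans
    ((add_le_add (measure_union_le _ _) le_rfl).trans ?_))
  rw [Real.volume_ball, Real.volume_ball, Real.volume_ball,
    ← ENNReal.ofReal_add (by positivity) (by positivity),
    ← ENNReal.ofReal_add (by positivity) (by positivity)]
  exact ENNReal.ofReal_le_ofReal (by linarith)

namespace IsDeformation

variable {𝕜 : Type*} [RCLike 𝕜] [NormedAlgebra 𝕜 ℂ] {m : ℕ} {S : Set 𝕜} {ρ : Fin m → ℂ}
  {z : 𝕜 → Fin m → ℂ} {w : 𝕜 → ℂ → ℂ} {t : 𝕜}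

/-- Near a singular point on the circle both weights are uniformly small. If z_k(t) is off the
circle, no point of the circle is close enough once s is near t. -/
lemma eventually_near_bound (h : IsDeformation S ρ z w) (ht : t ∈ S) (R : ℝ) {ε : ℝ}
    (hε : 0 < ε) :
    ∀ᶠ s in 𝓝 t, ∀ ζ ∈ Metric.sphere (0 : ℂ) 1, ζ ∉ range (z s) → ζ ∉ range (z t) →
      (∃ k, ‖ζ - z t k‖ < R * ‖s - t‖) → ‖w s ζ - w t ζ‖ ≤ ε := by
  have hR : ∀ d > 0, ∀ᶠ s in 𝓝 t, R * ‖s - t‖ < d := by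
    intro d hd
    have hc : ContinuousAt (fun s : 𝕜 => R * ‖s - t‖) t := by fun_prop
    exact hc.eventually (gt_mem_nhds (by simpa using hd))
  have hk : ∀ k, ∀ᶠ s in 𝓝 t, ∀ ζ ∈ Metric.sphere (0 : ℂ) 1, ζ ≠ z s k → ζ ≠ z t k →
      ‖ζ - z t k‖ < R * ‖s - t‖ → ‖w s ζ - w t ζ‖ ≤ ε := by
    intro k
    by_cases hmem : z t k ∈ Metric.sphere (0 : ℂ) 1
    · obtain ⟨U, hU, V, hV, hUV⟩ := eventually_prod_iff.mp
        (h.eventually_norm_le_near ht hmem (half_pos hε))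
      obtain ⟨d, hd, hball⟩ := Metric.eventually_nhds_iff_ball.mp hV
      filter_upwards [hU, hR d hd] with s hs hsd ζ hζ h1 h2 h3
      have hV' : V ζ := hball ζ (by rw [Metric.mem_ball, dist_eq_norm]; exact h3.trans hsd)
      have e1 := hUV hs hV' hζ h1
      have e2 := hUV hU.self_of_nhds hV' hζ h2
      have := norm_sub_le (w s ζ) (w t ζ)
      simp only at e1 e2
      linarith
    · have hd : 0 < |‖z t k‖ - 1| := abs_pos.mpr (sub_ne_zero.mpr fun h => hmem (by simpa using h))
      filter_upwards [hR _ hd] with s hs ζ hζ _ _ h3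
      exfalso
      have h4 := abs_norm_sub_norm_le (z t k) ζ
      rw [mem_sphere_zero_iff_norm.mp hζ, norm_sub_rev] at h4
      linarith
  filter_upwards [eventually_all.mpr hk] with s hs ζ hζ h1 h2 ⟨k, h3⟩
  exact hs k ζ hζ (fun e => h1 ⟨k, e.symm⟩) (fun e => h2 ⟨k, e.symm⟩) h3

/-- Differentiation under the integral sign for a weight with moving singular points. -/
theorem hasDerivAt_circMean (h : IsDeformation S ρ z w) (ht : t ∈ S) {c : ℂ → ℂ}
    (hc : ContinuousOn c (Metric.sphere 0 1)) :
    HasDerivAt (fun s => circMean fun ζ => w s ζ * c ζ)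
      (-∑ j, ρ j * (deriv (fun s => z s j) t) * circMean fun ζ => w t ζ / (ζ - z t j) * c ζ) t := by
  obtain ⟨M, hM, R, hR, η, hη, hball, hfar⟩ := h.exists_far_bound ht
  have hsemi := h.semiclassical t ht
  set μ : Measure ℝ := volume.restrict (Ioc 0 (2 * Real.pi)) with hμ
  have hpi := Real.pi_pos
  have h2pi : (0 : ℝ) ≤ 2 * Real.pi := by positivity
  have hcirc : ∀ f : ℂ → ℂ, circMean f = (2 * Real.pi : ℂ)⁻¹ * ∫ θ, f (circleMap 0 1 θ) ∂μ :=
    fun f => by rw [circMean_eq_integral, intervalIntegral.integral_of_le h2pi]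
  have hint : ∀ {f : ℂ → ℂ}, CircleIntegrable f 0 1 →
      Integrable (fun θ => f (circleMap 0 1 θ)) μ := fun hf =>
    (intervalIntegrable_iff_integrableOn_Ioc_of_le h2pi).mp hf
  set wdot : ℂ → ℂ := fun ζ =>
    -(∑ j, ρ j * (deriv (fun s => z s j) t / (ζ - z t j))) * w t ζ with hwdot
  have hterm : ∀ j, CircleIntegrable (fun ζ => w t ζ / (ζ - z t j) * c ζ) 0 1 := fun j =>
    circleIntegrable_mul (hsemi.integrable_div j) hc
  have hval : -∑ j, ρ j * (deriv (fun s => z s j) t) *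
      circMean (fun ζ => w t ζ / (ζ - z t j) * c ζ) = circMean fun ζ => wdot ζ * c ζ := by
    simp only [← circMean_const_mul]
    rw [← circMean_sum Finset.univ
      (f := fun j ζ => ρ j * (deriv (fun s => z s j) t) * (w t ζ / (ζ - z t j) * c ζ))
      fun j _ => (hterm j).const_smul (a := ρ j * (deriv (fun s => z s j) t)), ← neg_one_mul,
      ← circMean_const_mul]
    congr 1; funext ζ
    simp only [hwdot]
    rw [neg_one_mul, neg_mul, neg_mul, Finset.sum_mul, Finset.sum_mul]
    congr 1
    exact Finset.sum_congr rfl fun j _ => by ring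
  obtain ⟨Cc, hCc⟩ := (isCompact_sphere (0 : ℂ) 1).exists_bound_of_continuousOn hc
  have hCc0 : 0 ≤ Cc := (norm_nonneg _).trans (hCc 1 (by simp))
  have hcθ : ∀ θ : ℝ, ‖c (circleMap 0 1 θ)‖ ≤ Cc := fun θ => hCc _ (circleMap_mem_sphere_one θ)
  rw [hval, hasDerivAt_iff_tendsto_slope]
  -- Angles within R‖s-t‖ of a singular point. The set has measure O(‖s-t‖) and the increment of the
  -- weight on it tends uniformly to 0, so its share of the difference quotient vanishes; the
  -- complement is left to dominated convergence.
  set A : 𝕜 → Set ℝ := fun s => {θ | ∃ k, ‖circleMap 0 1 θ - z t k‖ < R * ‖s - t‖} with hA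
  have hAm : ∀ s, MeasurableSet (A s) := by
    intro s
    rw [hA]
    simp only [ofPred_exists]
    exact MeasurableSet.iUnion fun k => measurableSet_lt (by fun_prop) measurable_const
  set Q : 𝕜 → ℝ → ℂ := fun s θ =>
    (s - t)⁻¹ • (w s (circleMap 0 1 θ) * c (circleMap 0 1 θ)
      - w t (circleMap 0 1 θ) * c (circleMap 0 1 θ)) with hQ
  have hwi : ∀ s ∈ S, Integrable (fun θ => w s (circleMap 0 1 θ) * c (circleMap 0 1 θ)) μ :=
    fun s hs => hint (circleIntegrable_mul (h.semiclassical s hs).integrable hc)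
  have hQi : ∀ s ∈ S, Integrable (Q s) μ := fun s hs =>
    ((hwi s hs).sub (hwi t ht)).smul (s - t)⁻¹
  have hSnear : ∀ᶠ s in 𝓝[≠] t, s ∈ S :=
    nhdsWithin_le_nhds (h.isOpen.mem_nhds ht)
  have hslope : ∀ᶠ s in 𝓝[≠] t, (2 * Real.pi : ℂ)⁻¹ *
      ((∫ θ in A s, Q s θ ∂μ) + ∫ θ, (A s)ᶜ.indicator (Q s) θ ∂μ) =
        slope (fun s => circMean fun ζ => w s ζ * c ζ) t s := by
    filter_upwards [hSnear] with s hs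
    rw [integral_indicator (hAm s).compl, integral_add_compl (hAm s) (hQi s hs), slope_def_module,
      hcirc, hcirc, ← mul_sub, ← integral_sub (hwi s hs) (hwi t ht), ← mul_smul_comm,
      ← integral_smul]
  refine Tendsto.congr' hslope ?_
  rw [hcirc]
  refine Tendsto.const_mul _ ?_
  rw [← zero_add (∫ θ, wdot (circleMap 0 1 θ) * c (circleMap 0 1 θ) ∂μ)]
  have hae : ∀ s, ∀ᵐ θ ∂μ, circleMap 0 1 θ ∉ range (z s) := fun s =>
    ae_restrict_of_ae (ae_circleMap_notMem (finite_range (z s)).countable)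
  refine Tendsto.add ?_ ?_
  · rw [Metric.tendsto_nhds]
    intro ε hε
    -- The estimate comes out as (ε/K)(K-1), and the added 1 makes this strictly less than ε.
    set K := Cc * (m * (6 * Real.pi * R)) + 1 with hK
    have hK0 : 0 < K := by positivity
    filter_upwards [nhdsWithin_le_nhds (h.eventually_near_bound ht R (div_pos hε hK0)),
      self_mem_nhdsWithin, hSnear] with s hs hst hsS
    have hst0 : 0 < ‖s - t‖ := norm_pos_iff.mpr (sub_ne_zero.mpr hst)
    rw [dist_zero_right]
    have hμA : μ.real (A s) ≤ m * (6 * Real.pi * (R * ‖s - t‖)) := by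
      have h1 : μ (A s) ≤ ∑ k : Fin m, ENNReal.ofReal (6 * Real.pi * (R * ‖s - t‖)) := by
        have : A s = ⋃ k, {θ | ‖circleMap 0 1 θ - z t k‖ < R * ‖s - t‖} := by
          rw [hA]; simp only [ofPred_exists]
        rw [this]
        refine (measure_iUnion_fintype_le _ _).trans (Finset.sum_le_sum fun k _ => ?_)
        exact volume_circleMap_preimage_ball_le _ (by positivity)
      rw [← ENNReal.ofReal_sum_of_nonneg (fun _ _ => by positivity)] at h1
      have h2 := ENNReal.toReal_le_of_le_ofReal (Finset.sum_nonneg fun _ _ => by positivity) h1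
      simpa [Measure.real] using h2
    have hbd : ‖∫ θ in A s, Q s θ ∂μ‖ ≤ (‖s - t‖⁻¹ * (ε / K * Cc)) * μ.real (A s) := by
      refine norm_setIntegral_le_of_norm_le_const_ae (measure_lt_top μ _) ?_
      rw [ae_restrict_iff' (hAm s)]
      filter_upwards [hae s, hae t] with θ h1 h2 h3
      rw [hQ]
      simp only
      rw [norm_smul, norm_inv, ← sub_mul, norm_mul]
      have := hs _ (circleMap_mem_sphere_one θ) h1 h2 h3
      have := hcθ θ
      gcongr
    refine hbd.trans_lt ?_
    have : (‖s - t‖⁻¹ * (ε / K * Cc)) * μ.real (A s) ≤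
        (‖s - t‖⁻¹ * (ε / K * Cc)) * (m * (6 * Real.pi * (R * ‖s - t‖))) := by gcongr
    refine this.trans_lt ?_
    have e : (‖s - t‖⁻¹ * (ε / K * Cc)) * (m * (6 * Real.pi * (R * ‖s - t‖))) =
        ε / K * (K - 1) := by
      rw [hK]; field_simp; ring
    rw [e, mul_sub, div_mul_cancel₀ _ hK0.ne', mul_one]
    have := div_pos hε hK0
    linarith
  -- The far bound dominates the quotients by the functions w/(ζ-z_k), integrable by
  -- `integrable_div`. Almost every angle eventually leaves A s, so the pointwise limit is the
  -- deformation equation.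
  · refine tendsto_integral_filter_of_dominated_convergence
      (fun θ => M * (∑ k, ‖ρ k‖ * ‖w t (circleMap 0 1 θ) / (circleMap 0 1 θ - z t k)‖) * Cc)
      ?_ ?_ ?_ ?_
    · filter_upwards [hSnear] with s hs
      exact (hQi s hs).aestronglyMeasurable.indicator (hAm s).compl
    · filter_upwards [self_mem_nhdsWithin, nhdsWithin_le_nhds (Metric.ball_mem_nhds t hη)]
        with s hst hsη
      have hst0 : 0 < ‖s - t‖ := norm_pos_iff.mpr (sub_ne_zero.mpr hst)
      filter_upwards [hae t] with θ hθ
      by_cases hθA : θ ∈ A s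
      · rw [indicator_of_notMem (by simpa using hθA), norm_zero]
        positivity
      · rw [indicator_of_mem (by simpa using hθA), hQ]
        simp only
        have hne : ∀ k, circleMap 0 1 θ ≠ z t k := fun k e => hθ ⟨k, e.symm⟩
        have hfar' : ∀ k, R * ‖s - t‖ ≤ ‖circleMap 0 1 θ - z t k‖ := fun k => by
          by_contra! hlt
          exact hθA ⟨k, hlt⟩
        have h1 := (hfar s hsη _ (circleMap_mem_sphere_one θ) hne hfar').2
        rw [norm_smul, norm_inv, ← sub_mul, norm_mul, ← mul_assoc]
        have h2 : ‖s - t‖⁻¹ * ‖w s (circleMap 0 1 θ) - w t (circleMap 0 1 θ)‖ ≤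
            M * (∑ k, ‖ρ k‖ * ‖w t (circleMap 0 1 θ) / (circleMap 0 1 θ - z t k)‖) := by
          rw [inv_mul_le_iff₀ hst0, mul_comm]; exact h1
        have := hcθ θ
        gcongr
    · refine ((integrable_finsetSum _ fun k _ => ?_).const_mul M).mul_const Cc
      exact ((hint (hsemi.integrable_div k)).norm.const_mul _)
    · filter_upwards [hae t] with θ hθ
      have hne : ∀ k, circleMap 0 1 θ ≠ z t k := fun k e => hθ ⟨k, e.symm⟩
      have hev : ∀ᶠ s in 𝓝[≠] t, θ ∈ (A s)ᶜ := by
        have : ∀ᶠ s in 𝓝 t, ∀ k, R * ‖s - t‖ < ‖circleMap 0 1 θ - z t k‖ := by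
          refine eventually_all.mpr fun k => ?_
          have hcc : ContinuousAt (fun s : 𝕜 => R * ‖s - t‖) t := by fun_prop
          refine hcc.eventually (gt_mem_nhds ?_)
          simpa [sub_eq_zero] using hne k
        filter_upwards [nhdsWithin_le_nhds this] with s hs
        rintro ⟨k, hk⟩
        exact absurd hk (hs k).le.not_gt
      have hd := (h.hasDerivAt t ht _ (circleMap_mem_sphere_one θ) hne)
      have hd' := (hasDerivAt_iff_tendsto_slope.mp hd).mul_const (c (circleMap 0 1 θ))
      refine hd'.congr' ?_
      filter_upwards [hev] with s hs
      rw [indicator_of_mem hs, hQ, slope_def_module]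
      simp only
      rw [smul_mul_assoc, sub_mul]

end IsDeformation

end Biorth

/-! ### Derivatives along the deformation and the final assembly -/

namespace Biorth
open Filter Topology MeasureTheory Set

namespace IsDeformation

variable {𝕜 : Type*} [RCLike 𝕜] [NormedAlgebra 𝕜 ℂ] {m : ℕ} {S : Set 𝕜} {ρ : Fin m → ℂ}
  {z : 𝕜 → Fin m → ℂ} {w : 𝕜 → ℂ → ℂ} {t : 𝕜}

/-- The derivative of the bilinear moments along the deformation. -/
lemma hasDerivAt_pairing (h : IsDeformation S ρ z w) (ht : t ∈ S) (p q : ℂ[X]) :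
    HasDerivAt (fun s => pairing (w s) p q)
      (-∑ j, ρ j * (deriv (fun s => z s j) t) * cauchyPairing (w t) (z t j) p q) t := by
  have hc : ContinuousOn (fun ζ : ℂ => p.eval ζ * q.eval ζ⁻¹) (Metric.sphere 0 1) :=
    p.continuous.continuousOn.mul (continuousOn_eval_inv q)
  refine ((h.hasDerivAt_circMean ht hc).congr_of_eventuallyEq ?_).congr_deriv ?_
  · filter_upwards [h.isOpen.mem_nhds ht] with s hs
    rw [pairing_apply (h.semiclassical s hs).integrable]
    simp only [mul_assoc]
  · congr 1
    refine Finset.sum_congr rfl fun j _ => ?_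
    rw [cauchyPairing, pairing_apply ((h.semiclassical t ht).integrable_div j)]
    simp only [mul_assoc]

lemma hasDerivAt_reflCoeff {n : ℕ} {φ φbar : 𝕜 → ℕ → ℂ[X]} (h : IsDeformation S ρ z w)
    (hφ : ∀ t ∈ S, IsBiorthonormal (w t) (n + 1) (φ t) (φbar t)) (ht : t ∈ S) :
    HasDerivAt (fun s => reflCoeff (φ s) (n + 1))
      (kappa (φ t) n / kappa (φ t) (n + 1) * ∑ j, ρ j * (deriv (fun s => z s j) t) *
        cauchyPairing (w t) (z t j) (φ t (n + 1)) (reflect n (φ t n))) t := by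
  refine (Biorth.hasDerivAt_reflCoeff (B := fun s => pairing (w s)) (φbar := φbar)
    (h.hasDerivAt_pairing ht) ?_
    (isToeplitz_pairing (h.semiclassical t ht).integrable)).congr_deriv (by ring)
  filter_upwards [h.isOpen.mem_nhds ht] with s hs
  exact (hφ s hs).isToeplitzBiorth (h.semiclassical s hs).integrable

/-- The flipped form exchanges φ and φbar while preserving the leading coefficients, so the formula
for r transfers with the arguments of β_j swapped. -/
lemma hasDerivAt_reflCoeffBar {n : ℕ} {φ φbar : 𝕜 → ℕ → ℂ[X]} (h : IsDeformation S ρ z w)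
    (hφ : ∀ t ∈ S, IsBiorthonormal (w t) (n + 1) (φ t) (φbar t)) (ht : t ∈ S) :
    HasDerivAt (fun s => reflCoeffBar (φ s) (φbar s) (n + 1))
      (kappa (φ t) n / kappa (φ t) (n + 1) * ∑ j, ρ j * (deriv (fun s => z s j) t) *
        cauchyPairing (w t) (z t j) (reflect n (φbar t n)) (φbar t (n + 1))) t := by
  have hT : ∀ s ∈ S, IsToeplitzBiorth (pairing (w s)) (n + 1) (φ s) (φbar s) := fun s hs =>
    (hφ s hs).isToeplitzBiorth (h.semiclassical s hs).integrable
  have key := Biorth.hasDerivAt_reflCoeff (B := fun s => (pairing (w s)).flip) (φ := φbar)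
    (φbar := φ) (fun p q => h.hasDerivAt_pairing ht q p)
    (by filter_upwards [h.isOpen.mem_nhds ht] with s hs using (hT s hs).flip)
    (isToeplitz_pairing (h.semiclassical t ht).integrable).flip
  rw [(hT t ht).kappa_bar le_rfl, (hT t ht).kappa_bar (Nat.le_succ n)] at key
  refine (key.congr_of_eventuallyEq ?_).congr_deriv (by ring)
  filter_upwards [h.isOpen.mem_nhds ht] with s hs
  rw [reflCoeffBar, reflCoeff, (hT s hs).kappa_bar le_rfl]

/-- The values D_j of the spectral coefficients carry a factor 2z_j, which cancels ½ and 1/z_j. The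
index j₀ drops out because z_{j₀} is constant, and injectivity makes every other z_j nonzero. -/
lemma logDeriv_sum_eq (h : IsDeformation S ρ z w) {j₀ : Fin m} (hz₀ : ∀ t ∈ S, z t j₀ = 0)
    (ht : t ∈ S) {k k' a : ℂ} {β D : Fin m → ℂ} (ha : a / k' ≠ 0) (hk' : k' ≠ 0)
    (hD : ∀ j, z t j ≠ 0 → D j = 2 * z t j * (k / a) * β j) :
    (k / k' * ∑ j, ρ j * (deriv (fun s => z s j) t) * β j) / (a / k') =
      1 / 2 * ∑ j ∈ Finset.univ.erase j₀, ρ j * (deriv (fun s => z s j) t / z t j) * D j := by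
  have hd : deriv (fun s => z s j₀) t = 0 := by
    have : (fun s => z s j₀) =ᶠ[𝓝 t] fun _ => 0 := by
      filter_upwards [h.isOpen.mem_nhds ht] with s hs using hz₀ s hs
    rw [this.deriv_eq, deriv_const]
  have ha0 : a ≠ 0 := fun h => ha (by rw [h, zero_div])
  rw [← Finset.add_sum_erase _ _ (Finset.mem_univ j₀), hd, mul_zero, zero_mul, zero_add,
    Finset.mul_sum, Finset.sum_div, Finset.mul_sum]
  refine Finset.sum_congr rfl fun j hj => ?_
  have hzj : z t j ≠ 0 := by
    rw [← hz₀ t ht]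
    exact (h.semiclassical t ht).injective.ne (Finset.ne_of_mem_erase hj)
  rw [hD j hzj]
  field_simp

end IsDeformation

end Biorth

end

/-- The logarithmic derivatives of the reflection coefficients with respect to a real or complex
deformation parameter `t`. The index `n + 1` here runs over all degrees `≥ 1`; the singular
point with index `j₀` is the one fixed at the origin. -/
theorem mainTheorem9 {𝕜 : Type*} [RCLike 𝕜] [NormedAlgebra 𝕜 ℂ] {m : ℕ} (n : ℕ)
    (S : Set 𝕜) (hS : IsOpen S)
    (ρ : Fin m → ℂ) (z : 𝕜 → Fin m → ℂ) (j₀ : Fin m)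
    (hz : ∀ j, ContDiffOn 𝕜 1 (fun t => z t j) S)
    (hz₀ : ∀ t ∈ S, z t j₀ = 0)
    (w : 𝕜 → ℂ → ℂ)
    (hw : ∀ t ∈ S, IsRegularSemiclassical (polyW (z t)) (polyV (z t) ρ) (w t))
    (hdef : ∀ t ∈ S, ∀ ζ ∈ Metric.sphere (0 : ℂ) 1, (∀ j, ζ ≠ z t j) →
      HasDerivAt (fun s => w s ζ)
        (-(∑ j, ρ j * (deriv (fun s => z s j) t / (ζ - z t j))) * w t ζ) t)
    (φ φbar : 𝕜 → ℕ → ℂ[X])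
    (hφ : ∀ t ∈ S, IsBiorthonormal (w t) (n + 1) (φ t) (φbar t))
    (t : 𝕜) (ht : t ∈ S) :
    (reflCoeff (φ t) (n + 1) ≠ 0 →
      (∃! Ω : ℂ[X], IsOmega (polyW (z t)) (polyV (z t) ρ) (w t) (φ t) n Ω) ∧
      ∀ Ω : ℂ[X], IsOmega (polyW (z t)) (polyV (z t) ρ) (w t) (φ t) n Ω →
        DifferentiableAt 𝕜 (fun s => reflCoeff (φ s) (n + 1)) t ∧
        deriv (fun s => reflCoeff (φ s) (n + 1)) t / reflCoeff (φ t) (n + 1) =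
          1 / 2 * ∑ j ∈ Finset.univ.erase j₀,
            ρ j * (deriv (fun s => z s j) t / z t j) *
              ((Ω.eval (z t j) - (polyV (z t) ρ).eval (z t j)) /
                (polyV (z t) ρ).eval (z t j))) ∧
    (reflCoeffBar (φ t) (φbar t) (n + 1) ≠ 0 →
      (∃! Ω : ℂ[X], IsOmegaStar (polyW (z t)) (polyV (z t) ρ) (w t) (φ t) (φbar t) n Ω) ∧
      ∀ Ω : ℂ[X], IsOmegaStar (polyW (z t)) (polyV (z t) ρ) (w t) (φ t) (φbar t) n Ω →
        DifferentiableAt 𝕜 (fun s => reflCoeffBar (φ s) (φbar s) (n + 1)) t ∧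
        deriv (fun s => reflCoeffBar (φ s) (φbar s) (n + 1)) t /
            reflCoeffBar (φ t) (φbar t) (n + 1) =
          1 / 2 * ∑ j ∈ Finset.univ.erase j₀,
            ρ j * (deriv (fun s => z s j) t / z t j) *
              ((Ω.eval (z t j) + (polyV (z t) ρ).eval (z t j)) /
                (polyV (z t) ρ).eval (z t j))) := by
  have h : IsDeformation S ρ z w := ⟨hS, hz, hw, hdef⟩
  have hlim := h.vanishesAtSingular ht
  have hT := (hφ t ht).isToeplitzBiorth (hw t ht).integrable
  have hk := hT.kappa_ne_zero (k := n + 1) le_rfl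
  refine ⟨fun hr => ?_, fun hr => ?_⟩
  · have hr0 : (φ t (n + 1)).eval 0 ≠ 0 := fun h0 => hr (by rw [reflCoeff, h0, zero_div])
    obtain ⟨hex, hval⟩ := isOmega_existsUnique (hw t ht) hlim (hφ t ht) (hz₀ t ht) hr0
    refine ⟨hex, fun Ω hΩ => ?_⟩
    have hd := h.hasDerivAt_reflCoeff hφ ht
    refine ⟨hd.differentiableAt, ?_⟩
    rw [hd.deriv]
    exact h.logDeriv_sum_eq hz₀ ht hr hk (hval Ω hΩ)
  · have hr0 : (φbar t (n + 1)).eval 0 ≠ 0 := fun h0 => hr (by rw [reflCoeffBar, h0, zero_div])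
    obtain ⟨hex, hval⟩ := isOmegaStar_existsUnique (hw t ht) hlim (hφ t ht) (hz₀ t ht) hr0
    refine ⟨hex, fun Ω hΩ => ?_⟩
    have hd := h.hasDerivAt_reflCoeffBar hφ ht
    refine ⟨hd.differentiableAt, ?_⟩
    rw [hd.deriv]
    exact h.logDeriv_sum_eq hz₀ ht hr hk (hval Ω hΩ)
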